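/- **Conventions.** An $\infty$-category is a quasi-category, and $\mathrm{Fun}(A,\mathcal C)$ is the simplicial set of maps $A\to\mathcal C$. An exact $\infty$-category is a triple $(\mathcal C,\mathcal M,\mathcal E)$, where $\mathcal C$ is an additive $\infty$-category and $\mathcal M,\mathcal E$ are subcategories of $\mathcal C$ (their morphisms are called cofibrations and fibrations) such that: (E1) $\mathcal M$ and $\mathcal E$ contain all equivalences; (E2) pushouts of cofibrations along arbitrary morphisms exist and are cofibrations, and pullbacks of fibrations along arbitrary morphisms exist and are fibrations; (E3) for every square in $\mathcal C$ with upper edge $g:x\to y$, right edge $f:y\to z$ and lower left corner a zero object, if $g\in\mathcal M$ and the square is coCartesian, then $f\in\mathcal E$ and the square is Cartesian, and if $f\in\mathcal E$ and the square is Cartesian, then $g\in\mathcal M$ and the square is coCartesian. Let $T_2$ be the poset of pairs $ij$ with $0\le i\le j\le 2$, where $ij\le i'j'$ if and only if $i\le i'$ and $j\le j'$. Let $\mathcal D$ be an $\infty$-category with two classes of morphisms, called cofibrations and fibrations. For $k\ge 1$, let $S_2^{(k)}\mathcal D$ be the full simplicial subset of $\mathrm{Fun}(N(T_2^k),\mathcal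 D)$ spanned by the functors $F$ that satisfy the following conditions. 1. $F(i_1j_1,\dots,i_kj_k)$ is a zero object if $i_l=j_l$ for some $l$. 2. For every coordinate $s$ and all fixed values of the other coordinates, $F(\dots,aj,\dots)\to F(\dots,aj',\dots)$ (in place $s$) is a cofibration for all $a\le j\le j'$. 3. For every coordinate $t$ and all fixed values of the other coordinates, $F(\dots,ia,\dots)\to F(\dots,i'a,\dots)$ (in place $t$) is a fibration for all $i\le i'\le a$. 4. For every coordinate $r$, all fixed values of the other coordinates and all $0\le p\le q\le 2$, the square with rows $F(\dots,0p,\dots)\to F(\dots,0q,\dots)$ and $F(\dots,pp,\dots)\to F(\dots,pq,\dots)$ (in place $r$) is coCartesian in $\mathcal D$. Put $S_2^{(0)}\mathcal D=\mathcal D$ and $S_2\mathcal D=S_2^{(1)}\mathcal D$. For $k\ge1$, a morphism $\alpha:F\to G$ of $S_2^{(k)}\mathcal D$ is a cofibration (resp. fibration) if $\alpha(v):F(v)\to G(v)$ is one in $\mathcal D$ for every $v\in T_2^k$. **Lemma.** Let $\mathcal C$ be an exact $\infty$-category and let $n\ge 1$. Currying along $N(T_2^n)\cong N(T_2)\times N(T_2^{n-1})$,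 that is, $R(F)(x)(y)=F(x,y)$, defines a map $$R:\ S_2^{(n)}\mathcal C\longrightarrow S_2\bigl(S_2^{(n-1)}\mathcal C\bigr),$$ and $R$ is a categorical equivalence. Here $S_2$ on the right is formed with respect to the pointwise cofibrations and fibrations of $S_2^{(n-1)}\mathcal C$ (those of $\mathcal C$ itself if $n=1$). -/

import Mathlib

open CategoryTheory MonoidalCategory CartesianMonoidalCategory Simplicial Opposite

universe u

noncomputable section

namespace ExInf

/-! ### Nerves of posets and functor quasi-categories -/

/-- The nerve of a preorder, placed in the universe `u`. -/
abbrev N (P : Type) [Preorder P] : SSet.{u} := nerve (ULift.{u} P)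

/-- The map of nerves induced by a monotone map. -/
def N.map {P Q : Type} [Preorder P] [Preorder Q] (f : P →o Q) : N.{u} P ⟶ N.{u} Q :=
  nerveMap (Monotone.functor (f := fun x : ULift.{u} P => ULift.up.{u} (f x.down))
    (fun _ _ h => f.monotone h))

/-- The vertex of the nerve given by an element. -/
def N.vertex {P : Type} [Preorder P] (x : P) : N.{u} P _⦋0⦌ :=
  ComposableArrows.mk₀ (ULift.up x)

/-- The edge of the nerve given by an inequality. -/
def N.edge {P : Type} [Preorder P] {x y : P} (h : x ≤ y) : N.{u} P _⦋1⦌ :=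
  ComposableArrows.mk₁ (X₀ := ULift.up.{u} x) (X₁ := ULift.up.{u} y) (homOfLE h)

/-- The simplicial set `Fun(A, C)` of maps from `A` to `C`. -/
abbrev Fun (A C : SSet.{u}) : SSet.{u} := (ihom A).obj C

/-- The map `A ⟶ C` corresponding to a vertex of `Fun(A, C)`. -/
def Fun.toHom {A C : SSet.{u}} (F : Fun A C _⦋0⦌) : A ⟶ C :=
  (ρ_ A).inv ≫ MonoidalClosed.uncurry ((SSet.unitHomEquiv (Fun A C)).symm F)

/-- Evaluation `Fun(A, C) ⟶ C` at a vertex of `A`. -/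
def Fun.evalAt {A C : SSet.{u}} (a : A _⦋0⦌) : Fun A C ⟶ C :=
  lift (SSet.const a) (𝟙 _) ≫ (ihom.ev A).app C

/-- The full simplicial subset spanned by the vertices satisfying `p`: it consists of all
simplices all of whose vertices satisfy `p`. -/
def fullSub (X : SSet.{u}) (p : X _⦋0⦌ → Prop) : X.Subcomplex where
  obj d := {s | ∀ f : ⦋0⦌ ⟶ d.unop, p (X.map f.op s)}
  map {d e} g s hs f := by
    have := hs (f ≫ g.unop)
    rwa [op_comp, Quiver.Hom.op_unop, Functor.map_comp_apply] at this

/-! ### Limits and colimits in a quasi-category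

For a poset `P` the nerve of the ordinal sum `P ⊕ₗ Fin (m + 1)` is the join `N(P) ⋆ Δ[m]`,
so an `m`-simplex of the slice `C_{p/}` of `p : N(P) ⟶ C` is a map
`N(P ⊕ₗ Fin (m + 1)) ⟶ C` that restricts to `p`. -/

open Sum in
/-- The simplicial subset `N(P) ⋆ ∂Δ[m]` of `N(P) ⋆ Δ[m]`. -/
def joinBoundary (P : Type) [Preorder P] (m : ℕ) :
    (N.{u} (P ⊕ₗ Fin (m + 1))).Subcomplex where
  obj _ := {s | ∃ j : Fin (m + 1), ∀ i, s.obj i ≠ ULift.up (inrₗ j)}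
  map g _ hs := hs.imp fun _ hj i => hj (g.unop.toOrderHom i)

open Sum in
/-- The simplicial subset `∂Δ[m] ⋆ N(P)` of `Δ[m] ⋆ N(P)`. -/
def boundaryJoin (P : Type) [Preorder P] (m : ℕ) :
    (N.{u} (Fin (m + 1) ⊕ₗ P)).Subcomplex where
  obj _ := {s | ∃ j : Fin (m + 1), ∀ i, s.obj i ≠ ULift.up (inlₗ j)}
  map g _ hs := hs.imp fun _ hj i => hj (g.unop.toOrderHom i)

open Sum in
/-- The inclusion `N(P) ⋆ {0} ⟶ N(P) ⋆ ∂Δ[m + 1]`. -/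
def joinZero (P : Type) [Preorder P] (m : ℕ) :
    N.{u} (P ⊕ₗ Fin 1) ⟶ (joinBoundary.{u} P (m + 1) : SSet.{u}) :=
  SSet.Subcomplex.lift
    (N.map ⟨fun x => toLex (Sum.map id (fun _ => (0 : Fin (m + 2))) (ofLex x)), by
      intro a b h
      induction a with | _ a => ?_
      induction b with | _ b => ?_
      rcases a with a | a <;> rcases b with b | b <;> simp_all⟩) (by
    rintro _ _ ⟨s, rfl⟩
    refine ⟨1, fun i h => ?_⟩
    have h' := congrArg ULift.down h
    change toLex (Sum.map id (fun _ => (0 : Fin (m + 2))) (ofLex (s.obj i).down)) =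
      toLex (Sum.inr 1) at h'
    rcases hx : ofLex (s.obj i).down with x | x <;> rw [hx] at h' <;> simp at h')

open Sum in
/-- The inclusion `{m + 1} ⋆ N(P) ⟶ ∂Δ[m + 1] ⋆ N(P)`. -/
def lastJoin (P : Type) [Preorder P] (m : ℕ) :
    N.{u} (Fin 1 ⊕ₗ P) ⟶ (boundaryJoin.{u} P (m + 1) : SSet.{u}) :=
  SSet.Subcomplex.lift
    (N.map ⟨fun x => toLex (Sum.map (fun _ => Fin.last (m + 1)) id (ofLex x)), by
      intro a b h
      induction a with | _ a => ?_
      induction b with | _ b => ?_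
      rcases a with a | a <;> rcases b with b | b <;> simp_all⟩) (by
    rintro _ _ ⟨s, rfl⟩
    refine ⟨0, fun i h => ?_⟩
    have h' := congrArg ULift.down h
    change toLex (Sum.map (fun _ => Fin.last (m + 1)) id (ofLex (s.obj i).down)) =
      toLex (Sum.inl 0) at h'
    rcases hx : ofLex (s.obj i).down with x | x <;> rw [hx] at h' <;> simp [Fin.ext_iff] at h')

/-- A cocone `σ : N(P) ⋆ Δ[0] ⟶ C` is a colimit cocone if it is an initial vertex of the slice
`C_{p/}` where `p` is the restriction of `σ` to `N(P)`: every map `∂Δ[m + 1] ⟶ C_{p/}` whose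
value at the vertex `0` is `σ` extends to `Δ[m + 1]`. -/
def IsColimitCocone {C : SSet.{u}} {P : Type} [Preorder P] (σ : N.{u} (P ⊕ₗ Fin 1) ⟶ C) : Prop :=
  ∀ (m : ℕ) (g : (joinBoundary.{u} P (m + 1) : SSet.{u}) ⟶ C), joinZero P m ≫ g = σ →
    ∃ h : N.{u} (P ⊕ₗ Fin (m + 2)) ⟶ C, (joinBoundary.{u} P (m + 1)).ι ≫ h = g

/-- A cone `σ : Δ[0] ⋆ N(P) ⟶ C` is a limit cone if it is a terminal vertex of the slice
`C_{/p}` where `p` is the restriction of `σ` to `N(P)`: every map `∂Δ[m + 1] ⟶ C_{/p}` whose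
value at the last vertex is `σ` extends to `Δ[m + 1]`. -/
def IsLimitCone {C : SSet.{u}} {P : Type} [Preorder P] (σ : N.{u} (Fin 1 ⊕ₗ P) ⟶ C) : Prop :=
  ∀ (m : ℕ) (g : (boundaryJoin.{u} P (m + 1) : SSet.{u}) ⟶ C), lastJoin P m ≫ g = σ →
    ∃ h : N.{u} (Fin (m + 2) ⊕ₗ P) ⟶ C, (boundaryJoin.{u} P (m + 1)).ι ≫ h = g

/-- Initial objects: colimits of the empty diagram. -/
def IsInitialVertex {C : SSet.{u}} (x : C _⦋0⦌) : Prop :=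
  IsColimitCocone (P := Empty) (SSet.const x)

/-- Terminal objects: limits of the empty diagram. -/
def IsTerminalVertex {C : SSet.{u}} (x : C _⦋0⦌) : Prop :=
  IsLimitCone (P := Empty) (SSet.const x)

/-- Zero objects. -/
def IsZeroVertex {C : SSet.{u}} (x : C _⦋0⦌) : Prop :=
  IsInitialVertex x ∧ IsTerminalVertex x

open Sum in
/-- The edges `i₁`, `i₂` exhibit `s` as a coproduct of `x` and `y`. The shape `Unit ⊕ Unit` is
the discrete poset with two elements. -/
def IsCoproduct {C : SSet.{u}} {x y s : C _⦋0⦌} (i₁ : SSet.Edge x s) (i₂ : SSet.Edge y s) : Prop :=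
  ∃ σ : N.{u} ((Unit ⊕ Unit) ⊕ₗ Fin 1) ⟶ C,
    σ.app _ (N.edge (Sum.Lex.inl_le_inr (inl ()) (0 : Fin 1))) = i₁.edge ∧
    σ.app _ (N.edge (Sum.Lex.inl_le_inr (inr ()) (0 : Fin 1))) = i₂.edge ∧
    IsColimitCocone σ

open Sum in
/-- The edges `p₁`, `p₂` exhibit `t` as a product of `x` and `y`. -/
def IsProduct {C : SSet.{u}} {x y t : C _⦋0⦌} (p₁ : SSet.Edge t x) (p₂ : SSet.Edge t y) : Prop :=
  ∃ σ : N.{u} (Fin 1 ⊕ₗ (Unit ⊕ Unit)) ⟶ C,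
    σ.app _ (N.edge (Sum.Lex.inl_le_inr (0 : Fin 1) (inl ()))) = p₁.edge ∧
    σ.app _ (N.edge (Sum.Lex.inl_le_inr (0 : Fin 1) (inr ()))) = p₂.edge ∧
    IsLimitCone σ

/-! ### Squares -/

/-- A square `Δ[1] × Δ[1] ⟶ C`. The element `(a, b)` stands for row `a` and column `b`. -/
abbrev Square (C : SSet.{u}) := N.{u} (Fin 2 × Fin 2) ⟶ C

namespace Square

variable {C : SSet.{u}} (σ : Square C)

/-- The edge from the upper left to the upper right corner. -/
def top : C _⦋1⦌ :=
  σ.app _ (N.edge (show ((0, 0) : Fin 2 × Fin 2) ≤ (0, 1) by decide))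

/-- The edge from the upper left to the lower left corner. -/
def left : C _⦋1⦌ :=
  σ.app _ (N.edge (show ((0, 0) : Fin 2 × Fin 2) ≤ (1, 0) by decide))

/-- The edge from the upper right to the lower right corner. -/
def right : C _⦋1⦌ :=
  σ.app _ (N.edge (show ((0, 1) : Fin 2 × Fin 2) ≤ (1, 1) by decide))

/-- The edge from the lower left to the lower right corner. -/
def bottom : C _⦋1⦌ :=
  σ.app _ (N.edge (show ((1, 0) : Fin 2 × Fin 2) ≤ (1, 1) by decide))

/-- The lower left corner. -/
def lowerLeft : C _⦋0⦌ := σ.app _ (N.vertex ((1, 0) : Fin 2 × Fin 2))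

end Square

/-- The square without its lower right corner, whose nerve is the horn `Λ[2, 0]`. -/
abbrev Span := {x : Fin 2 × Fin 2 // x ≠ (1, 1)}

/-- The square without its upper left corner, whose nerve is the horn `Λ[2, 2]`. -/
abbrev Cospan := {x : Fin 2 × Fin 2 // x ≠ (0, 0)}

/-- The identification of the cocone over the span shape with the square. -/
def spanCocone : Span ⊕ₗ Fin 1 →o Fin 2 × Fin 2 where
  toFun x := Sum.elim Subtype.val (fun _ => (1, 1)) (ofLex x)
  monotone' := by
    intro a b h
    induction a with | _ a => ?_
    induction b with | _ b => ?_
    rcases a with a | a <;> rcases b with b | b <;> simp_all [Prod.le_def]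
    all_goals omega

/-- The identification of the cone over the cospan shape with the square. -/
def cospanCone : Fin 1 ⊕ₗ Cospan →o Fin 2 × Fin 2 where
  toFun x := Sum.elim (fun _ => (0, 0)) Subtype.val (ofLex x)
  monotone' := by
    intro a b h
    induction a with | _ a => ?_
    induction b with | _ b => ?_
    rcases a with a | a <;> rcases b with b | b <;> simp_all [Prod.le_def]

/-- Cocartesian (pushout) squares. -/
def IsCocartesian {C : SSet.{u}} (σ : Square C) : Prop :=
  IsColimitCocone (N.map spanCocone ≫ σ)

/-- Cartesian (pullback) squares. -/
def IsCartesian {C : SSet.{u}} (σ : Square C) : Prop :=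
  IsLimitCone (N.map cospanCone ≫ σ)

/-! ### Additive quasi-categories -/

/-- An edge is an equivalence if it has a homotopy inverse. -/
def IsEquivalence {C : SSet.{u}} {x y : C _⦋0⦌} (e : SSet.Edge x y) : Prop :=
  Nonempty e.InvStruct

/-- `h` is a composite of `f` followed by `g`. -/
def IsComp {C : SSet.{u}} {x y z : C _⦋0⦌} (f : SSet.Edge x y) (g : SSet.Edge y z)
    (h : SSet.Edge x z) : Prop :=
  Nonempty (SSet.Edge.CompStruct f g h)

/-- An edge is a zero map if it factors through a zero object. -/
def IsZeroMap {C : SSet.{u}} {x y : C _⦋0⦌} (e : SSet.Edge x y) : Prop :=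
  ∃ (z : C _⦋0⦌) (a : SSet.Edge x z) (b : SSet.Edge z y), IsZeroVertex z ∧ IsComp a b e

/-- The map `f : s ⟶ t` has the matrix with rows `(e₁₁, e₁₂)` and `(e₂₁, e₂₂)` with respect to
the maps `i₁`, `i₂` into `s` and the maps `p₁`, `p₂` out of `t`: the composite `p_r f i_c` is
homotopic to `e_rc`. -/
def HasMatrix {C : SSet.{u}} {x y s t x' y' : C _⦋0⦌}
    (i₁ : SSet.Edge x s) (i₂ : SSet.Edge y s) (p₁ : SSet.Edge t x') (p₂ : SSet.Edge t y')
    (f : SSet.Edge s t) (e₁₁ : SSet.Edge x x') (e₁₂ : SSet.Edge y x')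
    (e₂₁ : SSet.Edge x y') (e₂₂ : SSet.Edge y y') : Prop :=
  ∃ (a : SSet.Edge x t) (b : SSet.Edge y t), IsComp i₁ f a ∧ IsComp i₂ f b ∧
    IsComp a p₁ e₁₁ ∧ IsComp b p₁ e₁₂ ∧ IsComp a p₂ e₂₁ ∧ IsComp b p₂ e₂₂

/-- Additive quasi-categories: there are a zero object, binary products and binary coproducts,
the canonical maps `x ⊔ y ⟶ x × y` are equivalences, and so are the shear maps. -/
structure IsAdditive (C : SSet.{u}) : Prop where
  exists_zero : ∃ x : C _⦋0⦌, IsZeroVertex x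
  exists_coproduct (x y : C _⦋0⦌) :
    ∃ (s : C _⦋0⦌) (i₁ : SSet.Edge x s) (i₂ : SSet.Edge y s), IsCoproduct i₁ i₂
  exists_product (x y : C _⦋0⦌) :
    ∃ (t : C _⦋0⦌) (p₁ : SSet.Edge t x) (p₂ : SSet.Edge t y), IsProduct p₁ p₂
  canonical {x y s t : C _⦋0⦌} {i₁ : SSet.Edge x s} {i₂ : SSet.Edge y s}
    {p₁ : SSet.Edge t x} {p₂ : SSet.Edge t y} (hi : IsCoproduct i₁ i₂) (hp : IsProduct p₁ p₂)
    {o₁ : SSet.Edge y x} {o₂ : SSet.Edge x y} (h₁ : IsZeroMap o₁) (h₂ : IsZeroMap o₂)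
    (f : SSet.Edge s t)
    (hf : HasMatrix i₁ i₂ p₁ p₂ f (SSet.Edge.id x) o₁ o₂ (SSet.Edge.id y)) : IsEquivalence f
  shear {x s t : C _⦋0⦌} {i₁ i₂ : SSet.Edge x s} {p₁ p₂ : SSet.Edge t x}
    (hi : IsCoproduct i₁ i₂) (hp : IsProduct p₁ p₂)
    {o : SSet.Edge x x} (ho : IsZeroMap o) (f : SSet.Edge s t)
    (hf : HasMatrix i₁ i₂ p₁ p₂ f (SSet.Edge.id x) (SSet.Edge.id x) o (SSet.Edge.id x)) :
    IsEquivalence f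

/-! ### Exact quasi-categories -/

/-- A simplicial set with two sets of edges, called cofibrations and fibrations. A subcategory
of a quasi-category that contains all objects is determined by its set of edges. -/
structure Triple where
  carrier : SSet.{u}
  cof : Set (carrier _⦋1⦌)
  fib : Set (carrier _⦋1⦌)

/-- A triple is an exact quasi-category. -/
structure IsExact (X : Triple.{u}) : Prop where
  quasicategory : SSet.Quasicategory X.carrier
  additive : IsAdditive X.carrier
  cof_comp {x y z : X.carrier _⦋0⦌} {f : SSet.Edge x y} {g : SSet.Edge y z} {h : SSet.Edge x z} :
    IsComp f g h → f.edge ∈ X.cof → g.edge ∈ X.cof → h.edge ∈ X.cof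
  fib_comp {x y z : X.carrier _⦋0⦌} {f : SSet.Edge x y} {g : SSet.Edge y z} {h : SSet.Edge x z} :
    IsComp f g h → f.edge ∈ X.fib → g.edge ∈ X.fib → h.edge ∈ X.fib
  cof_of_equivalence {x y : X.carrier _⦋0⦌} {e : SSet.Edge x y} :
    IsEquivalence e → e.edge ∈ X.cof
  fib_of_equivalence {x y : X.carrier _⦋0⦌} {e : SSet.Edge x y} :
    IsEquivalence e → e.edge ∈ X.fib
  exists_pushout {x y z : X.carrier _⦋0⦌} (f : SSet.Edge x y) (g : SSet.Edge x z) :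
    f.edge ∈ X.cof →
      ∃ σ : Square X.carrier, σ.top = f.edge ∧ σ.left = g.edge ∧ IsCocartesian σ
  cof_pushout (σ : Square X.carrier) : IsCocartesian σ → σ.top ∈ X.cof → σ.bottom ∈ X.cof
  exists_pullback {y z w : X.carrier _⦋0⦌} (f : SSet.Edge y w) (g : SSet.Edge z w) :
    f.edge ∈ X.fib →
      ∃ σ : Square X.carrier, σ.right = f.edge ∧ σ.bottom = g.edge ∧ IsCartesian σ
  fib_pullback (σ : Square X.carrier) : IsCartesian σ → σ.right ∈ X.fib → σ.left ∈ X.fib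
  of_cocartesian (σ : Square X.carrier) : IsZeroVertex σ.lowerLeft → σ.top ∈ X.cof →
    IsCocartesian σ → σ.right ∈ X.fib ∧ IsCartesian σ
  of_cartesian (σ : Square X.carrier) : IsZeroVertex σ.lowerLeft → σ.right ∈ X.fib →
    IsCartesian σ → σ.top ∈ X.cof ∧ IsCocartesian σ

/-! ### The multi-directional `S`-construction -/

/-- The poset `T_n` of pairs `i ≤ j` in `[n]`, that is, the arrow category of `[n]`. -/
abbrev T (n : ℕ) := {x : Fin (n + 1) × Fin (n + 1) // x.1 ≤ x.2}

/-- The element `ij` of `T_n`. -/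
def T.mk {n : ℕ} (i j : Fin (n + 1)) (h : i ≤ j) : T n := ⟨(i, j), h⟩

lemma T.mk_le {n : ℕ} {i j i' j' : Fin (n + 1)} {h : i ≤ j} {h' : i' ≤ j'} (hi : i ≤ i')
    (hj : j ≤ j') : T.mk i j h ≤ T.mk i' j' h' := ⟨hi, hj⟩

/-- The square in `T_n` with rows `0p ⟶ 0q` and `pp ⟶ pq`. -/
def T.square {n : ℕ} (p q : Fin (n + 1)) (h : p ≤ q) : Fin 2 × Fin 2 →o T n where
  toFun x := T.mk (if x.1 = 0 then 0 else p) (if x.2 = 0 then p else q) (by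
    split_ifs <;> simp [h])
  monotone' := by
    rintro ⟨a, b⟩ ⟨a', b'⟩ ⟨h₁, h₂⟩
    apply T.mk_le
    · fin_cases a <;> fin_cases a' <;> simp_all
    · fin_cases b <;> fin_cases b' <;> simp_all

/-- The map `T_n ⟶ T_n ^ k` which inserts the `r`-th coordinate, the other coordinates being
those of `v`. -/
def T.insert {n k : ℕ} (v : Fin k → T n) (r : Fin k) : T n →o (Fin k → T n) where
  toFun x := Function.update v r x
  monotone' _ _ h := update_le_update_iff.2 ⟨h, fun _ _ => le_rfl⟩

/-- The conditions on a diagram `F : N(T_n ^ k) ⟶ C` to be a vertex of `S_n^{(k)} C`. The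
conditions on rows, columns and squares concern one coordinate of `T_n ^ k` at a time, while
the other coordinates are kept fixed. -/
structure IsExDiagram (X : Triple.{u}) (n k : ℕ) (F : N.{u} (Fin k → T n) ⟶ X.carrier) : Prop where
  zero (v : Fin k → T n) (l : Fin k) (h : (v l).1.1 = (v l).1.2) :
    IsZeroVertex (F.app _ (N.vertex v))
  horizontal (v : Fin k → T n) (s : Fin k) {a j j' : Fin (n + 1)} (h : a ≤ j) (h' : j ≤ j') :
    F.app _ (N.edge ((T.insert v s).monotone
      (T.mk_le (h := h) (h' := h.trans h') le_rfl h'))) ∈ X.cof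
  vertical (v : Fin k → T n) (t : Fin k) {i i' a : Fin (n + 1)} (h : i ≤ i') (h' : i' ≤ a) :
    F.app _ (N.edge ((T.insert v t).monotone
      (T.mk_le (h := h.trans h') (h' := h') h le_rfl))) ∈ X.fib
  cocartesian (v : Fin k → T n) (r : Fin k) {p q : Fin (n + 1)} (h : p ≤ q) :
    IsCocartesian (N.map ((T.insert v r).comp (T.square p q h)) ≫ F)

/-- The full simplicial subset `Ex_∞(N(T_n ^ k), C)` of `Fun(N(T_n ^ k), C)`. -/
def exSub (X : Triple.{u}) (n k : ℕ) : (Fun (N.{u} (Fin k → T n)) X.carrier).Subcomplex :=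
  fullSub _ fun F => IsExDiagram X n k (Fun.toHom F)

/-- The simplicial set `Ex_∞(N(T_n ^ k), C)` with the pointwise cofibrations and fibrations. -/
def Ex (n k : ℕ) (X : Triple.{u}) : Triple.{u} where
  carrier := exSub X n k
  cof := {α | ∀ v : Fin k → T n,
    ((exSub X n k).ι ≫ Fun.evalAt (N.vertex v)).app _ α ∈ X.cof}
  fib := {α | ∀ v : Fin k → T n,
    ((exSub X n k).ι ≫ Fun.evalAt (N.vertex v)).app _ α ∈ X.fib}

/-- `S_n^{(k)} C`, that is, `Ex_∞(N(T_n ^ k), C)` with the convention `S_n^{(0)} C = C`. -/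
def S (n k : ℕ) (X : Triple.{u}) : Triple.{u} :=
  match k with
  | 0 => X
  | k + 1 => Ex n (k + 1) X

/-- The evaluation map `N(T_n ^ k) × S_n^{(k)} C ⟶ C`, `(v, F) ↦ F(v)`. -/
def S.eval (n k : ℕ) (X : Triple.{u}) :
    N.{u} (Fin k → T n) ⊗ (S n k X).carrier ⟶ X.carrier :=
  match k with
  | 0 => snd _ X.carrier
  | k + 1 => (_ ◁ (exSub X n (k + 1)).ι) ≫ (ihom.ev _).app X.carrier

/-- The first coordinate, as a monotone map `T_n ^ (k + 1) ⟶ T_n ^ 1`. -/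
def T.head (n k : ℕ) : (Fin (k + 1) → T n) →o (Fin 1 → T n) where
  toFun v _ := v 0
  monotone' _ _ h _ := h 0

/-- The remaining coordinates, as a monotone map `T_n ^ (k + 1) ⟶ T_n ^ k`. -/
def T.tail (n k : ℕ) : (Fin (k + 1) → T n) →o (Fin k → T n) where
  toFun v i := v i.succ
  monotone' _ _ h i := h i.succ

/-- `R : S_n^{(k + 1)} C ⟶ S_n (S_n^{(k)} C)` is given by currying: `R(F)(x)(y) = F(x, y)` for
`x` in `N(T_n)` and `y` in `N(T_n ^ k)`, on simplices of every dimension. -/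
def IsCurrying (n k : ℕ) (X : Triple.{u})
    (R : (S n (k + 1) X).carrier ⟶ (S n 1 (S n k X)).carrier) : Prop :=
  lift (fst _ _ ≫ N.map (T.tail n k)) ((N.map (T.head n k) ⊗ₘ R) ≫ S.eval n 1 (S n k X)) ≫
    S.eval n k X = S.eval n (k + 1) X

/-! ### Categorical equivalences -/

/-- The maps `f` and `g` are naturally equivalent, as witnessed by a map out of the product with
the nerve of the walking isomorphism. -/
def NatEquivalent {X Y : SSet.{u}} (f g : X ⟶ Y) : Prop :=
  ∃ H : X ⊗ SSet.coherentIso.{u} ⟶ Y,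
    lift (𝟙 X) (SSet.const SSet.coherentIso.x₀) ≫ H = f ∧
    lift (𝟙 X) (SSet.const SSet.coherentIso.x₁) ≫ H = g

/-- A map of quasi-categories is a categorical equivalence if it has an inverse up to natural
equivalence. -/
def IsCategoricalEquivalence {X Y : SSet.{u}} (f : X ⟶ Y) : Prop :=
  ∃ g : Y ⟶ X, NatEquivalent (f ≫ g) (𝟙 X) ∧ NatEquivalent (g ≫ f) (𝟙 Y)

end ExInf

end

/-! The map `R` is in fact an isomorphism of simplicial sets. Currying is bijective on arbitrary
diagrams, so the content is that a diagram on `T_2 ^ (k + 1)` is allowed if and only if its curried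
form is an allowed diagram of allowed diagrams (`isExDiagram_succ_iff`). The conditions on
cofibrations and fibrations are pointwise on both sides. Zero objects and cocartesian squares are
not: after currying, those of the first coordinate refer to the full subcategory of allowed
diagrams, before currying to `C` itself.

Pointwise colimit cocones are colimit cocones of diagrams, and a full subcategory that contains the
cocone inherits this (`isColimit_of_eval`). This gives one direction. For the converse, a constant
zero diagram is allowed, every zero object of the category of allowed diagrams is a retract of it,
and retracts of zero objects are zero (`isZeroVertex_eval`).

It remains to show that the relevant cocartesian squares of allowed diagrams are pointwise
cocartesian (`isCocartesian_ev`). The only square of condition 4 with no degenerate direction is the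
one on `01`, `02`, `11`, `12`, whose lower left corner is zero. Consider its value at a vertex `v`
of `T_2 ^ k`. If `v` has a diagonal coordinate, all objects vanish. If all coordinates of `v` are
`02` or `12`, evaluation at `v` preserves colimits, because it behaves like a left adjoint: the
diagram that is `c` on a suitable box with top `v` and zero elsewhere is allowed, and maps into it
correspond to maps from the value at `v` to `c` (`isExDiagram_box`, `Coinduction.isColimit_eval`).
If some coordinate is `01`, axiom (E3) exhibits the value there as the fibre of the map from the
value at `02` to the value at `12`. Limits commute with limits (`isLimAt_first_row`), so the square
at `v` is Cartesian once the squares with `01` replaced by `02`, `11` and `12` are, and (E3) makes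
it cocartesian. Induction on the number of coordinates `01` finishes the argument.

The colimit theory is reduced to combinatorics of vertex sets. A partial map out of the nerve of a
poset is a total family of simplices that is natural on a lower set of vertex sets, and such
families are extended cell by cell, either along inner horns (`exists_extension_of_pairing`) or by
means of colimit cocones (`exists_extension_of_join`). Cofinality, Kan extension and the interchange
of limits follow; limits are treated by duality. -/

noncomputable section

set_option linter.unusedSectionVars false

namespace ExInf

/-! ### Partially defined maps out of nerves of posets -/

/-- A family of simplices of `C` indexed by the simplices of the nerve of `W`. It is a map of
simplicial sets on those simplices where it is natural, see `PMap.NatOn`. -/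
def PMap (W : Type) [Preorder W] (C : SSet.{u}) : Type u :=
  ∀ d : SimplexCategory, (Fin (d.len + 1) →o W) → C.obj (op d)

namespace PMap

variable {V W : Type} [Preorder V] [Preorder W] {C : SSet.{u}}

/-- The family `f` is natural on the simplices whose vertex sets belong to `A`. -/
def NatOn (f : PMap W C) (A : LowerSet (Set W)) : Prop :=
  ∀ (d : SimplexCategory) (s : Fin (d.len + 1) →o W), Set.range s ∈ A →
    ∀ (e : SimplexCategory) (φ : e ⟶ d), C.map φ.op (f d s) = f e (s.comp φ.toOrderHom)

/-- The families `f` and `g` agree on the simplices whose vertex sets belong to `A`. -/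
def EqOn (A : LowerSet (Set W)) (f g : PMap W C) : Prop :=
  ∀ (d : SimplexCategory) (s : Fin (d.len + 1) →o W), Set.range s ∈ A → f d s = g d s

lemma NatOn.mono {f : PMap W C} {A B : LowerSet (Set W)} (h : f.NatOn B) (hAB : A ≤ B) :
    f.NatOn A := fun d s hs => h d s (hAB hs)

lemma EqOn.mono {f g : PMap W C} {A B : LowerSet (Set W)} (h : EqOn B f g) (hAB : A ≤ B) :
    EqOn A f g := fun d s hs => h d s (hAB hs)

lemma EqOn.refl (A : LowerSet (Set W)) (f : PMap W C) : EqOn A f f := fun _ _ _ => rfl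

lemma EqOn.symm {A : LowerSet (Set W)} {f g : PMap W C} (h : EqOn A f g) : EqOn A g f :=
  fun d s hs => (h d s hs).symm

lemma EqOn.trans {A : LowerSet (Set W)} {f g k : PMap W C} (h : EqOn A f g) (h' : EqOn A g k) :
    EqOn A f k := fun d s hs => (h d s hs).trans (h' d s hs)

lemma range_comp_subset {d e : SimplexCategory} (s : Fin (d.len + 1) →o W) (φ : e ⟶ d) :
    Set.range (s.comp φ.toOrderHom) ⊆ Set.range s := by
  rintro _ ⟨i, rfl⟩
  exact ⟨_, rfl⟩

lemma NatOn.congr {f g : PMap W C} {A : LowerSet (Set W)} (h : f.NatOn A) (hfg : EqOn A f g) :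
    g.NatOn A := fun d s hs e φ => by
  rw [← hfg d s hs, h d s hs, hfg e _ (A.lower (range_comp_subset s φ) hs)]

/-- The vertex sets of the simplices of the nerve of `W`. -/
def IsSimplex (S : Set W) : Prop :=
  ∃ (d : SimplexCategory) (s : Fin (d.len + 1) →o W), Set.range s = S

lemma isSimplex_range {d : SimplexCategory} (s : Fin (d.len + 1) →o W) :
    IsSimplex (Set.range s) := ⟨d, s, rfl⟩

lemma IsSimplex.finite {S : Set W} (h : IsSimplex S) : S.Finite := by
  obtain ⟨d, s, rfl⟩ := h
  exact Set.finite_range s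

lemma IsSimplex.nonempty {S : Set W} (h : IsSimplex S) : S.Nonempty := by
  obtain ⟨d, s, rfl⟩ := h
  exact Set.range_nonempty s

lemma IsSimplex.total {S : Set W} (h : IsSimplex S) {x y : W} (hx : x ∈ S) (hy : y ∈ S) :
    x ≤ y ∨ y ≤ x := by
  obtain ⟨d, s, rfl⟩ := h
  obtain ⟨i, rfl⟩ := hx
  obtain ⟨j, rfl⟩ := hy
  exact (le_total i j).imp (s.monotone ·) (s.monotone ·)

/-- The vertex sets in `G` that do not contain `K`. -/
def notAbove (G : LowerSet (Set W)) (K : Set W) : LowerSet (Set W) :=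
  ⟨{S | S ∈ G ∧ ¬ K ⊆ S}, fun _ _ h hS => ⟨G.lower h hS.1, fun h' => hS.2 (h'.trans h)⟩⟩

lemma mem_notAbove {G : LowerSet (Set W)} {K S : Set W} :
    S ∈ notAbove G K ↔ S ∈ G ∧ ¬ K ⊆ S := Iff.rfl

/-! ### Attaching cells in order of rank. -/

section Cells

variable {ι : Type} (A : LowerSet (Set W)) (rank : ι → ℕ) (G : ι → LowerSet (Set W))

/-- The union of `A` and the cells of rank less than `k`. -/
def stage (k : ℕ) : LowerSet (Set W) :=
  ⟨{S | S ∈ A ∨ ∃ i, rank i < k ∧ S ∈ G i}, fun _ _ h hS =>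
    hS.imp (A.lower h) fun ⟨i, hi, hS⟩ => ⟨i, hi, (G i).lower h hS⟩⟩

/-- The union of `A` and all cells. -/
def allStages : LowerSet (Set W) :=
  ⟨{S | S ∈ A ∨ ∃ i, S ∈ G i}, fun _ _ h hS =>
    hS.imp (A.lower h) fun ⟨i, hS⟩ => ⟨i, (G i).lower h hS⟩⟩

lemma stage_mono {k l : ℕ} (h : k ≤ l) : stage A rank G k ≤ stage A rank G l :=
  fun _ hS => Or.imp id (fun ⟨i, hi, hS⟩ => ⟨i, hi.trans_le h, hS⟩) hS

variable {A rank G}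

-- All cells of rank `k` can be filled independently. By `h_core` a simplex containing `core i` lies
-- in no other cell of rank at most `rank i`, and by `h_face` the remaining simplices of the cell
-- already belong to the stage, so the chosen fillings never conflict.
open Classical in
lemma exists_extension_stage {core : ι → Set W} {f₀ f : PMap W C} {k : ℕ}
    (hf : f.NatOn (stage A rank G k)) (hf₀ : EqOn A f₀ f)
    (h_face : ∀ i S, IsSimplex S → S ∈ G i → ¬ core i ⊆ S →
      S ∈ A ∨ ∃ j, rank j < rank i ∧ S ∈ G j)
    (h_core : ∀ i j S, IsSimplex S → core i ⊆ S → S ∈ G j → rank j ≤ rank i → i = j)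
    (h_base : ∀ i S, IsSimplex S → S ∈ A → ¬ core i ⊆ S)
    (h_ext : ∀ i (f : PMap W C), f.NatOn (notAbove (G i) (core i)) → EqOn A f₀ f →
      ∃ g : PMap W C, g.NatOn (G i) ∧ EqOn (notAbove (G i) (core i)) f g) :
    ∃ g : PMap W C, g.NatOn (stage A rank G (k + 1)) ∧ EqOn (stage A rank G k) f g := by
  have key : ∀ i, ∃ g : PMap W C, rank i = k →
      g.NatOn (G i) ∧ EqOn (notAbove (G i) (core i)) f g := by
    intro i
    by_cases hi : rank i = k
    · obtain ⟨g, hg⟩ := h_ext i f (fun d s hs => hf d s (by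
        rcases h_face i _ (isSimplex_range s) hs.1 hs.2 with h | ⟨j, hj, h⟩
        · exact Or.inl h
        · exact Or.inr ⟨j, hi ▸ hj, h⟩)) hf₀
      exact ⟨g, fun _ => hg⟩
    · exact ⟨f, fun h => (hi h).elim⟩
  choose g hg using key
  let F : PMap W C := fun d s => if Set.range s ∈ stage A rank G k then f d s else
    if H : ∃ i, rank i = k ∧ Set.range s ∈ G i then g H.choose d s else f d s
  have F_old : ∀ d (s : Fin (d.len + 1) →o W), Set.range s ∈ stage A rank G k →
      F d s = f d s := fun d s hs => if_pos hs
  have F_new : ∀ d (s : Fin (d.len + 1) →o W) i, rank i = k → Set.range s ∈ G i →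
      F d s = g i d s := by
    intro d s i hi hs
    by_cases h : Set.range s ∈ stage A rank G k
    · rw [F_old d s h]
      refine (hg i hi).2 d s ⟨hs, fun hc => ?_⟩
      rcases h with h | ⟨j, hj, h⟩
      · exact h_base i _ (isSimplex_range s) h hc
      · have := h_core i j _ (isSimplex_range s) hc h (by omega)
        subst this
        omega
    · have H : ∃ i, rank i = k ∧ Set.range s ∈ G i := ⟨i, hi, hs⟩
      have hc : core i ⊆ Set.range s := by
        by_contra hc
        rcases h_face i _ (isSimplex_range s) hs hc with h' | ⟨j, hj, h'⟩
        · exact h (Or.inl h')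
        · exact h (Or.inr ⟨j, hi ▸ hj, h'⟩)
      have e : i = H.choose := h_core i _ _ (isSimplex_range s) hc H.choose_spec.2
        (H.choose_spec.1.trans hi.symm).le
      simp only [F, if_neg h, dif_pos H, ← e]
  refine ⟨F, fun d s hs e φ => ?_, fun d s hs => (F_old d s hs).symm⟩
  by_cases h : Set.range s ∈ stage A rank G k
  · rw [F_old d s h, F_old e _ ((stage A rank G k).lower (range_comp_subset s φ) h), hf d s h]
  · obtain ⟨i, hi, hs⟩ : ∃ i, rank i = k ∧ Set.range s ∈ G i := by
      rcases hs with hs | ⟨i, hi, hs⟩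
      · exact (h (Or.inl hs)).elim
      · refine ⟨i, ?_, hs⟩
        by_contra hik
        exact h (Or.inr ⟨i, by omega, hs⟩)
    rw [F_new d s i hi hs, F_new e _ i hi ((G i).lower (range_comp_subset s φ) hs),
      (hg i hi).1 d s hs]

open Classical in
/-- A map that is defined on `A` extends over the cells `G i` if it can be extended over one cell
at a time. The simplices of `G i` that do not contain `core i` are the boundary of the cell. -/
theorem exists_extension_of_cells {core : ι → Set W} {f₀ : PMap W C} (hf₀ : f₀.NatOn A)
    (h_face : ∀ i S, IsSimplex S → S ∈ G i → ¬ core i ⊆ S →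
      S ∈ A ∨ ∃ j, rank j < rank i ∧ S ∈ G j)
    (h_core : ∀ i j S, IsSimplex S → core i ⊆ S → S ∈ G j → rank j ≤ rank i → i = j)
    (h_base : ∀ i S, IsSimplex S → S ∈ A → ¬ core i ⊆ S)
    (h_ext : ∀ i (f : PMap W C), f.NatOn (notAbove (G i) (core i)) → EqOn A f₀ f →
      ∃ g : PMap W C, g.NatOn (G i) ∧ EqOn (notAbove (G i) (core i)) f g) :
    ∃ g : PMap W C, g.NatOn (allStages A G) ∧ EqOn A f₀ g := by
  have step : ∀ k (f : PMap W C), f.NatOn (stage A rank G k) → EqOn A f₀ f →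
      ∃ g : PMap W C, g.NatOn (stage A rank G (k + 1)) ∧ EqOn (stage A rank G k) f g :=
    fun k f hf hf₀ => exists_extension_stage hf hf₀ h_face h_core h_base h_ext
  have le_stage : ∀ k, A ≤ stage A rank G k := fun k S hS => Or.inl hS
  let F : ∀ k, {f : PMap W C // f.NatOn (stage A rank G k) ∧ EqOn A f₀ f} := fun k =>
    Nat.rec ⟨f₀, hf₀.mono (by
        rintro S (hS | ⟨i, hi, -⟩)
        · exact hS
        · exact absurd hi (Nat.not_lt_zero _)), EqOn.refl _ _⟩
      (fun k f => ⟨(step k f.1 f.2.1 f.2.2).choose, (step k f.1 f.2.1 f.2.2).choose_spec.1,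
        f.2.2.trans ((step k f.1 f.2.1 f.2.2).choose_spec.2.mono (le_stage k))⟩) k
  have hF : ∀ k, EqOn (stage A rank G k) (F k).1 (F (k + 1)).1 := fun k =>
    (step k (F k).1 (F k).2.1 (F k).2.2).choose_spec.2
  have hF' : ∀ k l, k ≤ l → EqOn (stage A rank G k) (F k).1 (F l).1 := by
    intro k l h
    induction l, h using Nat.le_induction with
    | base => exact EqOn.refl _ _
    | succ l h ih => exact ih.trans ((hF l).mono (stage_mono A rank G h))
  -- The union of the stages: the value is read off at the first stage containing the vertex set,
  -- and the choice of the stage does not matter by `hF'`. Outside all stages the value is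
  -- arbitrary.
  let g : PMap W C := fun d s => if H : ∃ k, Set.range s ∈ stage A rank G k then
    (F (Nat.find H)).1 d s else f₀ d s
  have hg : ∀ d (s : Fin (d.len + 1) →o W) k, Set.range s ∈ stage A rank G k → g d s = (F k).1 d s := by
    intro d s k hs
    have H : ∃ k, Set.range s ∈ stage A rank G k := ⟨k, hs⟩
    simp only [g, dif_pos H]
    exact hF' _ _ (Nat.find_min' H hs) d s (Nat.find_spec H)
  refine ⟨g, fun d s hs e φ => ?_, fun d s hs => ?_⟩
  · obtain ⟨k, hk⟩ : ∃ k, Set.range s ∈ stage A rank G k := by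
      rcases hs with hs | ⟨i, hs⟩
      · exact ⟨0, Or.inl hs⟩
      · exact ⟨rank i + 1, Or.inr ⟨i, Nat.lt_succ_self _, hs⟩⟩
    rw [hg d s k hk, hg e _ k ((stage A rank G k).lower (range_comp_subset s φ) hk),
      (F k).2.1 d s hk]
  · rw [hg d s 0 (Or.inl hs)]
    exact (F 0).2.2 d s hs

end Cells

/-! ### Restriction and extension along monotone maps -/

/-- The restriction along a monotone map. -/
def comp (f : PMap W C) (j : V →o W) : PMap V C := fun d s => f d (j.comp s)

/-- The vertex sets with image in `A`. -/
def comap (j : V →o W) (A : LowerSet (Set W)) : LowerSet (Set V) :=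
  ⟨{S | j '' S ∈ A}, fun _ _ h hS => A.lower (Set.image_mono h) hS⟩

lemma mem_comap {j : V →o W} {A : LowerSet (Set W)} {S : Set V} :
    S ∈ comap j A ↔ j '' S ∈ A := Iff.rfl

lemma range_comp (j : V →o W) {d : SimplexCategory} (s : Fin (d.len + 1) →o V) :
    Set.range (j.comp s) = j '' Set.range s := by
  simp [Set.range_comp]

lemma NatOn.comp {f : PMap W C} {A : LowerSet (Set W)} (h : f.NatOn A) (j : V →o W) :
    (f.comp j).NatOn (comap j A) := fun d s hs e φ =>
  h d (j.comp s) (by rwa [range_comp]) e φ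

open Classical in
/-- The extension of `h` along the injective map `j`. On simplices that do not come from `V` it
has the values of `f`. -/
def extend (j : V →o W) (h : PMap V C) (f : PMap W C) : PMap W C := fun d s =>
  if H : ∃ t, j.comp t = s then h d H.choose else f d s

lemma extend_comp {j : V →o W} (hj : Function.Injective j) (h : PMap V C) (f : PMap W C)
    {d : SimplexCategory} (t : Fin (d.len + 1) →o V) : extend j h f d (j.comp t) = h d t := by
  have H : ∃ t', j.comp t' = j.comp t := ⟨t, rfl⟩
  have e : H.choose = t := by
    ext i
    exact hj (DFunLike.congr_fun H.choose_spec i)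
  simp only [extend, dif_pos H, e]

lemma exists_comp_eq (j : V ↪o W) {d : SimplexCategory} {s : Fin (d.len + 1) →o W}
    (hs : Set.range s ⊆ Set.range j) : ∃ t : Fin (d.len + 1) →o V,
      (j : V →o W).comp t = s := by
  choose t ht using fun i => hs ⟨i, rfl⟩
  refine ⟨⟨t, fun a b hab => ?_⟩, ?_⟩
  · rw [← j.le_iff_le, ht, ht]
    exact s.monotone hab
  · ext i
    exact ht i

/-- A map on `V` that agrees with a partial map on `W` yields a map on the image of `V`. -/
lemma exists_extend (j : V ↪o W) {h : PMap V C} {A : LowerSet (Set V)} (hh : h.NatOn A)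
    (f : PMap W C) {G B : LowerSet (Set W)} (hG : ∀ S ∈ G, S ⊆ Set.range j)
    (hGA : comap (j : V →o W) G ≤ A) (hB : B ≤ G)
    (hfh : EqOn (comap (j : V →o W) B) (f.comp (j : V →o W)) h) :
    ∃ g : PMap W C, g.NatOn G ∧ EqOn B f g ∧ g.comp (j : V →o W) = h := by
  have hj : Function.Injective (j : V →o W) := j.injective
  refine ⟨extend j h f, fun d s hs e φ => ?_, fun d s hs => ?_, ?_⟩
  · obtain ⟨t, rfl⟩ := exists_comp_eq j (hG _ hs)
    rw [extend_comp hj, hh d t (hGA (mem_comap.2 (by rwa [← range_comp])))]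
    exact (extend_comp hj h f (t.comp φ.toOrderHom)).symm
  · obtain ⟨t, rfl⟩ := exists_comp_eq j (hG _ (hB hs))
    rw [extend_comp hj]
    exact hfh d t (mem_comap.2 (by rwa [← range_comp]))
  · funext d t
    exact extend_comp hj h f t

end PMap

end ExInf

end

noncomputable section

set_option linter.unusedSectionVars false

namespace ExInf

/-! ### Simplices of nerves of posets -/

namespace N

variable {P Q : Type} [Preorder P] [Preorder Q]

/-- The simplex of the nerve given by a monotone sequence. -/
def simplex {d : SimplexCategory} (s : Fin (d.len + 1) →o P) : (N.{u} P).obj (op d) :=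
  Monotone.functor (f := fun i => ULift.up.{u} (s i)) (fun _ _ h => s.monotone h)

/-- The monotone sequence given by a simplex of the nerve. -/
def seq {d : SimplexCategory} (x : (N.{u} P).obj (op d)) : Fin (d.len + 1) →o P where
  toFun i := (x.obj i).down
  monotone' i j h := (leOfHom (x.map (homOfLE h)) : x.obj i ≤ x.obj j)

@[simp] lemma seq_simplex {d : SimplexCategory} (s : Fin (d.len + 1) →o P) :
    seq (simplex.{u} s) = s := rfl

lemma map_simplex {d e : SimplexCategory} (s : Fin (d.len + 1) →o P) (φ : e ⟶ d) :
    (N.{u} P).map φ.op (simplex s) = simplex (s.comp φ.toOrderHom) := rfl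

lemma map_app_simplex (f : P →o Q) {d : SimplexCategory} (s : Fin (d.len + 1) →o P) :
    (N.map.{u} f).app _ (simplex s) = simplex (f.comp s) := rfl

lemma vertex_eq (x : P) : N.vertex.{u} x = simplex (d := ⦋0⦌) (OrderHom.const _ x) :=
  ComposableArrows.ext₀ rfl

/-- The monotone sequence of length two given by an inequality. -/
def pair {x y : P} (h : x ≤ y) : Fin 2 →o P where
  toFun i := if i = 0 then x else y
  monotone' i j hij := by
    fin_cases i <;> fin_cases j <;> simp_all

lemma edge_eq {x y : P} (h : x ≤ y) : N.edge.{u} h = simplex (d := ⦋1⦌) (pair h) :=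
  ComposableArrows.ext₁ rfl rfl rfl

end N

namespace PMap

variable {W V : Type} [Preorder W] [Preorder V] {C : SSet.{u}}

/-- The values of a map of simplicial sets. -/
def ofHom (σ : N.{u} W ⟶ C) : PMap W C := fun _ s => σ.app _ (N.simplex s)

lemma natOn_ofHom (σ : N.{u} W ⟶ C) (A : LowerSet (Set W)) : (ofHom σ).NatOn A :=
  fun _ s _ _ φ => (NatTrans.naturality_apply σ φ.op (N.simplex s)).symm

lemma ofHom_comp (j : V →o W) (σ : N.{u} W ⟶ C) : ofHom (N.map j ≫ σ) = (ofHom σ).comp j := rfl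

lemma ofHom_injective : Function.Injective (ofHom : (N.{u} W ⟶ C) → PMap W C) := by
  intro σ τ h
  ext ⟨d⟩ x
  exact congrFun (congrFun h d) (N.seq x)

/-- The map out of a subcomplex of a nerve given by a partial map. -/
def subHom {X : (N.{u} W).Subcomplex} {A : LowerSet (Set W)}
    (hX : ∀ (d : SimplexCategory) (x : (N.{u} W).obj (op d)), x ∈ X.obj (op d) →
      Set.range (N.seq x) ∈ A)
    (f : PMap W C) (hf : f.NatOn A) : (X : SSet.{u}) ⟶ C where
  app d := ↾fun x => f d.unop (N.seq x.1)
  naturality d e φ := by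
    ext x
    exact (hf d.unop (N.seq x.1) (hX _ _ x.2) e.unop φ.unop).symm

/-- The map out of a nerve given by an everywhere natural family. -/
def toHom (f : PMap W C) (hf : f.NatOn ⊤) : N.{u} W ⟶ C where
  app d := ↾fun x => f d.unop (N.seq x)
  naturality d e φ := by
    ext x
    exact (hf d.unop (N.seq x) trivial e.unop φ.unop).symm

@[simp] lemma ofHom_toHom (f : PMap W C) (hf : f.NatOn ⊤) : ofHom (f.toHom hf) = f := rfl

/-- The constant family. -/
def const (c : C _⦋0⦌) : PMap W C := fun d _ => C.map (SimplexCategory.const d ⦋0⦌ 0).op c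

lemma natOn_const (c : C _⦋0⦌) (A : LowerSet (Set W)) : (const c : PMap W C).NatOn A := by
  intro d s _ e φ
  simp only [const, ← Functor.map_comp_apply, ← op_comp]
  rfl

open Classical in
/-- The partial map given by a map out of a subcomplex of a nerve, with values `c` elsewhere. -/
def ofSubHom {X : (N.{u} W).Subcomplex} (g : (X : SSet.{u}) ⟶ C) (c : C _⦋0⦌) : PMap W C :=
  fun d s => if h : N.simplex s ∈ X.obj (op d) then g.app _ ⟨N.simplex s, h⟩ else const c d s

lemma ofSubHom_of_mem {X : (N.{u} W).Subcomplex} (g : (X : SSet.{u}) ⟶ C) (c : C _⦋0⦌)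
    {d : SimplexCategory} (s : Fin (d.len + 1) →o W) (h : N.simplex s ∈ X.obj (op d)) :
    ofSubHom g c d s = g.app _ ⟨N.simplex s, h⟩ := dif_pos h

lemma natOn_ofSubHom {X : (N.{u} W).Subcomplex} {A : LowerSet (Set W)}
    (hX : ∀ (d : SimplexCategory) (s : Fin (d.len + 1) →o W), Set.range s ∈ A →
      N.simplex s ∈ X.obj (op d)) (g : (X : SSet.{u}) ⟶ C) (c : C _⦋0⦌) :
    (ofSubHom g c).NatOn A := by
  intro d s hs e φ
  rw [ofSubHom_of_mem g c s (hX _ _ hs),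
    ofSubHom_of_mem g c _ (hX _ _ (A.lower (range_comp_subset s φ) hs))]
  exact (NatTrans.naturality_apply g φ.op ⟨N.simplex s, hX _ _ hs⟩).symm

lemma NatOn.mono_of_isSimplex {f : PMap W C} {A B : LowerSet (Set W)} (h : f.NatOn B)
    (hAB : ∀ S, IsSimplex S → S ∈ A → S ∈ B) : f.NatOn A :=
  fun d s hs => h d s (hAB _ (isSimplex_range s) hs)

end PMap

/-! ### Inner horns -/

/-- The filling of inner horns, in terms of partial maps. -/
def HasInnerFillers (C : SSet.{u}) : Prop :=
  ∀ (n : ℕ) (k : Fin (n + 1)) (f : PMap (Fin (n + 1)) C), 0 < k → k < Fin.last n →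
    f.NatOn (PMap.notAbove ⊤ {k}ᶜ) →
    ∃ g : PMap (Fin (n + 1)) C, g.NatOn ⊤ ∧ PMap.EqOn (PMap.notAbove ⊤ {k}ᶜ) f g

/-- A vertex set fails to contain `{k}ᶜ` exactly if it misses a vertex other than `k`, which is the
condition for a simplex to lie in the horn `Λ[n, k]`. -/
lemma hasInnerFillers (C : SSet.{u}) [SSet.Quasicategory C] : HasInnerFillers C := by
  intro n k f h₀ h₁ hf
  let g : (SSet.horn.{u} n k : SSet.{u}) ⟶ C :=
    { app := fun d => ↾fun x => f d.unop (SSet.stdSimplex.asOrderHom x.1)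
      naturality := fun d e φ => by
        ext x
        refine (hf d.unop (SSet.stdSimplex.asOrderHom x.1) ⟨trivial, fun h => ?_⟩ e.unop
          φ.unop).symm
        apply x.2
        rw [Set.eq_univ_iff_forall]
        intro j
        by_cases hj : j = k
        · exact Or.inr hj
        · exact Or.inl (h hj) }
  obtain ⟨σ, hσ⟩ := SSet.Quasicategory.hornFilling h₀ h₁ g
  refine ⟨fun d s => σ.app _ (SSet.stdSimplex.objMk s), fun d s _ e φ => ?_, fun d s hs => ?_⟩
  · rw [← NatTrans.naturality_apply σ φ.op]
    rfl
  · have hs' : SSet.stdSimplex.objMk.{u} s ∈ (SSet.horn.{u} n k).obj (op d) := by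
      intro h
      apply hs.2
      intro j hj
      rcases h.symm ▸ Set.mem_univ j with h' | h'
      · exact h'
      · exact (hj h').elim
    exact ConcreteCategory.congr_hom (NatTrans.congr_app hσ (op d)) ⟨_, hs'⟩

/-! ### Chains in posets and extension along inner horns. -/

namespace PMap

section

variable {W : Type} [PartialOrder W] {C : SSet.{u}}

lemma exists_orderEmbedding {S : Set W} (hf : S.Finite) (hn : S.Nonempty)
    (ht : ∀ x ∈ S, ∀ y ∈ S, x ≤ y ∨ y ≤ x) :
    ∃ (n : ℕ) (j : Fin (n + 1) ↪o W), Set.range j = S := by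
  classical
  let _ : LinearOrder S :=
    { (inferInstance : PartialOrder S) with
      le_total := fun x y => ht x x.2 y y.2
      toDecidableLE := Classical.decRel _ }
  have := hf.fintype
  have := hn.to_subtype
  obtain ⟨n, hn⟩ : ∃ n, Fintype.card S = n + 1 :=
    ⟨_, (Nat.succ_pred_eq_of_pos Fintype.card_pos).symm⟩
  let e : Fin (n + 1) ≃o S := Fintype.orderIsoFinOfCardEq S hn
  refine ⟨n, e.toOrderEmbedding.trans (OrderEmbedding.subtype _), ?_⟩
  ext x
  constructor
  · rintro ⟨i, rfl⟩
    exact (e i).2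
  · intro hx
    exact ⟨e.symm ⟨x, hx⟩, by simp⟩

lemma isSimplex_iff {S : Set W} :
    IsSimplex S ↔ S.Finite ∧ S.Nonempty ∧ ∀ x ∈ S, ∀ y ∈ S, x ≤ y ∨ y ≤ x := by
  refine ⟨fun h => ⟨h.finite, h.nonempty, fun x hx y hy => h.total hx hy⟩, fun ⟨hf, hn, ht⟩ => ?_⟩
  obtain ⟨n, j, rfl⟩ := exists_orderEmbedding hf hn ht
  exact ⟨⦋n⦌, j, rfl⟩

lemma IsSimplex.subset {S T : Set W} (h : IsSimplex S) (hT : T ⊆ S) (hn : T.Nonempty) :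
    IsSimplex T :=
  isSimplex_iff.2 ⟨h.finite.subset hT, hn, fun _ hx _ hy => h.total (hT hx) (hT hy)⟩

lemma IsSimplex.insert {S : Set W} (h : IsSimplex S) {x : W} (hx : ∀ y ∈ S, y ≤ x ∨ x ≤ y) :
    IsSimplex (insert x S) := by
  refine isSimplex_iff.2 ⟨h.finite.insert x, Set.insert_nonempty _ _, ?_⟩
  rintro y (rfl | hy) z (rfl | hz)
  · exact Or.inl le_rfl
  · exact (hx z hz).symm
  · exact hx y hy
  · exact h.total hy hz

lemma IsSimplex.exists_isLeast {S T : Set W} (h : IsSimplex S) (hn : (S ∩ T).Nonempty) :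
    ∃ x, IsLeast (S ∩ T) x := by
  obtain ⟨x, hx⟩ := (h.finite.subset Set.inter_subset_left).exists_minimal hn
  exact ⟨x, hx.1, fun y hy => (h.total hx.1.1 hy.1).elim id fun h' => hx.2 hy h'⟩

lemma IsSimplex.exists_isGreatest {S T : Set W} (h : IsSimplex S) (hn : (S ∩ T).Nonempty) :
    ∃ x, IsGreatest (S ∩ T) x := by
  obtain ⟨x, hx⟩ := (h.finite.subset Set.inter_subset_left).exists_maximal hn
  exact ⟨x, hx.1, fun y hy => (h.total hx.1.1 hy.1).elim (fun h' => hx.2 hy h') id⟩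

/-- An inner horn in a chain can be filled. -/
lemma exists_extension_inner (hC : HasInnerFillers C) {c : Set W} (hc : IsSimplex c) {z : W}
    (hz : z ∈ c) (h₀ : ∃ x ∈ c, x < z) (h₁ : ∃ x ∈ c, z < x) {f : PMap W C}
    (hf : f.NatOn (notAbove (LowerSet.Iic c) (c \ {z}))) :
    ∃ g : PMap W C, g.NatOn (LowerSet.Iic c) ∧
      EqOn (notAbove (LowerSet.Iic c) (c \ {z})) f g := by
  obtain ⟨hf', hn, ht⟩ := isSimplex_iff.1 hc
  obtain ⟨n, j, rfl⟩ := exists_orderEmbedding hf' hn ht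
  obtain ⟨k, rfl⟩ := hz
  have hk₀ : 0 < k := by
    obtain ⟨_, ⟨i, rfl⟩, hi⟩ := h₀
    exact lt_of_le_of_lt (Fin.zero_le i) (j.lt_iff_lt.1 hi)
  have hk₁ : k < Fin.last n := by
    obtain ⟨_, ⟨i, rfl⟩, hi⟩ := h₁
    exact lt_of_lt_of_le (j.lt_iff_lt.1 hi) (Fin.le_last i)
  have key : ∀ S : Set (Fin (n + 1)), (j : Fin (n + 1) →o W) '' S ∈
      notAbove (LowerSet.Iic (Set.range j)) (Set.range j \ {j k}) ↔ S ∈ notAbove ⊤ {k}ᶜ := by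
    intro S
    rw [mem_notAbove, mem_notAbove]
    refine and_congr (iff_of_true (Set.image_subset_range _ _) trivial) (not_congr ?_)
    constructor
    · intro h i hi
      obtain ⟨i', hi', e⟩ := h ⟨⟨i, rfl⟩, fun e => hi (j.injective e)⟩
      exact j.injective e ▸ hi'
    · rintro h _ ⟨⟨i, rfl⟩, hi⟩
      exact ⟨i, h (fun e => hi (congrArg j e)), rfl⟩
  obtain ⟨g, hg, hg'⟩ := hC n k (f.comp (j : Fin (n + 1) →o W)) hk₀ hk₁
    ((hf.comp _).mono fun S hS => (key S).2 hS)
  obtain ⟨g', hg₁, hg₂, -⟩ := exists_extend j hg f (G := LowerSet.Iic (Set.range j))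
    (B := notAbove (LowerSet.Iic (Set.range j)) (Set.range j \ {j k}))
    (fun S hS => hS) le_top (fun S hS => hS.1) (hg'.mono fun S hS => (key S).1 hS)
  exact ⟨g', hg₁, hg₂⟩

/-- If the simplices of `B` that do not belong to `A` can be paired by inserting inner vertices
`κ x`, where `x` is the largest vertex in `M`, then maps extend from `A` to `B`. -/
theorem exists_extension_of_pairing (hC : HasInnerFillers C) {A B : LowerSet (Set W)}
    (M : Set W) (κ : W → W) (hκ : ∀ x ∈ M, x < κ x ∧ κ x ∉ M)
    (h : ∀ S, IsSimplex S → S ∈ B → S ∉ A → (S ∩ M).Nonempty ∧ ∀ x, IsGreatest (S ∩ M) x →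
      insert (κ x) S ∈ B ∧ (∀ y ∈ S, y ≤ κ x ∨ κ x ≤ y) ∧ (∃ y ∈ S, κ x < y) ∧ S \ {κ x} ∉ A)
    {f : PMap W C} (hf : f.NatOn A) : ∃ g : PMap W C, g.NatOn B ∧ EqOn A f g := by
  -- The cells are the larger members `c` of the pairs `c \ {κ x}`, `c`. Filling the horn of `c`
  -- opposite to `κ x` adds precisely these two faces.
  let ι : Type := {i : Set W × W // IsSimplex i.1 ∧ i.1 ∈ B ∧ i.1 ∉ A ∧
    IsGreatest (i.1 ∩ M) i.2 ∧ κ i.2 ∈ i.1}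
  -- Since `κ x` is not in `M`, inserting it changes neither `S ∩ M` nor its largest element; hence
  -- the pairing is well defined.
  have upper : ∀ S, IsSimplex S → S ∈ B → S ∉ A → ∃ i : ι, i.1.1 = insert (κ i.1.2) S ∧
      IsGreatest (S ∩ M) i.1.2 ∧ i.1.1 ∩ M = S ∩ M := by
    intro S hS hB hA
    obtain ⟨hn, H⟩ := h S hS hB hA
    obtain ⟨x, hx⟩ := hS.exists_isGreatest hn
    obtain ⟨h₁, h₂, -, -⟩ := H x hx
    have e : insert (κ x) S ∩ M = S ∩ M := Set.insert_inter_of_notMem (hκ x hx.1.2).2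
    exact ⟨⟨(insert (κ x) S, x), hS.insert h₂, h₁, fun h => hA (A.lower (Set.subset_insert _ _) h),
      e.symm ▸ hx, Set.mem_insert _ _⟩, rfl, hx, e⟩
  have core_inter : ∀ i : ι, (i.1.1 \ {κ i.1.2}) ∩ M = i.1.1 ∩ M := by
    intro i
    ext y
    refine ⟨fun hy => ⟨hy.1.1, hy.2⟩, fun hy => ⟨⟨hy.1, ?_⟩, hy.2⟩⟩
    rintro rfl
    exact (hκ _ i.2.2.2.2.1.1.2).2 hy.2
  suffices H : ∃ g : PMap W C, g.NatOn (allStages A fun i : ι => LowerSet.Iic i.1.1) ∧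
      EqOn A f g by
    obtain ⟨g, hg, hg'⟩ := H
    refine ⟨g, hg.mono_of_isSimplex fun S hS hB => ?_, hg'⟩
    by_cases hA : S ∈ A
    · exact Or.inl hA
    · obtain ⟨i, hi, -⟩ := upper S hS hB hA
      exact Or.inr ⟨i, show S ⊆ i.1.1 from hi ▸ Set.subset_insert _ _⟩
  refine exists_extension_of_cells (rank := fun i : ι => i.1.1.ncard + (i.1.1 ∩ M).ncard)
    (core := fun i => i.1.1 \ {κ i.1.2}) hf ?_ ?_ ?_ ?_
  · rintro ⟨⟨c, x⟩, hc, hcB, hcA, hx, hκc⟩ S hS hSc hcore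
    replace hSc : S ⊆ c := hSc
    by_cases hA : S ∈ A
    · exact Or.inl hA
    obtain ⟨i, hi, hi', hi''⟩ := upper S hS (B.lower hSc hcB) hA
    refine Or.inr ⟨i, ?_, show S ⊆ i.1.1 from hi ▸ Set.subset_insert _ _⟩
    obtain ⟨y, hy, hyS⟩ := Set.not_subset.1 hcore
    have hSc' : S ⊂ c := ⟨hSc, fun h => hyS (h hy.1)⟩
    change i.1.1.ncard + (i.1.1 ∩ M).ncard < c.ncard + (c ∩ M).ncard
    rw [hi'']
    -- The rank drops on faces for one of two reasons. If `S` has the same vertices in `M`, its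
    -- partner is inserted at the same vertex and stays strictly inside `c`. Otherwise the insertion
    -- restores at most one lost vertex, but the number of vertices in `M` has decreased.
    by_cases e : S ∩ M = c ∩ M
    · have ex : i.1.2 = x := (e ▸ hi').unique hx
      have : i.1.1 ⊂ c := by
        rw [hi, ex]
        refine ⟨Set.insert_subset hκc hSc, fun h => ?_⟩
        rcases h hy.1 with h' | h'
        · exact hy.2 h'
        · exact hyS h'
      have := Set.ncard_lt_ncard this hc.finite
      rw [e]
      omega
    · have h₁ : S ∩ M ⊂ c ∩ M :=
        (Set.inter_subset_inter_left _ hSc).ssubset_of_ne e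
      have h₁ := Set.ncard_lt_ncard h₁ (hc.finite.subset Set.inter_subset_left)
      have h₂ := Set.ncard_lt_ncard hSc' hc.finite
      have h₃ := Set.ncard_insert_le (κ i.1.2) S
      rw [← hi] at h₃
      omega
  · rintro ⟨⟨c, x⟩, hc, hcB, hcA, hx, hκc⟩ ⟨⟨c', x'⟩, hc', hcB', hcA', hx', hκc'⟩ S hS hcS hSc' hr
    replace hr : c'.ncard + (c' ∩ M).ncard ≤ c.ncard + (c ∩ M).ncard := hr
    replace hcS : c \ {κ x} ⊆ c' := hcS.trans hSc'
    replace hx : IsGreatest (c ∩ M) x := hx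
    replace hx' : IsGreatest (c' ∩ M) x' := hx'
    have hM : c ∩ M ⊆ c' ∩ M := by
      rw [← core_inter ⟨(c, x), hc, hcB, hcA, hx, hκc⟩]
      exact Set.inter_subset_inter_left _ hcS
    have hM' := Set.ncard_le_ncard hM (hc'.finite.subset Set.inter_subset_left)
    have h₁ : (c \ {κ x}).ncard + 1 = c.ncard :=
      Set.ncard_sdiff_singleton_add_one hκc hc.finite
    have h₂ := Set.ncard_le_ncard hcS hc'.finite
    -- If `c` and `c'` had the same part in `M`, then `x = x'` and `κ x ∈ c'`. If not, `c'` has more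
    -- vertices in `M`, so the rank bound forces `c' = c \ {κ x}`, which has the same part in `M` as
    -- `c`.
    have key : κ x ∈ c' := by
      by_contra hn
      have hne : c ∩ M ≠ c' ∩ M := fun e => hn (by
        rw [← e] at hx'
        rw [hx.unique hx']
        exact hκc')
      have h₃ := Set.ncard_lt_ncard (hM.ssubset_of_ne hne)
        (hc'.finite.subset Set.inter_subset_left)
      have h₄ : c \ {κ x} = c' := Set.eq_of_subset_of_ncard_le hcS (by omega) hc'.finite
      exact hne (by
        rw [← h₄]
        exact (core_inter ⟨(c, x), hc, hcB, hcA, hx, hκc⟩).symm)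
    have hcc : c ⊆ c' := by
      intro y hy
      by_cases e : y = κ x
      · exact e ▸ key
      · exact hcS ⟨hy, e⟩
    have : c = c' := Set.eq_of_subset_of_ncard_le hcc (by omega) hc'.finite
    subst this
    have := hx.unique hx'
    subst this
    rfl
  · rintro ⟨⟨c, x⟩, hc, hcB, hcA, hx, hκc⟩ S hS hSA hcS
    exact ((h c hc hcB hcA).2 x hx).2.2.2 (A.lower hcS hSA)
  · rintro ⟨⟨c, x⟩, hc, hcB, hcA, hx, hκc⟩ f' hf' -
    exact exists_extension_inner hC hc hκc ⟨x, hx.1.1, (hκ x hx.1.2).1⟩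
      ((h c hc hcB hcA).2 x hx).2.2.1 hf'

end

end PMap

end ExInf

end

noncomputable section

set_option linter.unusedSectionVars false

namespace ExInf

/-! ### Colimit cocones in terms of partial maps -/

section

variable {P Q R W : Type} [Preorder P] [Preorder Q] [Preorder R] [Preorder W]

/-- The monotone map out of an ordinal sum given by monotone maps out of the summands. -/
def sumDesc (f : P →o W) (g : R →o W) (h : ∀ x y, f x ≤ g y) : P ⊕ₗ R →o W where
  toFun x := Sum.elim f g (ofLex x)
  monotone' := by
    intro a b hab
    induction a with | _ a => ?_
    induction b with | _ b => ?_
    rcases a with a | a <;> rcases b with b | b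
    · exact f.monotone (by simpa using hab)
    · exact h a b
    · simp at hab
    · exact g.monotone (by simpa using hab)

@[elab_as_elim]
lemma lexSum_cases {motive : P ⊕ₗ R → Prop} (inl : ∀ a, motive (Sum.inlₗ a))
    (inr : ∀ b, motive (Sum.inrₗ b)) (x : P ⊕ₗ R) : motive x := by
  change motive (toLex (ofLex x))
  cases ofLex x with
  | inl a => exact inl a
  | inr b => exact inr b

lemma lexSum_hom_ext {f g : P ⊕ₗ R →o W} (inl : ∀ a, f (Sum.inlₗ a) = g (Sum.inlₗ a))
    (inr : ∀ b, f (Sum.inrₗ b) = g (Sum.inrₗ b)) : f = g := by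
  ext x
  exact lexSum_cases (motive := fun x => f x = g x) inl inr x

/-- The order embedding of an ordinal sum given by order embeddings of the summands. -/
def sumDescEmb {P R W : Type} [PartialOrder P] [PartialOrder R] [PartialOrder W]
    (f : P ↪o W) (g : R ↪o W) (h : ∀ x y, f x < g y) : P ⊕ₗ R ↪o W :=
  OrderEmbedding.ofMapLEIff (sumDesc f.toOrderHom g.toOrderHom fun x y => (h x y).le) (by
    intro a b
    cases a using lexSum_cases with
    | inl a =>
      cases b using lexSum_cases with
      | inl b => exact f.le_iff_le.trans Sum.Lex.inl_le_inl_iff.symm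
      | inr b => exact iff_of_true (h a b).le (Sum.Lex.inl_le_inr a b)
    | inr a =>
      cases b using lexSum_cases with
      | inl b => exact iff_of_false (h b a).not_ge Sum.Lex.not_inr_le_inl
      | inr b => exact g.le_iff_le.trans Sum.Lex.inr_le_inr_iff.symm)

/-- The map of ordinal sums induced by a map of the first summand. -/
def sumMapLeft (R : Type) [Preorder R] (f : P →o Q) : P ⊕ₗ R →o Q ⊕ₗ R :=
  sumDesc ⟨fun x => Sum.inlₗ (f x), fun _ _ h => Sum.Lex.inl_le_inl_iff.2 (f.monotone h)⟩
    ⟨fun x => Sum.inrₗ x, fun _ _ h => Sum.Lex.inr_le_inr_iff.2 h⟩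
    (fun _ _ => Sum.Lex.inl_le_inr _ _)

@[simp] lemma sumMapLeft_inl (f : P →o Q) (x : P) :
    sumMapLeft R f (Sum.inlₗ x) = Sum.inlₗ (f x) := rfl

@[simp] lemma sumMapLeft_inr (f : P →o Q) (x : R) :
    sumMapLeft R f (Sum.inrₗ x) = Sum.inrₗ x := rfl

/-- The inclusion of the cocone with vertex `0`. -/
def coneZero (P : Type) [Preorder P] (m : ℕ) : P ⊕ₗ Fin 1 →o P ⊕ₗ Fin (m + 2) where
  toFun x := toLex (Sum.map id (fun _ => (0 : Fin (m + 2))) (ofLex x))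
  monotone' := by
    intro a b h
    induction a with | _ a => ?_
    induction b with | _ b => ?_
    rcases a with a | a <;> rcases b with b | b <;> simp_all

/-- The vertex sets of the simplices of `N(P) ⋆ ∂Δ[m + 1]`. -/
def coneBdry (P : Type) (m : ℕ) : LowerSet (Set (P ⊕ₗ Fin (m + 2))) :=
  PMap.notAbove ⊤ (Set.range Sum.inrₗ)

lemma mem_coneBdry {m : ℕ} {S : Set (P ⊕ₗ Fin (m + 2))} :
    S ∈ coneBdry P m ↔ ∃ j, Sum.inrₗ j ∉ S := by
  change (True ∧ ¬ _) ↔ _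
  rw [Set.range_subset_iff]
  simp

end

namespace PMap

variable {C : SSet.{u}}

/-- Colimit cocones in terms of families of simplices. -/
def IsColimit {P : Type} [Preorder P] (f : PMap (P ⊕ₗ Fin 1) C) : Prop :=
  ∀ (m : ℕ) (g : PMap (P ⊕ₗ Fin (m + 2)) C), g.NatOn (coneBdry P m) → g.comp (coneZero P m) = f →
    ∃ h : PMap (P ⊕ₗ Fin (m + 2)) C, h.NatOn ⊤ ∧ EqOn (coneBdry P m) g h

lemma mem_joinBoundary_iff {P : Type} [Preorder P] {m : ℕ} {d : SimplexCategory}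
    (s : Fin (d.len + 1) →o P ⊕ₗ Fin (m + 2)) :
    N.simplex.{u} s ∈ (joinBoundary.{u} P (m + 1)).obj (op d) ↔ Set.range s ∈ coneBdry P m := by
  rw [mem_coneBdry]
  refine exists_congr fun j => ⟨fun h => ?_, fun h i e => h ⟨i, congrArg ULift.down e⟩⟩
  rintro ⟨i, e⟩
  exact h i (congrArg ULift.up e)

lemma range_coneZero_comp_mem {P : Type} [Preorder P] {m : ℕ} {d : SimplexCategory}
    (s : Fin (d.len + 1) →o P ⊕ₗ Fin 1) : Set.range ((coneZero P m).comp s) ∈ coneBdry P m := by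
  refine mem_coneBdry.2 ⟨1, ?_⟩
  rintro ⟨i, hi⟩
  rw [OrderHom.comp_coe, Function.comp_apply] at hi
  generalize s i = x at hi
  cases x using lexSum_cases with
  | inl a => cases congrArg ofLex hi
  | inr a => simpa using Sum.inr_injective (congrArg ofLex hi)

lemma isColimitCocone_iff {P : Type} [Preorder P] (σ : N.{u} (P ⊕ₗ Fin 1) ⟶ C) :
    IsColimitCocone σ ↔ IsColimit (ofHom σ) := by
  constructor
  · intro H m g hg hgσ
    obtain ⟨h, hh⟩ := H m (subHom (fun d x hx => (mem_joinBoundary_iff (N.seq x)).1 hx) g hg) (by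
      apply ofHom_injective
      exact hgσ)
    refine ⟨ofHom h, natOn_ofHom h _, fun d s hs => ?_⟩
    exact (ConcreteCategory.congr_hom (NatTrans.congr_app hh (op d))
      ⟨N.simplex s, (mem_joinBoundary_iff s).2 hs⟩).symm
  · intro H m g hg
    -- Only a default value for the simplices outside the subcomplex.
    let c : C _⦋0⦌ := σ.app _ (N.vertex (Sum.inrₗ 0))
    obtain ⟨h, hh, hgh⟩ := H m (ofSubHom g c)
      (natOn_ofSubHom (fun d s hs => (mem_joinBoundary_iff s).2 hs) g c) (by
        funext d s
        refine (ofSubHom_of_mem g c _ ((mem_joinBoundary_iff _).2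
          (range_coneZero_comp_mem s))).trans ?_
        exact ConcreteCategory.congr_hom (NatTrans.congr_app hg (op d)) (N.simplex s))
    refine ⟨h.toHom hh, ?_⟩
    ext ⟨d⟩ ⟨x, hx⟩
    refine (hgh d (N.seq x) ((mem_joinBoundary_iff (N.seq x)).1 hx)).symm.trans ?_
    exact ofSubHom_of_mem g c _ hx

lemma comp_comp {U V W : Type} [Preorder U] [Preorder V] [Preorder W] (f : PMap W C)
    (j : V →o W) (k : U →o V) : (f.comp j).comp k = f.comp (j.comp k) := rfl

lemma NatOn.comp_top {V W : Type} [Preorder V] [Preorder W] {f : PMap W C}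
    (hf : f.NatOn ⊤) (j : V →o W) : (f.comp j).NatOn ⊤ := hf.comp j

lemma IsColimit.of_orderIso {P Q : Type} [Preorder P] [Preorder Q] (e : P ≃o Q)
    {f : PMap (Q ⊕ₗ Fin 1) C} (hf : IsColimit (f.comp (sumMapLeft (Fin 1) (e : P →o Q)))) :
    IsColimit f := by
  intro m g hg hgf
  have key : ∀ S : Set (P ⊕ₗ Fin (m + 2)), sumMapLeft (Fin (m + 2)) (e : P →o Q) '' S ∈
      coneBdry Q m ↔ S ∈ coneBdry P m := by
    intro S
    rw [mem_coneBdry, mem_coneBdry]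
    refine exists_congr fun j => not_congr ⟨?_, fun h => ⟨_, h, rfl⟩⟩
    rintro ⟨x, hx, e⟩
    cases x using lexSum_cases with
    | inl a => cases congrArg ofLex e
    | inr a =>
      have : a = j := Sum.inr_injective (congrArg ofLex e)
      exact this ▸ hx
  obtain ⟨h, hh, hgh⟩ := hf m (g.comp (sumMapLeft _ (e : P →o Q)))
    ((hg.comp _).mono fun S hS => (key S).2 hS) (by
      rw [← hgf, comp_comp, comp_comp]
      congr 1
      exact lexSum_hom_ext (fun _ => rfl) (fun _ => rfl))
  have e₁ : (sumMapLeft (Fin (m + 2)) (e : P →o Q)).comp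
      (sumMapLeft (Fin (m + 2)) (e.symm : Q →o P)) = OrderHom.id :=
    lexSum_hom_ext (fun a => by simp) (fun _ => rfl)
  refine ⟨h.comp (sumMapLeft _ (e.symm : Q →o P)), hh.comp_top _, fun d s hs => ?_⟩
  have e₂ : (sumMapLeft (Fin (m + 2)) (e : P →o Q)).comp
      ((sumMapLeft (Fin (m + 2)) (e.symm : Q →o P)).comp s) = s := congrArg (·.comp s) e₁
  have := hgh d ((sumMapLeft (Fin (m + 2)) (e.symm : Q →o P)).comp s) (by
    rw [← key, ← range_comp, e₂]
    exact hs)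
  refine Eq.trans ?_ this
  exact congrArg (g d) e₂.symm

section

variable {V W : Type} [PartialOrder V] [PartialOrder W]

/-- The cocone with vertex `e` over the set `K`. -/
def coneHom (K : Set W) (e : W) (h : ∀ k ∈ K, k ≤ e) : K ⊕ₗ Fin 1 →o W :=
  sumDesc (OrderHom.Subtype.val _) (OrderHom.const _ e) fun k _ => h k k.2

/-- The restriction of the family `f` to `K` and `e` is a colimit cocone. -/
structure IsColimAt (f : PMap W C) (K : Set W) (e : W) : Prop where
  lt : ∀ k ∈ K, k < e
  isColimit : IsColimit (f.comp (coneHom K e fun k hk => (lt k hk).le))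

lemma range_coneHom {K : Set W} {e : W} (h : ∀ k ∈ K, k ≤ e) :
    Set.range (coneHom K e h) ⊆ insert e K := by
  rintro _ ⟨x, rfl⟩
  cases x using lexSum_cases with
  | inl a => exact Or.inr a.2
  | inr a => exact Or.inl rfl

lemma IsColimAt.congr {f g : PMap W C} {K : Set W} {e : W} (hf : IsColimAt f K e)
    (h : EqOn (LowerSet.Iic (insert e K)) f g) : IsColimAt g K e := by
  refine ⟨hf.lt, ?_⟩
  have : g.comp (coneHom K e fun k hk => (hf.lt k hk).le) =
      f.comp (coneHom K e fun k hk => (hf.lt k hk).le) := by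
    funext d s
    refine (h d _ ?_).symm
    rw [range_comp]
    exact (Set.image_subset_range _ _).trans (range_coneHom _)
  rw [this]
  exact hf.isColimit

/-- Being a colimit cocone depends only on the restriction to the cocone itself, so it can be moved
freely between ambient posets. -/
lemma isColimAt_image (ψ : V ↪o W) {f : PMap W C} {K : Set V} {e : V} :
    IsColimAt f (ψ '' K) (ψ e) ↔ IsColimAt (f.comp (ψ : V →o W)) K e := by
  have hlt : (∀ k ∈ ψ '' K, k < ψ e) ↔ ∀ k ∈ K, k < e := by
    simp
  let E : K ≃o ψ '' K :=
    { toEquiv := Equiv.Set.image ψ K ψ.injective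
      map_rel_iff' := by simp [Equiv.Set.image_apply] }
  have key : ∀ (h : ∀ k ∈ K, k ≤ e) (h' : ∀ k ∈ ψ '' K, k ≤ ψ e),
      (f.comp (coneHom (ψ '' K) (ψ e) h')).comp (sumMapLeft _ (E : K →o ψ '' K)) =
        (f.comp (ψ : V →o W)).comp (coneHom K e h) := by
    intro h h'
    rw [comp_comp, comp_comp]
    congr 1
    exact lexSum_hom_ext (fun _ => rfl) (fun _ => rfl)
  constructor
  · intro H
    have e₁ : (coneHom (ψ '' K) (ψ e) fun k hk => (H.lt k hk).le).comp
        ((sumMapLeft (Fin 1) (E : K →o ψ '' K)).comp (sumMapLeft (Fin 1) (E.symm : ψ '' K →o K))) =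
        coneHom (ψ '' K) (ψ e) fun k hk => (H.lt k hk).le :=
      lexSum_hom_ext (fun a => congrArg Subtype.val (E.apply_symm_apply a)) (fun _ => rfl)
    refine ⟨hlt.1 H.lt, IsColimit.of_orderIso E.symm ?_⟩
    rw [← key (fun k hk => (hlt.1 H.lt k hk).le) fun k hk => (H.lt k hk).le, comp_comp]
    convert H.isColimit using 1
    exact congrArg f.comp e₁
  · intro H
    refine ⟨hlt.2 H.lt, IsColimit.of_orderIso E ?_⟩
    rw [key fun k hk => (H.lt k hk).le]
    exact H.isColimit

/-- The image of a cocone under a map of cocone shapes that need not be an embedding on the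
cone vertex. -/
lemma IsColimit.isColimAt {P : Type} [PartialOrder P] {f : PMap (P ⊕ₗ Fin 1) C}
    (hf : IsColimit f) : IsColimAt f (Set.range Sum.inlₗ) (Sum.inrₗ 0) := by
  let E : P ≃o (Set.range (Sum.inlₗ : P → P ⊕ₗ Fin 1)) :=
    { toEquiv := Equiv.ofInjective _ (fun a b h => Sum.inl_injective (congrArg ofLex h))
      map_rel_iff' := Sum.Lex.inl_le_inl_iff }
  refine ⟨by rintro _ ⟨a, rfl⟩; exact Sum.Lex.inl_lt_inr _ _, IsColimit.of_orderIso E ?_⟩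
  rw [comp_comp]
  convert hf using 1
  change f.comp _ = f.comp OrderHom.id
  congr 1
  refine lexSum_hom_ext (fun _ => rfl) (fun b => ?_)
  rw [Subsingleton.elim b 0]
  rfl

/-- Extension over a cell of the form `K ⋆ Δ[m + 1]`, relative to `K ⋆ ∂Δ[m + 1]`. -/
lemma exists_extension_colim {K d : Set W} {e : W} {f : PMap W C} (hK : IsColimAt f K e)
    (hd : IsSimplex d) (he : IsLeast d e) (hne : ∃ y ∈ d, e < y)
    (hf : f.NatOn (notAbove (LowerSet.Iic (K ∪ d)) d)) :
    ∃ g : PMap W C, g.NatOn (LowerSet.Iic (K ∪ d)) ∧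
      EqOn (notAbove (LowerSet.Iic (K ∪ d)) d) f g := by
  obtain ⟨hdf, hdn, hdt⟩ := isSimplex_iff.1 hd
  obtain ⟨n, j, rfl⟩ := exists_orderEmbedding hdf hdn hdt
  have hj₀ : j 0 = e := le_antisymm (by
    obtain ⟨i, hi⟩ := he.1
    rw [← hi]
    exact j.monotone (Fin.zero_le i)) (he.2 ⟨0, rfl⟩)
  -- The colimit property only concerns simplices of positive dimension; the vertex above `e`
  -- guarantees this.
  obtain ⟨m, rfl⟩ : ∃ m, n = m + 1 := by
    obtain ⟨_, ⟨i, rfl⟩, hi⟩ := hne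
    have : (0 : Fin (n + 1)) < i := j.lt_iff_lt.1 (hj₀ ▸ hi)
    exact ⟨n - 1, by have := i.2; have := Fin.lt_def.1 ‹0 < i›; simp at this; omega⟩
  let ψ : K ⊕ₗ Fin (m + 2) ↪o W := sumDescEmb (OrderEmbedding.subtype _) j fun k i =>
    (hK.lt k k.2).trans_le (hj₀ ▸ j.monotone (Fin.zero_le i))
  have hψ : Set.range ψ = K ∪ Set.range j := by
    ext x
    constructor
    · rintro ⟨y, rfl⟩
      cases y using lexSum_cases with
      | inl a => exact Or.inl a.2
      | inr a => exact Or.inr ⟨a, rfl⟩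
    · rintro (hx | ⟨i, rfl⟩)
      · exact ⟨Sum.inlₗ ⟨x, hx⟩, rfl⟩
      · exact ⟨Sum.inrₗ i, rfl⟩
  have key : ∀ S : Set (K ⊕ₗ Fin (m + 2)), (ψ : K ⊕ₗ Fin (m + 2) →o W) '' S ∈
      notAbove (LowerSet.Iic (K ∪ Set.range j)) (Set.range j) ↔ S ∈ coneBdry K m := by
    intro S
    rw [mem_notAbove, mem_coneBdry]
    have h₁ : (ψ : K ⊕ₗ Fin (m + 2) →o W) '' S ∈ LowerSet.Iic (K ∪ Set.range j) := by
      rw [← hψ]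
      exact Set.image_subset_range _ _
    rw [and_iff_right h₁, Set.range_subset_iff, not_forall]
    refine exists_congr fun i => not_congr ⟨?_, fun h => ⟨_, h, rfl⟩⟩
    rintro ⟨x, hx, e⟩
    have : x = Sum.inrₗ i := ψ.injective e
    exact this ▸ hx
  obtain ⟨h, hh, hh'⟩ := hK.isColimit m (f.comp (ψ : K ⊕ₗ Fin (m + 2) →o W))
    ((hf.comp _).mono fun S hS => (key S).2 hS) (by
      rw [comp_comp]
      congr 1
      exact lexSum_hom_ext (fun _ => rfl) (fun _ => hj₀))
  obtain ⟨g, hg₁, hg₂, -⟩ := exists_extend ψ hh f (G := LowerSet.Iic (K ∪ Set.range j))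
    (B := notAbove (LowerSet.Iic (K ∪ Set.range j)) (Set.range j))
    (fun S hS => hψ ▸ hS) le_top (fun S hS => hS.1) (hh'.mono fun S hS => (key S).1 hS)
  exact ⟨g, hg₁, hg₂⟩

/-- Extension over simplices whose part above the smallest vertex `e` in `M` can be filled by
means of a colimit cocone with vertex `e`. -/
theorem exists_extension_of_join {A B : LowerSet (Set W)} (M : Set W) (K : W → Set W)
    {f : PMap W C} (hf : f.NatOn A)
    (h : ∀ S, IsSimplex S → S ∈ B → S ∉ A → (S ∩ M).Nonempty ∧ ∀ e, IsLeast (S ∩ M) e →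
      IsColimAt f (K e) e ∧ LowerSet.Iic (insert e (K e)) ≤ A ∧ (∀ y ∈ K e, y ∉ M) ∧
      (∀ y ∈ S, ¬ e ≤ y → y ∈ K e) ∧ (S ∩ Set.Ici e) ∉ A ∧ (∃ y ∈ S, e < y) ∧
      ∀ T, IsSimplex T → T ⊆ K e ∪ (S ∩ Set.Ici e) → T ∈ B) :
    ∃ g : PMap W C, g.NatOn B ∧ EqOn A f g := by
  -- The cells are the joins of `K e` with `d`, where `d` is the part of a new simplex above its
  -- first vertex `e` in `M`.
  let ι : Type := {i : Set W × W // IsSimplex i.1 ∧ i.1 ∈ B ∧ i.1 ∉ A ∧ IsLeast (i.1 ∩ M) i.2 ∧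
    ∀ y ∈ i.1, i.2 ≤ y}
  have tail : ∀ S, IsSimplex S → S ∈ B → S ∉ A → ∃ i : ι, i.1.1 = S ∩ Set.Ici i.1.2 ∧
      i.1.2 ∈ S ∩ M ∧ S ⊆ K i.1.2 ∪ i.1.1 := by
    intro S hS hB hA
    obtain ⟨hn, H⟩ := h S hS hB hA
    obtain ⟨e, he⟩ := hS.exists_isLeast hn
    obtain ⟨-, -, -, h₄, h₅, -, h₇⟩ := H e he
    have hd : IsSimplex (S ∩ Set.Ici e) := hS.subset (fun _ hy => hy.1) ⟨e, he.1.1, le_rfl⟩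
    refine ⟨⟨((S ∩ Set.Ici e), e), hd, h₇ _ hd Set.subset_union_right, h₅,
      ⟨⟨⟨he.1.1, le_rfl⟩, he.1.2⟩, fun y hy => hy.1.2⟩, fun y hy => hy.2⟩, rfl, he.1,
      fun y hy => ?_⟩
    by_cases hey : e ≤ y
    · exact Or.inr ⟨hy, hey⟩
    · exact Or.inl (h₄ y hy hey)
  have info : ∀ i : ι, IsColimAt f (K i.1.2) i.1.2 ∧
      LowerSet.Iic (insert i.1.2 (K i.1.2)) ≤ A ∧ (∀ y ∈ K i.1.2, y ∉ M) ∧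
      (∃ y ∈ i.1.1, i.1.2 < y) ∧ ∀ T, IsSimplex T → T ⊆ K i.1.2 ∪ i.1.1 → T ∈ B := by
    rintro ⟨⟨d, e⟩, hd, hB, hA, he, hed⟩
    obtain ⟨h₁, h₂, h₃, -, -, h₆, h₇⟩ := (h d hd hB hA).2 e he
    have : d ∩ Set.Ici e = d := Set.inter_eq_left.2 hed
    rw [this] at h₇
    exact ⟨h₁, h₂, h₃, h₆, h₇⟩
  suffices H : ∃ g : PMap W C, g.NatOn (allStages A fun i : ι => LowerSet.Iic (K i.1.2 ∪ i.1.1)) ∧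
      EqOn A f g by
    obtain ⟨g, hg, hg'⟩ := H
    refine ⟨g, hg.mono_of_isSimplex fun S hS hB => ?_, hg'⟩
    by_cases hA : S ∈ A
    · exact Or.inl hA
    · obtain ⟨i, -, -, hi⟩ := tail S hS hB hA
      exact Or.inr ⟨i, hi⟩
  -- Since `K e` does not meet `M`, the first vertex in `M` of a new simplex in the cell of `d`
  -- belongs to `d`. Its part above that vertex is then contained in `d`, properly unless the
  -- simplex contains all of `d`.
  refine exists_extension_of_cells (rank := fun i : ι => i.1.1.ncard) (core := fun i => i.1.1) hf
    ?_ ?_ ?_ ?_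
  · intro i S hS hSi hcore
    replace hSi : S ⊆ K i.1.2 ∪ i.1.1 := hSi
    by_cases hA : S ∈ A
    · exact Or.inl hA
    obtain ⟨h₁, -, h₃, -, h₅⟩ := info i
    obtain ⟨i', h₁', h₂', h₃'⟩ := tail S hS (h₅ S hS hSi) hA
    refine Or.inr ⟨i', ?_, h₃'⟩
    apply Set.ncard_lt_ncard _ i.2.1.finite
    have he' : i'.1.2 ∈ i.1.1 := (hSi h₂'.1).resolve_left fun h => h₃ _ h h₂'.2
    have hsub : i'.1.1 ⊆ i.1.1 := by
      intro y hy
      rw [h₁'] at hy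
      refine (hSi hy.1).resolve_left fun h => ?_
      exact absurd ((i.2.2.2.2.2 _ he').trans hy.2) (h₁.lt y h).not_ge
    refine hsub.ssubset_of_ne fun e => hcore ?_
    rw [← e, h₁']
    exact fun y hy => hy.1
  · intro i i' S hS hiS hSi' hr
    obtain ⟨h₁, -, h₃, -, h₅⟩ := info i'
    have hi : i.1.1 ⊆ K i'.1.2 ∪ i'.1.1 := hiS.trans hSi'
    have he : i.1.2 ∈ i'.1.1 := (hi i.2.2.2.2.1.1.1).resolve_left fun h => h₃ _ h i.2.2.2.2.1.1.2
    have hsub : i.1.1 ⊆ i'.1.1 := by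
      intro y hy
      refine (hi hy).resolve_left fun h => ?_
      exact absurd ((i'.2.2.2.2.2 _ he).trans (i.2.2.2.2.2 y hy)) (h₁.lt y h).not_ge
    have e : i.1.1 = i'.1.1 := Set.eq_of_subset_of_ncard_le hsub hr i'.2.1.finite
    have e' : i.1.2 = i'.1.2 := i.2.2.2.2.1.unique (e ▸ i'.2.2.2.2.1)
    exact Subtype.ext (Prod.ext e e')
  · intro i S hS hSA hiS
    exact i.2.2.2.1 (A.lower hiS hSA)
  · intro i f' hf' hff'
    obtain ⟨h₁, h₂, -, h₄, -⟩ := info i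
    -- The cocone lies in `A`, where the current partial map agrees with `f`, so it is still a
    -- colimit cocone.
    exact exists_extension_colim (h₁.congr (hff'.mono h₂)) i.2.1
      ⟨i.2.2.2.2.1.1.1, fun y hy => i.2.2.2.2.2 y hy⟩ h₄ hf'

end

end PMap

end ExInf

end

/-! ### Colimits over cofinal subsets and of left Kan extended diagrams. -/

noncomputable section

set_option linter.unusedSectionVars false

namespace ExInf

namespace PMap

variable {C : SSet.{u}}

open Classical in
/-- Partial maps that agree on the common part of their domains can be glued. -/
lemma exists_glue {W : Type} [Preorder W] {A B : LowerSet (Set W)} {f g : PMap W C}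
    (hf : f.NatOn A) (hg : g.NatOn B) (h : EqOn (A ⊓ B) f g) :
    ∃ k : PMap W C, k.NatOn (A ⊔ B) ∧ EqOn A f k ∧ EqOn B g k := by
  let k : PMap W C := fun d s => if Set.range s ∈ A then f d s else g d s
  have hA : EqOn A f k := fun d s hs => (if_pos hs).symm
  have hB : EqOn B g k := by
    intro d s hs
    by_cases h' : Set.range s ∈ A
    · rw [← hA d s h', h d s ⟨h', hs⟩]
    · exact (if_neg h').symm
  refine ⟨k, fun d s hs e φ => ?_, hA, hB⟩
  rcases hs with hs | hs
  · exact hf.congr hA d s hs e φ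
  · exact hg.congr hB d s hs e φ

section

variable {W : Type} [PartialOrder W]

/-- The cocone with vertex `e` over the set `K`, as an order embedding. -/
def coneHomEmb (K : Set W) (e : W) (h : ∀ k ∈ K, k < e) : K ⊕ₗ Fin 1 ↪o W :=
  sumDescEmb (OrderEmbedding.subtype _)
    (OrderEmbedding.ofMapLEIff (fun _ => e) fun a b => by simp [Subsingleton.elim a b])
    fun k _ => h k k.2

/-- The inclusion of the cocone with vertex `0`, as an order embedding. -/
def coneZeroEmb (P : Type) [PartialOrder P] (m : ℕ) : P ⊕ₗ Fin 1 ↪o P ⊕ₗ Fin (m + 2) :=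
  OrderEmbedding.ofMapLEIff (coneZero P m) (by
    intro a b
    cases a using lexSum_cases with
    | inl a =>
      cases b using lexSum_cases with
      | inl b => exact Sum.Lex.inl_le_inl_iff.trans Sum.Lex.inl_le_inl_iff.symm
      | inr b => exact iff_of_true (Sum.Lex.inl_le_inr _ _) (Sum.Lex.inl_le_inr _ _)
    | inr a =>
      cases b using lexSum_cases with
      | inl b => exact iff_of_false Sum.Lex.not_inr_le_inl Sum.Lex.not_inr_le_inl
      | inr b => rw [Subsingleton.elim a b]; exact iff_of_true le_rfl le_rfl)

/-- The subset of the base of a cocone shape given by a subset of `W`. -/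
def baseSet (K : Set W) (L : Set W) (m : ℕ) : Set (K ⊕ₗ Fin (m + 1)) :=
  {x | ∃ y : K, y.1 ∈ L ∧ Sum.inlₗ y = x}

lemma inl_mem_baseSet {K L : Set W} {m : ℕ} {y : K} :
    Sum.inlₗ y ∈ baseSet K L m ↔ y.1 ∈ L :=
  ⟨fun ⟨_, hz, e⟩ => Sum.inl_injective (congrArg ofLex e) ▸ hz, fun h => ⟨y, h, rfl⟩⟩

lemma inr_notMem_baseSet {K L : Set W} {m : ℕ} {j : Fin (m + 1)} :
    Sum.inrₗ j ∉ baseSet K L m := by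
  rintro ⟨z, -, e⟩
  cases congrArg ofLex e

/-- The cocone is transported along the embeddings of `K ⊕ₗ Fin 1` into `W` and into `K ⊕ₗ Fin (m +
2)`, on which `f` and `g` agree. Thus colimit cocones of `f` can be used in the extension problems
that test the colimit property of `f` itself. -/
lemma IsColimAt.lift {f : PMap W C} {K L : Set W} {e : W} (h : ∀ k ∈ K, k < e) {m : ℕ}
    {g : PMap (K ⊕ₗ Fin (m + 2)) C}
    (hg : g.comp (coneZero K m) = f.comp (coneHom K e fun k hk => (h k hk).le))
    (hL : L ⊆ K) (x : K ⊕ₗ Fin 1) (hx : IsColimAt f L (coneHomEmb K e h x)) :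
    IsColimAt g (baseSet K L (m + 1)) (coneZero K m x) := by
  have e₁ : L = coneHomEmb K e h '' baseSet K L 0 := by
    ext y
    constructor
    · intro hy
      exact ⟨_, ⟨⟨y, hL hy⟩, hy, rfl⟩, rfl⟩
    · rintro ⟨_, ⟨y, hy, rfl⟩, rfl⟩
      exact hy
  have e₂ : baseSet K L (m + 1) = coneZeroEmb K m '' baseSet K L 0 := by
    ext y
    constructor
    · rintro ⟨y, hy, rfl⟩
      exact ⟨_, ⟨y, hy, rfl⟩, rfl⟩
    · rintro ⟨_, ⟨y, hy, rfl⟩, rfl⟩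
      exact ⟨y, hy, rfl⟩
  rw [e₁, isColimAt_image] at hx
  rw [e₂]
  refine (isColimAt_image (coneZeroEmb K m) (e := x)).2 ?_
  have e₃ : g.comp (coneZeroEmb K m : K ⊕ₗ Fin 1 →o K ⊕ₗ Fin (m + 2)) =
      f.comp (coneHomEmb K e h : K ⊕ₗ Fin 1 →o W) := hg
  rwa [e₃]

/-- Families of vertex sets of `K ⋆ Δ[m + 1]` that only depend on the vertices in `Δ[m + 1]`. -/
def IsApexFamily {K : Set W} {m : ℕ} (Z : LowerSet (Set (K ⊕ₗ Fin (m + 2)))) : Prop :=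
  ∀ S S', (∀ j : Fin (m + 2), Sum.inrₗ j ∈ S → Sum.inrₗ j ∈ S') → S' ∈ Z → S ∈ Z

lemma isApexFamily_top {K : Set W} {m : ℕ} :
    IsApexFamily (⊤ : LowerSet (Set (K ⊕ₗ Fin (m + 2)))) := fun _ _ _ _ => trivial

lemma isApexFamily_coneBdry {K : Set W} {m : ℕ} : IsApexFamily (coneBdry K m) := by
  intro S S' h hS
  rw [mem_coneBdry] at hS ⊢
  exact hS.imp fun j hj hj' => hj (h j hj')

lemma mem_Iic_range_coneZero {K : Set W} {m : ℕ} {S : Set (K ⊕ₗ Fin (m + 2))} :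
    S ∈ LowerSet.Iic (Set.range (coneZero K m)) ↔ ∀ j, Sum.inrₗ j ∈ S → j = 0 := by
  constructor
  · intro h j hj
    obtain ⟨x, hx⟩ := h hj
    cases x using lexSum_cases with
    | inl a => cases congrArg ofLex hx
    | inr a => exact (Sum.inr_injective (congrArg ofLex hx)).symm
  · intro h x hx
    cases x using lexSum_cases with
    | inl a => exact ⟨Sum.inlₗ a, rfl⟩
    | inr a =>
      rw [h a hx]
      exact ⟨Sum.inrₗ 0, rfl⟩

lemma range_coneZero_comp_mem_Iic {K : Set W} {m : ℕ} {d : SimplexCategory}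
    (s : Fin (d.len + 1) →o K ⊕ₗ Fin 1) :
    Set.range ((coneZero K m).comp s) ∈ LowerSet.Iic (Set.range (coneZero K m)) := by
  rw [range_comp]
  exact Set.image_subset_range _ _

lemma isApexFamily_coneZero {K : Set W} {m : ℕ} :
    IsApexFamily (LowerSet.Iic (Set.range (coneZero K m))) := by
  intro S S' h hS
  rw [mem_Iic_range_coneZero] at hS ⊢
  exact fun j hj => hS j (h j hj)

lemma coneZero_le_coneBdry {K : Set W} {m : ℕ} :
    LowerSet.Iic (Set.range (coneZero K m)) ≤ coneBdry K m := by
  intro S hS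
  refine mem_coneBdry.2 ⟨1, fun h => ?_⟩
  simpa using mem_Iic_range_coneZero.1 hS 1 h

/-- The vertex sets of the simplices of `L ⋆ Δ[m + 1]` inside `K ⋆ Δ[m + 1]`. -/
def overBase (K L : Set W) (m : ℕ) : LowerSet (Set (K ⊕ₗ Fin (m + 2))) :=
  LowerSet.Iic (baseSet K L (m + 1) ∪ Set.range Sum.inrₗ)

lemma mem_overBase {K L : Set W} {m : ℕ} {S : Set (K ⊕ₗ Fin (m + 2))} :
    S ∈ overBase K L m ↔ ∀ y : K, Sum.inlₗ y ∈ S → y.1 ∈ L := by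
  constructor
  · intro h y hy
    rcases h hy with h' | ⟨j, hj⟩
    · exact inl_mem_baseSet.1 h'
    · cases congrArg ofLex hj
  · intro h x hx
    cases x using lexSum_cases with
    | inl a => exact Or.inl (inl_mem_baseSet.2 (h a hx))
    | inr a => exact Or.inr ⟨a, rfl⟩

lemma isSimplex_range_inr {P : Type} [PartialOrder P] {m : ℕ} :
    IsSimplex (Set.range (Sum.inrₗ : Fin (m + 1) → P ⊕ₗ Fin (m + 1))) :=
  ⟨⦋m⦌, ⟨fun i => Sum.inrₗ i, fun _ _ h => Sum.Lex.inr_le_inr_iff.2 h⟩, rfl⟩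

/-- If maps out of `K ⋆ Z ∪ L ⋆ T` extend to `K ⋆ T` for suitable `Z ⊆ T ⊆ Δ[m + 1]`, then cocones
over `K` and over `L` are colimit cocones at the same time. -/
theorem isColimAt_iff_of_extension {f : PMap W C} {K L : Set W} {e : W} (hLK : L ⊆ K)
    (hlt : ∀ k ∈ K, k < e) (hf : f.NatOn (LowerSet.Iic (insert e K)))
    (H : ∀ (m : ℕ) (Z T : LowerSet (Set (K ⊕ₗ Fin (m + 2)))), IsApexFamily Z → IsApexFamily T →
      LowerSet.Iic (Set.range (coneZero K m)) ≤ Z → Z ≤ T →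
      ∀ g : PMap (K ⊕ₗ Fin (m + 2)) C, g.NatOn (Z ⊔ (T ⊓ overBase K L m)) →
        g.comp (coneZero K m) = f.comp (coneHom K e fun k hk => (hlt k hk).le) →
        ∃ h : PMap (K ⊕ₗ Fin (m + 2)) C, h.NatOn T ∧ EqOn (Z ⊔ (T ⊓ overBase K L m)) g h) :
    IsColimAt f L e ↔ IsColimAt f K e := by
  constructor
  · intro hL
    -- The map is given on `K ⋆ ∂Δ[m + 1]`. The colimit over `L` extends it to `L ⋆ Δ[m + 1]`, and
    -- `H` with `T = ⊤` extends the union to `K ⋆ Δ[m + 1]`.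
    refine ⟨hlt, fun m g hg hgf => ?_⟩
    have h₁ : IsColimAt g (baseSet K L (m + 1)) (Sum.inrₗ 0) :=
      IsColimAt.lift hlt hgf hLK (Sum.inrₗ 0) hL
    have hle : notAbove (overBase K L m) (Set.range Sum.inrₗ) ≤ coneBdry K m :=
      fun S hS => ⟨trivial, hS.2⟩
    obtain ⟨g₁, hg₁, hgg₁⟩ := exists_extension_colim h₁ isSimplex_range_inr
      ⟨⟨0, rfl⟩, by rintro _ ⟨j, rfl⟩; exact Sum.Lex.inr_le_inr_iff.2 (Fin.zero_le j)⟩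
      ⟨Sum.inrₗ 1, ⟨1, rfl⟩, Sum.Lex.inr_lt_inr_iff.2 Fin.zero_lt_one⟩ (hg.mono hle)
    obtain ⟨g₂, hg₂, h₂, h₂'⟩ := exists_glue hg hg₁ fun d s hs => hgg₁ d s ⟨hs.2, hs.1.2⟩
    obtain ⟨h, hh, hgh⟩ := H m (coneBdry K m) ⊤ isApexFamily_coneBdry isApexFamily_top
      coneZero_le_coneBdry le_top g₂ (hg₂.mono (sup_le_sup_left inf_le_right _)) (by
        rw [← hgf]
        funext d s
        exact (h₂ d _ (coneZero_le_coneBdry (range_coneZero_comp_mem_Iic s))).symm)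
    exact ⟨h, hh, h₂.trans (hgh.mono le_sup_left)⟩
  · intro hK
    -- The map is given on `L ⋆ ∂Δ[m + 1]` and, by `f`, on `K ⋆ {0}`. Now `H` with `T` the boundary
    -- extends it to `K ⋆ ∂Δ[m + 1]`, the colimit over `K` extends it further to `K ⋆ Δ[m + 1]`, and
    -- the result is restricted to `L`.
    refine ⟨fun k hk => hlt k (hLK hk), fun m g hg hgf => ?_⟩
    let ψ : L ⊕ₗ Fin (m + 2) ↪o K ⊕ₗ Fin (m + 2) := OrderEmbedding.ofMapLEIff
      (sumMapLeft (Fin (m + 2)) ⟨Set.inclusion hLK, fun _ _ h => h⟩) (by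
        intro a b
        cases a using lexSum_cases with
        | inl a =>
          cases b using lexSum_cases with
          | inl b =>
            exact (Sum.Lex.inl_le_inl_iff (a := Set.inclusion hLK a)
              (b := Set.inclusion hLK b)).trans (Sum.Lex.inl_le_inl_iff (a := a) (b := b)).symm
          | inr b => exact iff_of_true (Sum.Lex.inl_le_inr _ _) (Sum.Lex.inl_le_inr _ _)
        | inr a =>
          cases b using lexSum_cases with
          | inl b => exact iff_of_false Sum.Lex.not_inr_le_inl Sum.Lex.not_inr_le_inl
          | inr b => exact Sum.Lex.inr_le_inr_iff.trans Sum.Lex.inr_le_inr_iff.symm)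
    have hψ : ∀ S ∈ overBase K L m, S ⊆ Set.range ψ := by
      intro S hS x hx
      cases x using lexSum_cases with
      | inl a => exact ⟨Sum.inlₗ ⟨a.1, mem_overBase.1 hS a hx⟩, rfl⟩
      | inr a => exact ⟨Sum.inrₗ a, rfl⟩
    have hψ' : ∀ S : Set (L ⊕ₗ Fin (m + 2)),
        (ψ : L ⊕ₗ Fin (m + 2) →o K ⊕ₗ Fin (m + 2)) '' S ∈ overBase K L m := by
      intro S
      rw [mem_overBase]
      rintro y ⟨x, hx, e⟩
      cases x using lexSum_cases with
      | inl a =>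
        have : Set.inclusion hLK a = y := Sum.inl_injective (congrArg ofLex e)
        exact this ▸ a.2
      | inr a => cases congrArg ofLex e
    have hψ'' : ∀ (S : Set (L ⊕ₗ Fin (m + 2))) (j : Fin (m + 2)), Sum.inrₗ j ∈
        (ψ : L ⊕ₗ Fin (m + 2) →o K ⊕ₗ Fin (m + 2)) '' S ↔ Sum.inrₗ j ∈ S := by
      refine fun S j => ⟨?_, fun h => ⟨_, h, rfl⟩⟩
      rintro ⟨x, hx, e⟩
      have : x = Sum.inrₗ j := ψ.injective e
      exact this ▸ hx
    let r : K ⊕ₗ Fin (m + 2) →o W :=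
      sumDesc (OrderHom.Subtype.val _) (OrderHom.const _ e) fun k _ => (hlt k k.2).le
    let Z := LowerSet.Iic (Set.range (coneZero K m))
    have hr : (f.comp r).NatOn Z := (hf.comp r).mono fun S _ => by
      rintro _ ⟨x, -, rfl⟩
      cases x using lexSum_cases with
      | inl a => exact Or.inr a.2
      | inr a => exact Or.inl rfl
    obtain ⟨g₁, hg₁, h₁, h₁'⟩ := exists_extend ψ hg (f.comp r)
      (G := coneBdry K m ⊓ overBase K L m) (B := Z ⊓ overBase K L m)
      (fun S hS => hψ S hS.2) (fun S hS => by
        have := mem_coneBdry.1 hS.1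
        simp only [hψ''] at this
        exact mem_coneBdry.2 this)
      (inf_le_inf_right _ coneZero_le_coneBdry) (by
        intro d s hs
        obtain ⟨t, rfl⟩ : ∃ t, (coneZero L m).comp t = s := by
          refine exists_comp_eq (coneZeroEmb L m) ?_
          refine mem_Iic_range_coneZero.2 fun j hj => ?_
          exact mem_Iic_range_coneZero.1 hs.1 j ((hψ'' _ j).2 hj)
        have e₁ : g d ((coneZero L m).comp t) = g.comp (coneZero L m) d t := rfl
        rw [e₁, hgf]
        have e₂ : (r.comp (ψ : L ⊕ₗ Fin (m + 2) →o K ⊕ₗ Fin (m + 2))).comp (coneZero L m) =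
            coneHom L e fun k hk => (hlt k (hLK hk)).le :=
          lexSum_hom_ext (fun _ => rfl) (fun _ => rfl)
        exact congrArg (fun j : L ⊕ₗ Fin 1 →o W => f d (j.comp t)) e₂)
    obtain ⟨g₂, hg₂, h₂, h₂'⟩ := exists_glue hr hg₁ (h₁.mono fun S hS => ⟨hS.1, hS.2.2⟩)
    have hg₂z : g₂.comp (coneZero K m) = f.comp (coneHom K e fun k hk => (hlt k hk).le) := by
      funext d s
      have e₂ : r.comp (coneZero K m) = coneHom K e fun k hk => (hlt k hk).le :=
        lexSum_hom_ext (fun _ => rfl) (fun _ => rfl)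
      exact (h₂ d _ (range_coneZero_comp_mem_Iic s)).symm.trans
        (congrArg (fun j : K ⊕ₗ Fin 1 →o W => f d (j.comp s)) e₂)
    obtain ⟨g₃, hg₃, h₃⟩ := H m Z (coneBdry K m) isApexFamily_coneZero isApexFamily_coneBdry
      le_rfl coneZero_le_coneBdry g₂ hg₂ hg₂z
    obtain ⟨h, hh, h₄⟩ := hK.isColimit m g₃ hg₃ (by
      rw [← hg₂z]
      funext d s
      exact (h₃ d _ (Or.inl (range_coneZero_comp_mem_Iic s))).symm)
    refine ⟨h.comp (ψ : L ⊕ₗ Fin (m + 2) →o K ⊕ₗ Fin (m + 2)), hh.comp_top _, fun d s hs => ?_⟩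
    have hs' : Set.range ((ψ : L ⊕ₗ Fin (m + 2) →o K ⊕ₗ Fin (m + 2)).comp s) ∈
        coneBdry K m ⊓ overBase K L m := by
      rw [range_comp]
      refine ⟨mem_coneBdry.2 ?_, hψ' _⟩
      simp only [hψ'']
      exact mem_coneBdry.1 hs
    calc g d s = g₁ d ((ψ : L ⊕ₗ Fin (m + 2) →o K ⊕ₗ Fin (m + 2)).comp s) :=
          (congrFun (congrFun h₁' d) s).symm
      _ = g₂ d _ := h₂' d _ hs'
      _ = g₃ d _ := h₃ d _ (Or.inr hs')
      _ = h d _ := h₄ d _ hs'.1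

/-- Colimits can be computed over cofinal subsets. -/
theorem isColimAt_iff_of_cofinal (hC : HasInnerFillers C) {f : PMap W C} {K L : Set W} {e : W}
    (hLK : L ⊆ K) (hlt : ∀ k ∈ K, k < e) (hf : f.NatOn (LowerSet.Iic (insert e K)))
    (hcof : ∀ x ∈ K, x ∉ L → ∃ z ∈ L, x < z ∧ ∀ y ∈ L, x ≤ y → z ≤ y) :
    IsColimAt f L e ↔ IsColimAt f K e := by
  refine isColimAt_iff_of_extension hLK hlt hf fun m Z T hZ hT hZ₀ hZT g hg _ => ?_
  -- The pairing inserts, after the last vertex outside `L`, the least element of `L` above it.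
  have hcof' : ∀ w ∈ baseSet K Lᶜ (m + 1), ∃ z ∈ baseSet K L (m + 1), w < z ∧
      ∀ y ∈ baseSet K L (m + 1), w ≤ y → z ≤ y := by
    rintro _ ⟨x, hx, rfl⟩
    obtain ⟨z, hz, hxz, hz'⟩ := hcof x x.2 hx
    refine ⟨Sum.inlₗ ⟨z, hLK hz⟩, inl_mem_baseSet.2 hz, Sum.Lex.inl_lt_inl_iff.2 hxz, ?_⟩
    rintro _ ⟨y, hy, rfl⟩ hxy
    exact Sum.Lex.inl_le_inl_iff.2 (hz' y hy (show x ≤ y from Sum.Lex.inl_le_inl_iff.1 hxy))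
  have : Nonempty (K ⊕ₗ Fin (m + 2)) := ⟨Sum.inrₗ 0⟩
  choose! κ hκ using hcof'
  refine exists_extension_of_pairing hC (baseSet K Lᶜ (m + 1)) κ (fun x hx => ?_)
    (fun S hS hST hSA => ?_) hg
  · obtain ⟨h₁, h₂, -⟩ := hκ x hx
    refine ⟨h₂, fun h => ?_⟩
    obtain ⟨z, hz, e⟩ := h₁
    obtain ⟨z', hz', e'⟩ := h
    have : z' = z := Sum.inl_injective (congrArg ofLex (e'.trans e.symm))
    exact hz' (this ▸ hz)
  · have hSZ : S ∉ Z := fun h => hSA (Or.inl h)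
    have hSL : S ∉ overBase K L m := fun h => hSA (Or.inr ⟨hST, h⟩)
    -- A new simplex has a vertex in `Δ[m + 1]`. It lies above the inserted vertex, so that the horn
    -- is inner.
    obtain ⟨j, hj, -⟩ : ∃ j, Sum.inrₗ j ∈ S ∧ j ≠ 0 := by
      by_contra hcon
      push Not at hcon
      exact hSZ (hZ₀ (mem_Iic_range_coneZero.2 hcon))
    refine ⟨?_, fun x hx => ?_⟩
    · rw [mem_overBase] at hSL
      push Not at hSL
      obtain ⟨y, hy, hyL⟩ := hSL
      exact ⟨_, hy, inl_mem_baseSet.2 hyL⟩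
    · obtain ⟨⟨z, hz, hzκ⟩, h₂, h₃⟩ := hκ x hx.1.2
      rw [← hzκ] at h₂ h₃ ⊢
      refine ⟨hT _ _ (fun i hi => ?_) hST, fun y hy => ?_, ⟨_, hj, Sum.Lex.inl_lt_inr _ _⟩, ?_⟩
      · exact (Set.mem_insert_iff.1 hi).resolve_left fun e => by cases congrArg ofLex e
      · rcases hS.total hy hx.1.1 with h | h
        · exact Or.inl (h.trans h₂.le)
        · cases y using lexSum_cases with
          | inl a =>
            by_cases ha : a.1 ∈ L
            · exact Or.inr (h₃ _ (inl_mem_baseSet.2 ha) h)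
            · exact Or.inl ((hx.2 ⟨hy, inl_mem_baseSet.2 ha⟩).trans h₂.le)
          | inr a => exact Or.inr (Sum.Lex.inl_le_inr _ _)
      · rintro (h | h)
        · refine hSZ (hZ S _ (fun i hi => ?_) h)
          exact ⟨hi, fun e => by cases congrArg ofLex e⟩
        · obtain ⟨x', hx', rfl⟩ := hx.1.2
          exact hx' (mem_overBase.1 h.2 x' ⟨hx.1.1, fun e => (e ▸ h₂).ne rfl⟩)

/-- If a diagram on `K` is left Kan extended from `L`, then it has the same colimit as its
restriction to `L`. -/
theorem isColimAt_iff_of_kan {f : PMap W C} {K L : Set W} {e : W} (hLK : L ⊆ K)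
    (hlt : ∀ k ∈ K, k < e) (hf : f.NatOn (LowerSet.Iic (insert e K)))
    (hkan : ∀ x ∈ K, x ∉ L → IsColimAt f (L ∩ Set.Iio x) x) :
    IsColimAt f L e ↔ IsColimAt f K e := by
  refine isColimAt_iff_of_extension hLK hlt hf fun m Z T hZ hT hZ₀ hZT g hg hgf => ?_
  -- At its first vertex `x` outside `L`, a new simplex is filled by means of the colimit cocone
  -- over the part of `L` below `x`.
  refine exists_extension_of_join (baseSet K Lᶜ (m + 1))
    (fun w => baseSet K L (m + 1) ∩ Set.Iio w) hg (fun S hS hST hSA => ?_)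
  have hSZ : S ∉ Z := fun h => hSA (Or.inl h)
  have hSL : S ∉ overBase K L m := fun h => hSA (Or.inr ⟨hST, h⟩)
  obtain ⟨j, hj, -⟩ : ∃ j, Sum.inrₗ j ∈ S ∧ j ≠ 0 := by
    by_contra hcon
    push Not at hcon
    exact hSZ (hZ₀ (mem_Iic_range_coneZero.2 hcon))
  refine ⟨?_, ?_⟩
  · rw [mem_overBase] at hSL
    push Not at hSL
    obtain ⟨y, hy, hyL⟩ := hSL
    exact ⟨_, hy, inl_mem_baseSet.2 hyL⟩
  · rintro w ⟨⟨hwS, x, hx, rfl⟩, hmin⟩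
    have hcol := IsColimAt.lift hlt hgf ((Set.inter_subset_left (s := L)).trans hLK) (Sum.inlₗ x)
      (hkan x x.2 hx)
    have e₁ : baseSet K (L ∩ Set.Iio x.1) (m + 1) =
        baseSet K L (m + 1) ∩ Set.Iio (Sum.inlₗ x) := by
      ext v
      constructor
      · rintro ⟨y, hy, rfl⟩
        exact ⟨⟨y, hy.1, rfl⟩, Sum.Lex.inl_lt_inl_iff.2 hy.2⟩
      · rintro ⟨⟨y, hy, rfl⟩, hv⟩
        exact ⟨y, ⟨hy, show y < x from Sum.Lex.inl_lt_inl_iff.1 (Set.mem_Iio.1 hv)⟩, rfl⟩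
    rw [e₁] at hcol
    have hbase : ∀ y ∈ baseSet K L (m + 1), y ∉ baseSet K Lᶜ (m + 1) := by
      rintro _ ⟨y, hy, rfl⟩ h
      exact inl_mem_baseSet.1 h hy
    refine ⟨hcol, fun S' hS' => Or.inl (hZ₀ (mem_Iic_range_coneZero.2 fun i hi => ?_)),
      fun y hy => hbase y hy.1, fun y hy hxy => ?_, ?_, ⟨_, hj, Sum.Lex.inl_lt_inr _ _⟩,
      fun S' hS' hS'' => hT _ _ (fun i hi => ?_) hST⟩
    · rcases hS' hi with h | h
      · cases congrArg ofLex h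
      · exact (inr_notMem_baseSet h.1).elim
    · have hyx : y < Sum.inlₗ x := lt_of_le_not_ge ((hS.total hy hwS).resolve_right hxy) hxy
      refine ⟨?_, hyx⟩
      cases y using lexSum_cases with
      | inl a =>
        by_contra ha
        exact hxy (hmin ⟨hy, inl_mem_baseSet.2 fun h => ha (inl_mem_baseSet.2 h)⟩)
      | inr a => exact (hxy (Sum.Lex.inl_le_inr _ _)).elim
    · rintro (h | h)
      · refine hSZ (hZ S _ (fun i hi => ?_) h)
        exact ⟨hi, Sum.Lex.inl_le_inr _ _⟩
      · exact hx (mem_overBase.1 h.2 x ⟨hwS, Set.mem_Ici.2 le_rfl⟩)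
    · rcases hS'' hi with h | h
      · exact (inr_notMem_baseSet h.1).elim
      · exact h.1

end

end PMap

end ExInf

end

noncomputable section

set_option linter.unusedSectionVars false

namespace ExInf

namespace PMap

/-! ### Duality -/

section

variable {W : Type} [Preorder W] {C : SSet.{u}}

/-- The reversal of a monotone sequence in the dual of `W`. -/
def ofDualSeq {n : ℕ} (s : Fin (n + 1) →o Wᵒᵈ) : Fin (n + 1) →o W where
  toFun i := OrderDual.ofDual (s i.rev)
  monotone' _ _ h := s.monotone (Fin.rev_le_rev.2 h)

/-- The reversal of a monotone sequence in `W`. -/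
def toDualSeq {n : ℕ} (s : Fin (n + 1) →o W) : Fin (n + 1) →o Wᵒᵈ where
  toFun i := OrderDual.toDual (s i.rev)
  monotone' _ _ h := s.monotone (Fin.rev_le_rev.2 h)

@[simp] lemma ofDualSeq_toDualSeq {n : ℕ} (s : Fin (n + 1) →o W) :
    ofDualSeq (toDualSeq s) = s := by
  ext i
  exact congrArg s (Fin.rev_rev i)

@[simp] lemma toDualSeq_ofDualSeq {n : ℕ} (s : Fin (n + 1) →o Wᵒᵈ) :
    toDualSeq (ofDualSeq s) = s := by
  ext i
  exact congrArg s (Fin.rev_rev i)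

/-- The family in the opposite simplicial set. -/
def op (f : PMap W C) : PMap Wᵒᵈ C.op := fun d s => SSet.opObjEquiv.symm (f d (ofDualSeq s))

/-- The family in `C` given by a family in the opposite simplicial set. -/
def unop (f : PMap Wᵒᵈ C.op) : PMap W C := fun d s => SSet.opObjEquiv (f d (toDualSeq s))

@[simp] lemma unop_op (f : PMap W C) : f.op.unop = f := by
  funext d s
  simp [op, unop]

@[simp] lemma op_unop (f : PMap Wᵒᵈ C.op) : f.unop.op = f := by
  funext d s
  simp [op, unop]

lemma op_comp {V : Type} [Preorder V] (f : PMap W C) (j : V →o W) :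
    (f.comp j).op = f.op.comp j.dual := rfl

/-- The sets of vertices in the dual of `W` that belong to `A`. -/
def dualSets (A : LowerSet (Set W)) : LowerSet (Set Wᵒᵈ) :=
  ⟨{S | OrderDual.toDual ⁻¹' S ∈ A}, fun _ _ h hS => A.lower (Set.preimage_mono h) hS⟩

lemma mem_dualSets {A : LowerSet (Set W)} {S : Set Wᵒᵈ} :
    S ∈ dualSets A ↔ OrderDual.toDual ⁻¹' S ∈ A := Iff.rfl

lemma range_ofDualSeq {n : ℕ} (s : Fin (n + 1) →o Wᵒᵈ) :
    Set.range (ofDualSeq s) = OrderDual.toDual ⁻¹' Set.range s := by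
  ext x
  constructor
  · rintro ⟨i, rfl⟩
    exact ⟨i.rev, rfl⟩
  · rintro ⟨i, hi⟩
    exact ⟨i.rev, (congrArg (fun j => OrderDual.ofDual (s j)) (Fin.rev_rev i)).trans hi⟩

lemma ofDualSeq_comp {d e : SimplexCategory} (s : Fin (d.len + 1) →o Wᵒᵈ) (φ : e ⟶ d) :
    ofDualSeq (s.comp φ.toOrderHom) =
      (ofDualSeq s).comp (SimplexCategory.rev.map φ).toOrderHom := by
  ext i
  exact congrArg (fun j => OrderDual.ofDual (s j)) (Fin.rev_rev _).symm

lemma natOn_op {f : PMap W C} {A : LowerSet (Set W)} :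
    f.op.NatOn (dualSets A) ↔ f.NatOn A := by
  constructor
  · intro h d s hs e φ
    have := h d (toDualSeq s) (by
      rw [mem_dualSets, ← range_ofDualSeq, ofDualSeq_toDualSeq]
      exact hs) e (SimplexCategory.rev.map φ)
    rw [SSet.op_map] at this
    have := SSet.opObjEquiv.symm.injective this
    rw [Quiver.Hom.unop_op, SimplexCategory.rev_map_rev_map, ofDualSeq_comp,
      SimplexCategory.rev_map_rev_map] at this
    simpa [op] using this
  · intro h d s hs e φ
    rw [SSet.op_map]
    refine congrArg SSet.opObjEquiv.symm ?_
    rw [ofDualSeq_comp]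
    exact h d (ofDualSeq s) (by rwa [range_ofDualSeq]) e (SimplexCategory.rev.map φ)

lemma eqOn_op {f g : PMap W C} {A : LowerSet (Set W)} :
    EqOn (dualSets A) f.op g.op ↔ EqOn A f g := by
  constructor
  · intro h d s hs
    have := SSet.opObjEquiv.symm.injective (h d (toDualSeq s) (by
      rw [mem_dualSets, ← range_ofDualSeq, ofDualSeq_toDualSeq]
      exact hs))
    simpa using this
  · intro h d s hs
    exact congrArg SSet.opObjEquiv.symm (h d (ofDualSeq s) (by rwa [range_ofDualSeq]))

lemma isSimplex_preimage_toDual {S : Set Wᵒᵈ} (h : IsSimplex S) :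
    IsSimplex (OrderDual.toDual ⁻¹' S : Set W) := by
  obtain ⟨d, s, rfl⟩ := h
  exact ⟨d, ofDualSeq s, range_ofDualSeq s⟩

end

end PMap

/-- Reversing the order of the vertices turns the horn at `k` into the horn at `k.rev`, and inner
horns stay inner. -/
lemma HasInnerFillers.op {C : SSet.{u}} (hC : HasInnerFillers C) : HasInnerFillers C.op := by
  intro n k f h₀ h₁ hf
  let r : (Fin (n + 1))ᵒᵈ ≃o Fin (n + 1) := Fin.revOrderIso
  have key : ∀ S : Set (Fin (n + 1))ᵒᵈ,
      (r : (Fin (n + 1))ᵒᵈ →o Fin (n + 1)) '' S ∈ PMap.notAbove ⊤ {k}ᶜ ↔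
        S ∈ PMap.dualSets (PMap.notAbove ⊤ {k.rev}ᶜ) := by
    intro S
    refine and_congr Iff.rfl (not_congr ?_)
    constructor
    · intro h i hi
      obtain ⟨j, hj, e⟩ := h (a := i.rev) (fun e => hi (by
        rw [← (e : i.rev = k), Fin.rev_rev]; rfl))
      have : j = OrderDual.toDual i := Fin.rev_injective e
      rwa [this] at hj
    · intro h i hi
      exact ⟨OrderDual.toDual i.rev, h (fun e => hi (Fin.rev_injective e)), Fin.rev_rev i⟩
  have hu : (f.comp (r : (Fin (n + 1))ᵒᵈ →o Fin (n + 1))).unop.NatOn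
      (PMap.notAbove ⊤ {k.rev}ᶜ) := by
    rw [← PMap.natOn_op, PMap.op_unop]
    exact (hf.comp _).mono fun S hS => (key S).2 hS
  obtain ⟨g, hg, hg'⟩ := hC n k.rev _ (by
    rw [Fin.pos_iff_ne_zero] ; rintro e; exact h₁.ne (by rw [← Fin.rev_rev k, e, Fin.rev_zero]))
    (by
      refine lt_of_le_of_ne (Fin.le_last _) fun e => h₀.ne' ?_
      rw [← Fin.rev_rev k, e, Fin.rev_last]) hu
  refine ⟨g.op.comp (r.symm : Fin (n + 1) →o (Fin (n + 1))ᵒᵈ),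
    ((PMap.natOn_op (A := ⊤)).2 hg).comp _, fun d s hs => ?_⟩
  rw [← PMap.eqOn_op, PMap.op_unop] at hg'
  have e : (r : (Fin (n + 1))ᵒᵈ →o Fin (n + 1)).comp
      ((r.symm : Fin (n + 1) →o (Fin (n + 1))ᵒᵈ).comp s) = s := by
    ext i
    simp
  have := hg' d ((r.symm : Fin (n + 1) →o (Fin (n + 1))ᵒᵈ).comp s) (by
    rw [← key, ← PMap.range_comp, e]
    exact hs)
  refine Eq.trans ?_ this
  exact congrArg (f d) e.symm

namespace PMap

variable {C : SSet.{u}}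

/-- The inclusion of the cone with vertex the last one. -/
def coneLast (P : Type) [Preorder P] (m : ℕ) : Fin 1 ⊕ₗ P →o Fin (m + 2) ⊕ₗ P where
  toFun x := toLex (Sum.map (fun _ => Fin.last (m + 1)) id (ofLex x))
  monotone' := by
    intro a b h
    induction a with | _ a => ?_
    induction b with | _ b => ?_
    rcases a with a | a <;> rcases b with b | b <;> simp_all

/-- The vertex sets of the simplices of `∂Δ[m + 1] ⋆ N(P)`. -/
def bdryCone (P : Type) (m : ℕ) : LowerSet (Set (Fin (m + 2) ⊕ₗ P)) :=
  PMap.notAbove ⊤ (Set.range Sum.inlₗ)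

lemma mem_bdryCone {P : Type} {m : ℕ} {S : Set (Fin (m + 2) ⊕ₗ P)} :
    S ∈ bdryCone P m ↔ ∃ j, Sum.inlₗ j ∉ S := by
  change (True ∧ ¬ _) ↔ _
  rw [Set.range_subset_iff]
  simp

/-- Limit cones in terms of families of simplices. -/
def IsLimit {P : Type} [Preorder P] (f : PMap (Fin 1 ⊕ₗ P) C) : Prop :=
  ∀ (m : ℕ) (g : PMap (Fin (m + 2) ⊕ₗ P) C), g.NatOn (bdryCone P m) → g.comp (coneLast P m) = f →
    ∃ h : PMap (Fin (m + 2) ⊕ₗ P) C, h.NatOn ⊤ ∧ EqOn (bdryCone P m) g h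

lemma mem_boundaryJoin_iff {P : Type} [Preorder P] {m : ℕ} {d : SimplexCategory}
    (s : Fin (d.len + 1) →o Fin (m + 2) ⊕ₗ P) :
    N.simplex.{u} s ∈ (boundaryJoin.{u} P (m + 1)).obj (Opposite.op d) ↔
      Set.range s ∈ bdryCone P m := by
  rw [mem_bdryCone]
  refine exists_congr fun j => ⟨fun h => ?_, fun h i e => h ⟨i, congrArg ULift.down e⟩⟩
  rintro ⟨i, e⟩
  exact h i (congrArg ULift.up e)

lemma range_coneLast_comp_mem {P : Type} [Preorder P] {m : ℕ} {d : SimplexCategory}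
    (s : Fin (d.len + 1) →o Fin 1 ⊕ₗ P) : Set.range ((coneLast P m).comp s) ∈ bdryCone P m := by
  refine mem_bdryCone.2 ⟨0, ?_⟩
  rintro ⟨i, hi⟩
  rw [OrderHom.comp_coe, Function.comp_apply] at hi
  generalize s i = x at hi
  cases x using lexSum_cases with
  | inl a =>
    have := Sum.inl_injective (congrArg ofLex hi)
    simp [Fin.ext_iff] at this
  | inr a => cases congrArg ofLex hi

lemma isLimitCone_iff {P : Type} [Preorder P] (σ : N.{u} (Fin 1 ⊕ₗ P) ⟶ C) :
    IsLimitCone σ ↔ IsLimit (ofHom σ) := by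
  constructor
  · intro H m g hg hgσ
    obtain ⟨h, hh⟩ := H m (subHom (fun d x hx => (mem_boundaryJoin_iff (N.seq x)).1 hx) g hg) (by
      apply ofHom_injective
      exact hgσ)
    refine ⟨ofHom h, natOn_ofHom h _, fun d s hs => ?_⟩
    exact (ConcreteCategory.congr_hom (NatTrans.congr_app hh (Opposite.op d))
      ⟨N.simplex s, (mem_boundaryJoin_iff s).2 hs⟩).symm
  · intro H m g hg
    let c : C _⦋0⦌ := σ.app _ (N.vertex (Sum.inlₗ 0))
    obtain ⟨h, hh, hgh⟩ := H m (ofSubHom g c)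
      (natOn_ofSubHom (fun d s hs => (mem_boundaryJoin_iff s).2 hs) g c) (by
        funext d s
        refine (ofSubHom_of_mem g c _ ((mem_boundaryJoin_iff _).2
          (range_coneLast_comp_mem s))).trans ?_
        exact ConcreteCategory.congr_hom (NatTrans.congr_app hg (Opposite.op d)) (N.simplex s))
    refine ⟨h.toHom hh, ?_⟩
    ext ⟨d⟩ ⟨x, hx⟩
    refine (hgh d (N.seq x) ((mem_boundaryJoin_iff (N.seq x)).1 hx)).symm.trans ?_
    exact ofSubHom_of_mem g c _ hx

/-- The dual of a cone shape is a cocone shape. -/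
def dualConeIso (P : Type) [Preorder P] (n : ℕ) : Pᵒᵈ ⊕ₗ Fin n ≃o (Fin n ⊕ₗ P)ᵒᵈ :=
  (OrderIso.sumLexCongr (OrderIso.refl _) Fin.revOrderIso.symm).trans
    (OrderIso.sumLexDualAntidistrib _ _).symm

lemma image_dualConeIso_mem {P : Type} [Preorder P] {m : ℕ} (S : Set (Pᵒᵈ ⊕ₗ Fin (m + 2))) :
    (dualConeIso P (m + 2) : Pᵒᵈ ⊕ₗ Fin (m + 2) →o (Fin (m + 2) ⊕ₗ P)ᵒᵈ) '' S ∈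
      dualSets (bdryCone P m) ↔ S ∈ coneBdry Pᵒᵈ m := by
  rw [mem_dualSets, mem_bdryCone, mem_coneBdry]
  have : ∀ j : Fin (m + 2), Sum.inlₗ j.rev ∈ OrderDual.toDual ⁻¹'
      ((dualConeIso P (m + 2) : Pᵒᵈ ⊕ₗ Fin (m + 2) →o (Fin (m + 2) ⊕ₗ P)ᵒᵈ) '' S) ↔
      Sum.inrₗ j ∈ S := by
    intro j
    refine ⟨?_, fun h => ⟨_, h, rfl⟩⟩
    rintro ⟨x, hx, e⟩
    have : x = Sum.inrₗ j := (dualConeIso P (m + 2)).injective e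
    exact this ▸ hx
  constructor
  · rintro ⟨j, hj⟩
    refine ⟨j.rev, ?_⟩
    rwa [← this, Fin.rev_rev]
  · rintro ⟨j, hj⟩
    exact ⟨j.rev, by rwa [this]⟩

/-- The dual of `Fin n ⊕ₗ P` is `Pᵒᵈ ⊕ₗ Fin n`, and the reversal of `Fin n` carries the last vertex,
which tests terminality, to the vertex `0`, which tests initiality. -/
lemma isLimit_iff {P : Type} [Preorder P] (f : PMap (Fin 1 ⊕ₗ P) C) :
    IsLimit f ↔ IsColimit (f.op.comp (dualConeIso P 1 : Pᵒᵈ ⊕ₗ Fin 1 →o (Fin 1 ⊕ₗ P)ᵒᵈ)) := by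
  have hcone : ∀ m, (dualConeIso P (m + 2) : Pᵒᵈ ⊕ₗ Fin (m + 2) →o (Fin (m + 2) ⊕ₗ P)ᵒᵈ).comp
      (coneZero Pᵒᵈ m) = (coneLast P m).dual.comp
        (dualConeIso P 1 : Pᵒᵈ ⊕ₗ Fin 1 →o (Fin 1 ⊕ₗ P)ᵒᵈ) := by
    intro m
    refine lexSum_hom_ext (fun _ => rfl) (fun b => ?_)
    change OrderDual.toDual (Sum.inlₗ (Fin.rev 0)) = OrderDual.toDual (Sum.inlₗ (Fin.last _))
    rw [Fin.rev_zero]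
  constructor
  · intro H m g hg hgf
    let D := dualConeIso P (m + 2)
    have e₁ : ∀ {n : ℕ} (s : Fin (n + 1) →o (Fin (m + 2) ⊕ₗ P)ᵒᵈ),
        (D : _ →o (Fin (m + 2) ⊕ₗ P)ᵒᵈ).comp ((D.symm : (Fin (m + 2) ⊕ₗ P)ᵒᵈ →o Pᵒᵈ ⊕ₗ Fin (m + 2)).comp s) = s := by
      intro n s
      ext i
      simp
    have e₂ : ∀ {n : ℕ} (s : Fin (n + 1) →o Pᵒᵈ ⊕ₗ Fin (m + 2)),
        (D.symm : (Fin (m + 2) ⊕ₗ P)ᵒᵈ →o Pᵒᵈ ⊕ₗ Fin (m + 2)).comp ((D : _ →o (Fin (m + 2) ⊕ₗ P)ᵒᵈ).comp s) = s := by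
      intro n s
      ext i
      simp
    obtain ⟨h, hh, hgh⟩ := H m (g.comp (D.symm : (Fin (m + 2) ⊕ₗ P)ᵒᵈ →o Pᵒᵈ ⊕ₗ Fin (m + 2))).unop (by
      rw [← natOn_op, op_unop]
      intro d s hs e φ
      exact hg d _ ((image_dualConeIso_mem _).1 (by
        rw [← range_comp]
        exact (e₁ s).symm ▸ hs)) e φ) (by
      rw [← unop_op ((unop _).comp _), op_comp, op_unop, ← unop_op f]
      congr 1
      funext d s
      obtain ⟨t, rfl⟩ : ∃ t, (dualConeIso P 1 : _ →o (Fin 1 ⊕ₗ P)ᵒᵈ).comp t = s :=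
        ⟨((dualConeIso P 1).symm : (Fin 1 ⊕ₗ P)ᵒᵈ →o Pᵒᵈ ⊕ₗ Fin 1).comp s, by ext i; simp⟩
      refine Eq.trans ?_ (congrFun (congrFun hgf d) t)
      have := congrArg (fun j => (D.symm : (Fin (m + 2) ⊕ₗ P)ᵒᵈ →o Pᵒᵈ ⊕ₗ Fin (m + 2)).comp
        (OrderHom.comp j t)) (hcone m)
      exact congrArg (g d) (this.symm.trans (e₂ ((coneZero _ m).comp t))))
    refine ⟨h.op.comp (D : _ →o (Fin (m + 2) ⊕ₗ P)ᵒᵈ), ((natOn_op (A := ⊤)).2 hh).comp _,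
      fun d s hs => ?_⟩
    rw [← eqOn_op, op_unop] at hgh
    have h₁ := hgh d ((D : _ →o (Fin (m + 2) ⊕ₗ P)ᵒᵈ).comp s) (by
      rw [range_comp, image_dualConeIso_mem]
      exact hs)
    exact (congrArg (g d) (e₂ s)).symm.trans h₁
  · intro H m g hg hgf
    let D := dualConeIso P (m + 2)
    have e₁ : ∀ {n : ℕ} (s : Fin (n + 1) →o (Fin (m + 2) ⊕ₗ P)ᵒᵈ),
        (D : _ →o (Fin (m + 2) ⊕ₗ P)ᵒᵈ).comp ((D.symm : (Fin (m + 2) ⊕ₗ P)ᵒᵈ →o Pᵒᵈ ⊕ₗ Fin (m + 2)).comp s) = s := by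
      intro n s
      ext i
      simp
    obtain ⟨h, hh, hgh⟩ := H m (g.op.comp (D : _ →o (Fin (m + 2) ⊕ₗ P)ᵒᵈ)) (by
      refine ((natOn_op.2 hg).comp _).mono fun S hS => ?_
      exact (image_dualConeIso_mem S).2 hS) (by
      rw [comp_comp, hcone, ← comp_comp, ← op_comp, hgf])
    refine ⟨(h.comp (D.symm : (Fin (m + 2) ⊕ₗ P)ᵒᵈ →o Pᵒᵈ ⊕ₗ Fin (m + 2))).unop, ?_, ?_⟩
    · refine (natOn_op (A := ⊤)).1 ?_
      rw [op_unop]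
      exact hh.comp _
    · rw [← eqOn_op, op_unop]
      intro d s hs
      have h₁ := hgh d ((D.symm : (Fin (m + 2) ⊕ₗ P)ᵒᵈ →o Pᵒᵈ ⊕ₗ Fin (m + 2)).comp s) (by
        rw [← image_dualConeIso_mem, ← range_comp]
        exact (e₁ s).symm ▸ hs)
      exact (congrArg (g.op d) (e₁ s)).symm.trans h₁

section

variable {W : Type} [PartialOrder W]

/-- The restriction of the family `f` to `K` and `e` is a limit cone. -/
def IsLimAt (f : PMap W C) (K : Set W) (e : W) : Prop :=
  IsColimAt f.op (OrderDual.ofDual ⁻¹' K) (OrderDual.toDual e)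

/-- Extension over simplices whose smallest vertex is initial. -/
theorem exists_extension_of_initial {A B : LowerSet (Set W)} {f : PMap W C} (hf : f.NatOn A)
    (h : ∀ S, IsSimplex S → S ∈ B → S ∉ A → ∀ e, IsLeast S e → IsColimAt f ∅ e ∧ {e} ∈ A) :
    ∃ g : PMap W C, g.NatOn B ∧ EqOn A f g := by
  -- An initial object is a colimit cocone over the empty set. With `M` everything, the part of a
  -- simplex above its first vertex is the whole simplex.
  refine exists_extension_of_join Set.univ (fun _ => ∅) hf fun S hS hB hA => ?_
  rw [Set.inter_univ]
  refine ⟨hS.nonempty, fun e he => ?_⟩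
  have hSe : S ∩ Set.Ici e = S := Set.inter_eq_left.2 he.2
  obtain ⟨h₁, h₂⟩ := h S hS hB hA e he
  refine ⟨h₁, fun T hT => A.lower (hT.trans (by simp)) h₂, fun y hy => hy.elim,
    fun y hy hey => (hey (he.2 hy)).elim, by rwa [hSe], ?_, fun T _ hT => ?_⟩
  · by_contra hcon
    push Not at hcon
    refine hA (A.lower (fun y hy => ?_) h₂)
    exact ((he.2 hy).lt_or_eq.resolve_left (hcon y hy)).symm
  · rw [Set.empty_union, hSe] at hT
    exact B.lower hT hB

/-- Extension over simplices whose largest vertex is terminal. -/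
theorem exists_extension_of_terminal {A B : LowerSet (Set W)} {f : PMap W C} (hf : f.NatOn A)
    (h : ∀ S, IsSimplex S → S ∈ B → S ∉ A → ∀ e, IsGreatest S e → IsLimAt f ∅ e ∧ {e} ∈ A) :
    ∃ g : PMap W C, g.NatOn B ∧ EqOn A f g := by
  obtain ⟨g, hg, hfg⟩ := exists_extension_of_initial (B := dualSets B) (natOn_op.2 hf)
    fun S hS hB hA e he => h _ (isSimplex_preimage_toDual hS) hB hA (OrderDual.ofDual e)
      ⟨he.1, fun y hy => he.2 hy⟩
  rw [← op_unop g] at hg hfg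
  exact ⟨g.unop, natOn_op.1 hg, eqOn_op.1 hfg⟩

lemma isLimAt_iff {f : PMap W C} {K : Set W} {e : W} (h : ∀ k ∈ K, e < k) :
    IsLimAt f K e ↔ IsLimit (f.comp (sumDesc (OrderHom.const _ e) (OrderHom.Subtype.val _)
      fun _ k => (h k.1 k.2).le : Fin 1 ⊕ₗ K →o W)) := by
  rw [isLimit_iff, op_comp, comp_comp]
  have e₀ : ((sumDesc (OrderHom.const _ e) (OrderHom.Subtype.val _)
      fun _ k => (h k.1 k.2).le : Fin 1 ⊕ₗ K →o W).dual.comp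
      (dualConeIso K 1 : Kᵒᵈ ⊕ₗ Fin 1 →o (Fin 1 ⊕ₗ K)ᵒᵈ)) =
      coneHom (OrderDual.ofDual ⁻¹' K) (OrderDual.toDual e) fun k hk => (h _ hk).le :=
    lexSum_hom_ext (fun _ => rfl) (fun _ => rfl)
  constructor
  · intro H
    have := H.isColimit
    exact (congrArg (fun j => IsColimit (f.op.comp j)) e₀).mpr this
  · intro H
    exact ⟨fun k hk => h _ hk, (congrArg (fun j => IsColimit (f.op.comp j)) e₀).mp H⟩

end

end PMap

open PMap

variable {C : SSet.{u}}

lemma isCocartesian_iff (σ : Square C) :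
    IsCocartesian σ ↔ IsColimAt (ofHom σ) {(1, 1)}ᶜ (1, 1) := by
  have hlt : ∀ k ∈ ({(1, 1)}ᶜ : Set (Fin 2 × Fin 2)), k < (1, 1) :=
    fun k hk => lt_of_le_of_ne ⟨Fin.le_last _, Fin.le_last _⟩ hk
  have : IsCocartesian σ ↔ IsColimit ((ofHom σ).comp (coneHom ({(1, 1)}ᶜ : Set (Fin 2 × Fin 2))
      (1, 1) fun k hk => (hlt k hk).le)) := isColimitCocone_iff _
  exact this.trans ⟨fun h => ⟨hlt, h⟩, fun h => h.isColimit⟩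

lemma isCartesian_iff (σ : Square C) :
    IsCartesian σ ↔ IsLimAt (ofHom σ) {(0, 0)}ᶜ (0, 0) := by
  have hlt : ∀ k ∈ ({(0, 0)}ᶜ : Set (Fin 2 × Fin 2)), (0, 0) < k :=
    fun k hk => lt_of_le_of_ne ⟨Fin.zero_le _, Fin.zero_le _⟩ (Ne.symm hk)
  rw [isLimAt_iff hlt]
  exact isLimitCone_iff _

lemma PMap.ofHom_const {W : Type} [Preorder W] (c : C _⦋0⦌) :
    ofHom (SSet.const c : N.{u} W ⟶ C) = PMap.const c := rfl

/-- Initiality only involves the degenerate simplices at `e`, so it can be tested inside any family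
that takes the value `x` there. -/
lemma isInitialVertex_iff {W : Type} [PartialOrder W] {f : PMap W C} {e : W} {x : C _⦋0⦌}
    (h : EqOn (LowerSet.Iic {e}) f (PMap.const x)) : IsInitialVertex x ↔ IsColimAt f ∅ e := by
  let ψ : Empty ⊕ₗ Fin 1 ↪o W := OrderEmbedding.ofMapLEIff (fun _ => e) (by
    intro a b
    have : a = b := by
      cases a using lexSum_cases with
      | inl a => exact a.elim
      | inr a =>
        cases b using lexSum_cases with
        | inl b => exact b.elim
        | inr b => rw [Subsingleton.elim a b]
    simp [this])
  have h₁ : f.comp (ψ : Empty ⊕ₗ Fin 1 →o W) = PMap.const x := by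
    funext d s
    exact h d _ (by rintro _ ⟨i, rfl⟩; rfl)
  have h₂ := isColimAt_image (f := f) ψ (K := ∅) (e := Sum.inrₗ 0)
  rw [h₁, Set.image_empty] at h₂
  refine (isColimitCocone_iff _).trans (Iff.trans ?_ h₂.symm)
  have e₀ : (Set.range Sum.inlₗ : Set (Empty ⊕ₗ Fin 1)) = ∅ := by
    simp [Set.range_eq_empty]
  constructor
  · intro H
    have := IsColimit.isColimAt H
    rwa [e₀] at this
  · intro H
    rw [← e₀] at H
    let E : Empty ≃o (Set.range (Sum.inlₗ : Empty → Empty ⊕ₗ Fin 1)) :=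
      { toEquiv := Equiv.ofInjective _ (fun a => a.elim)
        map_rel_iff' := fun {a} => a.elim }
    have := IsColimit.of_orderIso (f := (PMap.const x)) E.symm H.isColimit
    exact this

lemma PMap.op_const {W : Type} [Preorder W] (c : C _⦋0⦌) :
    (PMap.const c : PMap W C).op = PMap.const (C := C.op) (SSet.opObjEquiv.symm c) := by
  funext d s
  change _ = C.op.map _ _
  rw [SSet.op_map]
  refine congrArg (fun φ : d ⟶ ⦋0⦌ => SSet.opObjEquiv.symm (C.map φ.op c)) ?_
  exact Subsingleton.elim _ _

lemma isTerminalVertex_iff_op (x : C _⦋0⦌) :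
    IsTerminalVertex x ↔ IsInitialVertex (C := C.op) (SSet.opObjEquiv.symm x) := by
  refine (isLimitCone_iff _).trans ((isLimit_iff _).trans (Iff.trans ?_
    (isColimitCocone_iff _).symm))
  rw [ofHom_const, ofHom_const, op_const]
  let E : Empty ≃o Emptyᵒᵈ :=
    { toEquiv := OrderDual.toDual
      map_rel_iff' := fun {a} => a.elim }
  exact ⟨fun H => IsColimit.of_orderIso (f := PMap.const _) E.symm H,
    fun H => IsColimit.of_orderIso (f := PMap.const _) E H⟩

lemma isTerminalVertex_iff {W : Type} [PartialOrder W] {f : PMap W C} {e : W} {x : C _⦋0⦌}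
    (h : EqOn (LowerSet.Iic {e}) f (PMap.const x)) : IsTerminalVertex x ↔ IsLimAt f ∅ e := by
  refine (isTerminalVertex_iff_op x).trans (isInitialVertex_iff ?_)
  rw [← op_const]
  exact eqOn_op.2 h

end ExInf

end

/-! ### Degenerate edges are colimit cocones. -/

noncomputable section

set_option linter.unusedSectionVars false

namespace ExInf

namespace PMap

variable {C : SSet.{u}}

section Identity

variable {P : Type} [PartialOrder P] {m : ℕ}

/-- The map that sends the first `k + 1` of four vertices to `x` and the others to the cone
vertex. -/
def foldHom (x : P) (m : ℕ) (k : Fin 4) : Fin 4 ⊕ₗ Fin (m + 1) →o P ⊕ₗ Fin (m + 2) :=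
  sumDesc
    ⟨fun i => if i ≤ k then Sum.inlₗ x else Sum.inrₗ 0, fun i j hij => by
      dsimp only
      split_ifs with h₁ h₂ h₂
      · exact le_rfl
      · exact Sum.Lex.inl_le_inr _ _
      · exact (h₁ (hij.trans h₂)).elim
      · exact le_rfl⟩
    ⟨fun i => Sum.inrₗ i.succ, fun _ _ h => Sum.Lex.inr_le_inr_iff.2 (Fin.succ_le_succ_iff.2 h)⟩
    fun i j => by
      change (if i ≤ k then (Sum.inlₗ x : P ⊕ₗ Fin (m + 2)) else Sum.inrₗ 0) ≤ Sum.inrₗ j.succ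
      split_ifs
      · exact Sum.Lex.inl_le_inr _ _
      · exact Sum.Lex.inr_le_inr_iff.2 (Fin.zero_le _)

/-- The section of `foldHom` with values in the first two vertices. -/
def unfoldHom (P : Type) [PartialOrder P] (m : ℕ) [Subsingleton P] :
    P ⊕ₗ Fin (m + 2) →o Fin 4 ⊕ₗ Fin (m + 1) :=
  sumDesc (OrderHom.const _ (Sum.inlₗ 0))
    ⟨fun j => Fin.cases (Sum.inlₗ 1) (fun i => Sum.inrₗ i) j, fun i j => by
      refine Fin.cases ?_ (fun i => ?_) i <;> refine Fin.cases ?_ (fun j => ?_) j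
      · exact fun _ => le_rfl
      · exact fun _ => Sum.Lex.inl_le_inr _ _
      · exact fun h => (Fin.succ_ne_zero i (Fin.le_zero_iff.1 h)).elim
      · exact fun h => Sum.Lex.inr_le_inr_iff.2 (Fin.succ_le_succ_iff.1 h)⟩
    fun x j => by
      refine Fin.cases ?_ (fun j => ?_) j
      · exact Sum.Lex.inl_le_inl_iff.2 (Fin.zero_le _)
      · exact Sum.Lex.inl_le_inr _ _

lemma fold_unfold [Subsingleton P] (x : P) :
    (foldHom x m 0).comp (unfoldHom P m) = OrderHom.id := by
  refine lexSum_hom_ext (fun a => ?_) (fun j => ?_)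
  · rw [Subsingleton.elim a x]
    rfl
  · refine Fin.cases ?_ (fun j => ?_) j <;> rfl

lemma inl_notMem_range_unfold [Subsingleton P] {i : Fin 4} (hi : 2 ≤ i) :
    Sum.inlₗ i ∉ Set.range (unfoldHom P m) := by
  rintro ⟨x, hx⟩
  cases x using lexSum_cases with
  | inl a =>
    have : 0 = i := Sum.inl_injective (congrArg ofLex hx)
    subst this
    exact absurd hi (by decide)
  | inr j =>
    revert hx
    refine Fin.cases (fun hx => ?_) (fun j hx => ?_) j
    · have : 1 = i := Sum.inl_injective (congrArg ofLex hx)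
      subst this
      exact absurd hi (by decide)
    · cases congrArg ofLex hx

/-- A degenerate edge from `x` is initial among the maps out of `x`. -/
lemma exists_extension_degenerate [Subsingleton P] (hC : HasInnerFillers C) (x : P) {c : C _⦋0⦌}
    {g : PMap (P ⊕ₗ Fin (m + 2)) C} (hg : g.NatOn (coneBdry P m))
    (hgc : EqOn (LowerSet.Iic (Set.range (coneZero P m))) g (PMap.const c)) :
    ∃ h : PMap (P ⊕ₗ Fin (m + 2)) C, h.NatOn ⊤ ∧ EqOn (coneBdry P m) g h := by
  let p : Fin 4 → Fin 4 ⊕ₗ Fin (m + 1) := fun i => Sum.inlₗ i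
  let full : Set (Fin 4 ⊕ₗ Fin (m + 1)) := Set.range Sum.inrₗ
  -- The data form an outer horn at `x` whose first edge is degenerate. Four vertices replace `x`
  -- and the cone vertex `0`: `p 0` and `p 2` stand for `x`, `p 1` and `p 3` for `0`. As all of them
  -- have the value `c`, the edge from `p 1` to `p 2` acts as an inverse of the edge from `x` to
  -- `0`, and passing through `p 2` turns the outer horn into inner ones. On `A₁` the vertex `p 1`
  -- is absent, on `A₂` the vertex `p 2`, and `A₃` carries the constant map.
  let A₁ := comap (foldHom x m 2) (coneBdry P m) ⊓ notAbove ⊤ {p 1}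
  let A₂ := comap (foldHom x m 0) (coneBdry P m) ⊓ notAbove ⊤ {p 2}
  let A₃ : LowerSet (Set (Fin 4 ⊕ₗ Fin (m + 1))) := LowerSet.Iic (Set.range p)
  have not₁ : ∀ {i T}, T ∈ notAbove (W := Fin 4 ⊕ₗ Fin (m + 1)) ⊤ {p i} ↔ p i ∉ T := by
    intro i T
    rw [mem_notAbove]
    simp
  have A₁_of : ∀ T, p 1 ∉ T → (¬ full ⊆ T ∨ p 3 ∉ T) → T ∈ A₁ := by
    rintro T h₁ h
    refine ⟨mem_coneBdry.2 ?_, not₁.2 h₁⟩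
    rcases h with h | h
    · obtain ⟨_, ⟨i, rfl⟩, hi⟩ := Set.not_subset.1 h
      refine ⟨i.succ, ?_⟩
      rintro ⟨y, hy, e⟩
      cases y using lexSum_cases with
      | inl a =>
        replace e : (if a ≤ 2 then Sum.inlₗ x else Sum.inrₗ 0) = Sum.inrₗ i.succ := e
        split_ifs at e
        · cases congrArg ofLex e
        · exact Fin.succ_ne_zero i (Sum.inr_injective (congrArg ofLex e)).symm
      | inr a =>
        have : a.succ = i.succ := Sum.inr_injective (congrArg ofLex e)
        exact hi (Fin.succ_injective _ this ▸ hy)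
    · refine ⟨0, ?_⟩
      rintro ⟨y, hy, e⟩
      cases y using lexSum_cases with
      | inl a =>
        replace e : (if a ≤ 2 then (Sum.inlₗ x : P ⊕ₗ Fin (m + 2)) else Sum.inrₗ 0) = Sum.inrₗ 0 := e
        split_ifs at e with h'
        · cases congrArg ofLex e
        · have : a = 3 := by omega
          exact h (this ▸ hy)
      | inr a => exact Fin.succ_ne_zero a (Sum.inr_injective (congrArg ofLex e))
  have A₂_of : ∀ T, p 2 ∉ T → ¬ full ⊆ T → T ∈ A₂ := by
    rintro T h₁ h
    refine ⟨mem_coneBdry.2 ?_, not₁.2 h₁⟩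
    obtain ⟨_, ⟨i, rfl⟩, hi⟩ := Set.not_subset.1 h
    refine ⟨i.succ, ?_⟩
    rintro ⟨y, hy, e⟩
    cases y using lexSum_cases with
    | inl a =>
      replace e : (if a ≤ 0 then Sum.inlₗ x else Sum.inrₗ 0) = Sum.inrₗ i.succ := e
      split_ifs at e
      · cases congrArg ofLex e
      · exact Fin.succ_ne_zero i (Sum.inr_injective (congrArg ofLex e)).symm
    | inr a =>
      have : a.succ = i.succ := Sum.inr_injective (congrArg ofLex e)
      exact hi (Fin.succ_injective _ this ▸ hy)
  have h₁₂ : EqOn (A₁ ⊓ A₂) (g.comp (foldHom x m 2)) (g.comp (foldHom x m 0)) := by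
    intro d s hs
    have h₁ := not₁.1 hs.1.2
    have h₂ := not₁.1 hs.2.2
    have : (foldHom x m 2).comp s = (foldHom x m 0).comp s := by
      ext i
      have h₁' : s i ≠ p 1 := fun h => h₁ ⟨i, h⟩
      have h₂' : s i ≠ p 2 := fun h => h₂ ⟨i, h⟩
      rw [OrderHom.comp_coe, OrderHom.comp_coe, Function.comp_apply, Function.comp_apply]
      generalize s i = y at h₁' h₂'
      cases y using lexSum_cases with
      | inl a =>
        have ha₁ : a ≠ 1 := fun h => h₁' (congrArg p h)
        have ha₂ : a ≠ 2 := fun h => h₂' (congrArg p h)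
        change (if a ≤ 2 then (Sum.inlₗ x : P ⊕ₗ Fin (m + 2)) else Sum.inrₗ 0) =
          if a ≤ 0 then Sum.inlₗ x else Sum.inrₗ 0
        have : a ≤ 2 ↔ a ≤ 0 := by omega
        simp only [this]
      | inr a => rfl
    exact congrArg (g d) this
  obtain ⟨g₁, hg₁, e₁, e₂⟩ := exists_glue ((hg.comp (foldHom x m 2)).mono inf_le_left)
    ((hg.comp (foldHom x m 0)).mono inf_le_left) h₁₂
  have fold_const : ∀ k, EqOn A₃ (g.comp (foldHom x m k)) (PMap.const c) := by
    intro k d s hs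
    refine hgc d _ ?_
    rw [range_comp]
    rintro _ ⟨y, hy, rfl⟩
    obtain ⟨i, rfl⟩ := hs hy
    change (if i ≤ k then (Sum.inlₗ x : P ⊕ₗ Fin (m + 2)) else Sum.inrₗ 0) ∈ _
    split_ifs
    · exact ⟨Sum.inlₗ x, rfl⟩
    · exact ⟨Sum.inrₗ 0, rfl⟩
  obtain ⟨g₂, hg₂, e₃, -⟩ := exists_glue hg₁ (natOn_const c A₃) (by
    rintro d s ⟨hs | hs, hs'⟩
    · rw [← e₁ d s hs]
      exact fold_const _ d s hs'
    · rw [← e₂ d s hs]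
      exact fold_const _ d s hs')
  let B₁ : LowerSet (Set (Fin 4 ⊕ₗ Fin (m + 1))) := notAbove ⊤ full ⊔ (notAbove ⊤ {p 1} ⊓ notAbove ⊤ {p 3})
  let B₂ : LowerSet (Set (Fin 4 ⊕ₗ Fin (m + 1))) := B₁ ⊔ notAbove ⊤ {p 3}
  have hp : ∀ {i j}, p i = p j → i = j := fun h => Sum.inl_injective (congrArg ofLex h)
  have hlt : ∀ {i j}, i < j → p i < p j := fun h => Sum.Lex.inl_lt_inl_iff.2 h
  have hge : ∀ {y}, p 3 ≤ y → y = p 3 ∨ ∃ i, y = Sum.inrₗ i := by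
    intro y hy
    cases y using lexSum_cases with
    | inl a =>
      have := Sum.Lex.inl_le_inl_iff.1 hy
      left
      congr 1
      omega
    | inr a => exact Or.inr ⟨a, rfl⟩
  -- The missing simplices contain `p 1` and `p 2` but not all of `full`. They are paired by
  -- inserting or removing `p 3`.
  obtain ⟨g₃, hg₃, e₄⟩ := exists_extension_of_pairing (B := B₁) hC {p 2} (fun _ => p 3) (by
      rintro _ rfl
      exact ⟨hlt (by decide), fun h => absurd (hp h) (by decide)⟩) (by
    intro S hS hB hA
    have hp1 : p 1 ∈ S := by
      by_contra hp1
      refine hA (Or.inl (Or.inl (A₁_of S hp1 ?_)))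
      rcases hB with hB | hB
      · exact Or.inl hB.2
      · exact Or.inr (not₁.1 hB.2)
    have hfull : ¬ full ⊆ S := by
      rcases hB with hB | hB
      · exact hB.2
      · exact (not₁.1 hB.1 hp1).elim
    have hp2 : p 2 ∈ S := by
      by_contra hp2
      exact hA (Or.inl (Or.inr (A₂_of S hp2 hfull)))
    obtain ⟨j, hj⟩ : ∃ j, Sum.inrₗ j ∈ S := by
      by_contra hcon
      refine hA (Or.inr fun y hy => ?_)
      cases y using lexSum_cases with
      | inl a => exact ⟨a, rfl⟩
      | inr a => exact (hcon ⟨a, hy⟩).elim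
    refine ⟨⟨_, hp2, rfl⟩, fun _ _ => ⟨Or.inl ⟨trivial, fun h => hfull ?_⟩,
      fun y _ => le_total _ _, ⟨_, hj, Sum.Lex.inl_lt_inr _ _⟩, ?_⟩⟩
    · rintro _ ⟨i, rfl⟩
      exact (h ⟨i, rfl⟩).resolve_left fun e => by cases congrArg ofLex e
    · rintro ((h | h) | h)
      · exact not₁.1 h.2 ⟨hp1, fun e => absurd (hp e) (by decide)⟩
      · exact not₁.1 h.2 ⟨hp2, fun e => absurd (hp e) (by decide)⟩
      · obtain ⟨i, hi⟩ := h ⟨hj, fun e => by cases congrArg ofLex e⟩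
        cases congrArg ofLex hi) hg₂
  -- Now the simplices that contain `p 1` and `full` but not `p 3` are paired by `p 2`. The simplex
  -- on `p 0`, `p 1` and `full` that is wanted in the end is among them.
  obtain ⟨g₄, hg₄, e₅⟩ := exists_extension_of_pairing (B := B₂) hC {p 1} (fun _ => p 2) (by
      rintro _ rfl
      exact ⟨hlt (by decide), fun h => absurd (hp h) (by decide)⟩) (by
    intro S hS hB hA
    have hp3 : p 3 ∉ S := not₁.1 (hB.resolve_left hA)
    have hfull : full ⊆ S := by
      by_contra h
      exact hA (Or.inl ⟨trivial, h⟩)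
    have hp1 : p 1 ∈ S := by
      by_contra h
      exact hA (Or.inr ⟨not₁.2 h, not₁.2 hp3⟩)
    refine ⟨⟨_, hp1, rfl⟩, fun _ _ => ⟨Or.inr (not₁.2 ?_), fun y _ => le_total _ _,
      ⟨_, hfull ⟨0, rfl⟩, Sum.Lex.inl_lt_inr _ _⟩, ?_⟩⟩
    · rintro (h | h)
      · exact absurd (hp h) (by decide)
      · exact hp3 h
    · rintro (h | h)
      · refine h.2 ?_
        rintro _ ⟨i, rfl⟩
        exact ⟨hfull ⟨i, rfl⟩, fun e => by cases congrArg ofLex e⟩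
      · exact not₁.1 h.1 ⟨hp1, fun e => absurd (hp e) (by decide)⟩) hg₃
  refine ⟨g₄.comp (unfoldHom P m), (hg₄.comp _).mono fun S _ => Or.inr (not₁.2 fun h => ?_),
    fun d s hs => ?_⟩
  · exact inl_notMem_range_unfold (by decide) (Set.image_subset_range _ _ h)
  · have hfu : (foldHom x m 0).comp ((unfoldHom P m).comp s) = s := congrArg (·.comp s) (fold_unfold x)
    have hA₂ : Set.range ((unfoldHom P m).comp s) ∈ A₂ := by
      refine ⟨?_, not₁.2 fun h => ?_⟩
      · change _ ∈ coneBdry P m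
        rw [← range_comp, hfu]
        exact hs
      · rw [range_comp] at h
        exact inl_notMem_range_unfold (by decide) (Set.image_subset_range _ _ h)
    have hB₁ : Set.range ((unfoldHom P m).comp s) ∈ B₁ := by
      by_cases hfull : full ⊆ Set.range ((unfoldHom P m).comp s)
      · refine Or.inr ⟨not₁.2 fun h => ?_, not₁.2 fun h => ?_⟩
        · obtain ⟨j, hj⟩ := mem_coneBdry.1 hs
          obtain ⟨i, hi⟩ := h
          have hj' : ∀ k, s k ≠ Sum.inrₗ j := fun k hk => hj ⟨k, hk⟩
          revert hj'
          refine Fin.cases (fun hj' => ?_) (fun j hj' => ?_) j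
          · refine hj' i ?_
            have := congrArg (fun y => y i) hfu
            refine this.symm.trans ((congrArg (foldHom x m 0) hi).trans ?_)
            rfl
          · obtain ⟨k, hk⟩ := hfull ⟨j, rfl⟩
            refine hj' k ?_
            have := congrArg (fun y => y k) hfu
            refine this.symm.trans ((congrArg (foldHom x m 0) hk).trans ?_)
            rfl
        · rw [range_comp] at h
          exact inl_notMem_range_unfold (by decide) (Set.image_subset_range _ _ h)
      · exact Or.inl ⟨trivial, hfull⟩
    calc g d s = g d ((foldHom x m 0).comp ((unfoldHom P m).comp s)) := congrArg (g d) hfu.symm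
      _ = g₁ d _ := e₂ d _ hA₂
      _ = g₂ d _ := e₃ d _ (Or.inr hA₂)
      _ = g₃ d _ := e₄ d _ (Or.inl (Or.inr hA₂))
      _ = g₄ d _ := e₅ d _ hB₁

end Identity

section

variable {W : Type} [PartialOrder W]

/-- A cocone over a single object is a colimit cocone if it is initial among the maps out of that
object, and a degenerate edge is. -/
lemma isColimAt_of_const (hC : HasInnerFillers C) {f : PMap W C} {x y : W} (hxy : x < y)
    {c : C _⦋0⦌} (h : EqOn (LowerSet.Iic {x, y}) f (PMap.const c)) : IsColimAt f {x} y := by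
  have hlt : ∀ k ∈ ({x} : Set W), k < y := by
    rintro _ rfl
    exact hxy
  refine ⟨hlt, fun m g hg hgf => ?_⟩
  refine exists_extension_degenerate hC ⟨x, rfl⟩ (c := c) hg fun d s hs => ?_
  obtain ⟨t, rfl⟩ := exists_comp_eq (coneZeroEmb ({x} : Set W) m) hs
  refine (congrFun (congrFun hgf d) t).trans (h d _ ?_)
  rw [range_comp]
  rintro _ ⟨z, -, rfl⟩
  rcases range_coneHom _ ⟨z, rfl⟩ with h | h
  · exact Or.inr h
  · exact Or.inl h

end

end PMap

end ExInf

end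

/-! ### Cocartesian squares and the interchange of colimits. -/

noncomputable section

set_option linter.unusedSectionVars false

namespace ExInf

namespace PMap

variable {C : SSet.{u}}

section

variable {W : Type} [PartialOrder W]

/-- A cocone in which all objects are initial is a colimit cocone. -/
lemma isColimAt_of_initial {f : PMap W C} {K : Set W} {e : W} (hlt : ∀ k ∈ K, k < e)
    (hf : f.NatOn ⊤) (h : ∀ k ∈ K, IsColimAt f ∅ k) (he : IsColimAt f ∅ e) : IsColimAt f K e := by
  -- A diagram of initial objects is left Kan extended from the empty set.
  refine (isColimAt_iff_of_kan (Set.empty_subset K) hlt (hf.mono le_top) fun x hx _ => ?_).1 he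
  rw [Set.empty_inter]
  exact h x hx

/-- A cone in which all objects are terminal is a limit cone. -/
lemma isLimAt_of_terminal {f : PMap W C} {K : Set W} {e : W} (hlt : ∀ k ∈ K, e < k)
    (hf : f.NatOn ⊤) (h : ∀ k ∈ K, IsLimAt f ∅ k) (he : IsLimAt f ∅ e) : IsLimAt f K e :=
  isColimAt_of_initial (fun k hk => hlt (OrderDual.ofDual k) hk) ((natOn_op (A := ⊤)).2 hf)
    (fun k hk => h (OrderDual.ofDual k) hk) he

/-- A square in which two opposite edges are colimit cocones is cocartesian. -/
lemma isColimAt_square (hC : HasInnerFillers C) {f : PMap W C} (hf : f.NatOn ⊤) {p q r e : W}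
    (hpq : p < q) (hpr : p < r) (hqe : q < e) (hre : r < e) (hqr : ¬ q < r)
    (h₁ : IsColimAt f {p} r) (h₂ : IsColimAt f {q} e) : IsColimAt f {p, q, r} e := by
  have hlt : ∀ k ∈ ({p, q, r} : Set W), k < e := by
    rintro k (rfl | rfl | rfl)
    · exact hpq.trans hqe
    · exact hqe
    · exact hre
  have hsub : ({p, q} : Set W) ⊆ {p, q, r} := by
    rintro k (rfl | rfl)
    · exact Or.inl rfl
    · exact Or.inr (Or.inl rfl)
  -- The value at `r` is extended from `p`, the only element of `{p, q}` below `r`, so `r` may be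
  -- dropped. In `{p, q}` the element `q` is cofinal.
  refine (isColimAt_iff_of_kan hsub hlt (hf.mono le_top) fun x hx hx' => ?_).1
    ((isColimAt_iff_of_cofinal hC (L := {q}) (by simp) (fun k hk => hlt k (hsub hk))
      (hf.mono le_top) ?_).1 h₂)
  · have : x = r := by
      rcases hx with rfl | rfl | rfl
      · exact (hx' (Or.inl rfl)).elim
      · exact (hx' (Or.inr rfl)).elim
      · rfl
    subst this
    have : ({p, q} : Set W) ∩ Set.Iio x = {p} := by
      ext y
      constructor
      · rintro ⟨rfl | rfl, hy⟩
        · rfl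
        · exact (hqr hy).elim
      · rintro rfl
        exact ⟨Or.inl rfl, hpr⟩
    rwa [this]
  · rintro x (rfl | rfl) hx
    · refine ⟨q, rfl, hpq, ?_⟩
      rintro _ rfl _
      exact le_rfl
    · exact (hx rfl).elim

/-- A square in which two opposite edges are degenerate is cocartesian. -/
lemma isColimAt_square_of_const (hC : HasInnerFillers C) {f : PMap W C} (hf : f.NatOn ⊤)
    {p q r e : W} (hpq : p < q) (hpr : p < r) (hqe : q < e) (hre : r < e) (hqr : ¬ q < r)
    {c c' : C _⦋0⦌} (h₁ : EqOn (LowerSet.Iic {p, r}) f (PMap.const c))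
    (h₂ : EqOn (LowerSet.Iic {q, e}) f (PMap.const c')) : IsColimAt f {p, q, r} e :=
  isColimAt_square hC hf hpq hpr hqe hre hqr (isColimAt_of_const hC hpr h₁)
    (isColimAt_of_const hC hqe h₂)

lemma isLimAt_square_of_const (hC : HasInnerFillers C) {f : PMap W C} (hf : f.NatOn ⊤)
    {p q r e : W} (hpq : q < p) (hpr : r < p) (hqe : e < q) (hre : e < r) (hqr : ¬ r < q)
    {c c' : C _⦋0⦌} (h₁ : EqOn (LowerSet.Iic {r, p}) f (PMap.const c))
    (h₂ : EqOn (LowerSet.Iic {e, q}) f (PMap.const c')) : IsLimAt f {p, q, r} e := by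
  refine isColimAt_square_of_const hC.op ((natOn_op (A := ⊤)).2 hf)
    (p := OrderDual.toDual p) (q := OrderDual.toDual q) (r := OrderDual.toDual r)
    hpq hpr hqe hre hqr (c := SSet.opObjEquiv.symm c) (c' := SSet.opObjEquiv.symm c') ?_ ?_
  · rw [← op_const]
    refine (eqOn_op.2 h₁).mono fun S hS x hx => ?_
    rcases hS hx with h | h
    · exact Or.inr h
    · exact Or.inl h
  · rw [← op_const]
    refine (eqOn_op.2 h₂).mono fun S hS x hx => ?_
    rcases hS hx with h | h
    · exact Or.inr h
    · exact Or.inl h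

end

section Fubini

variable {A B : Type} [PartialOrder A] [PartialOrder B] {a : A} {b : B}

/-- If all columns of a diagram of cocones are colimit cocones, and all rows but the last one,
then the last row is a colimit cocone. -/
theorem isColimAt_last_row (hC : HasInnerFillers C) {f : PMap (A × B) C} (hf : f.NatOn ⊤)
    (ha : ∀ x, x ≠ a → x < a) (hb : ∀ y, y ≠ b → y < b)
    (hcol : ∀ y, IsColimAt f ({a}ᶜ ×ˢ {y}) (a, y))
    (hrow : ∀ x, x ≠ a → IsColimAt f ({x} ×ˢ {b}ᶜ) (x, b)) :
    IsColimAt f ({a} ×ˢ {b}ᶜ) (a, b) := by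
  have hale : ∀ x, x ≤ a := fun x => by
    by_cases h : x = a
    · exact h.le
    · exact (ha x h).le
  have hble : ∀ y, y ≤ b := fun y => by
    by_cases h : y = b
    · exact h.le
    · exact (hb y h).le
  have hlt : ∀ k : A × B, k ≠ (a, b) → k < (a, b) := fun k hk =>
    lt_of_le_of_ne ⟨hale _, hble _⟩ hk
  -- The value at `(a, b)` is the colimit over the core without last row and last column: the rows
  -- extend the core to `{a}ᶜ ×ˢ univ`, where the last column `{a}ᶜ ×ˢ {b}` is cofinal and has
  -- colimit `(a, b)` by `hcol`.
  have hcore : IsColimAt f ({a}ᶜ ×ˢ {b}ᶜ) (a, b) := by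
    refine (isColimAt_iff_of_kan (K := {a}ᶜ ×ˢ Set.univ) (fun k hk => ⟨hk.1, trivial⟩)
      (fun k hk => hlt k fun h => hk.1 (congrArg Prod.fst h)) (hf.mono le_top) ?_).2 ?_
    · rintro ⟨x, y⟩ ⟨hx, -⟩ hxy
      have hy : y = b := by
        by_contra hy
        exact hxy ⟨hx, hy⟩
      subst hy
      refine (isColimAt_iff_of_cofinal (L := {x} ×ˢ {y}ᶜ)
        (K := ({a}ᶜ ×ˢ {y}ᶜ) ∩ Set.Iio (x, y)) hC (fun k hk => ⟨⟨?_, hk.2⟩, ?_⟩) (fun k hk => hk.2)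
        (hf.mono le_top) ?_).1 (hrow x hx)
      · rw [show k.1 = x from hk.1]
        exact hx
      · have h₁ : k ≤ (x, y) := ⟨(show k.1 = x from hk.1).le, hble _⟩
        refine lt_of_le_of_ne h₁ fun h => hk.2 ?_
        exact congrArg Prod.snd h
      · rintro ⟨x', y'⟩ ⟨⟨hx', hy'⟩, hlt'⟩ hn
        have hxx : x' ≤ x := (Set.mem_Iio.1 hlt').le.1
        refine ⟨(x, y'), ⟨rfl, hy'⟩, ?_, ?_⟩
        · refine lt_of_le_of_ne ⟨hxx, le_rfl⟩ fun h => hn ⟨congrArg Prod.fst h, hy'⟩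
        · rintro ⟨x'', y''⟩ ⟨hx'', -⟩ h
          exact ⟨(show x'' = x from hx'').ge, h.2⟩
    · refine (isColimAt_iff_of_cofinal (L := {a}ᶜ ×ˢ {b})
        (K := {a}ᶜ ×ˢ Set.univ) hC (fun k hk => ⟨hk.1, trivial⟩)
        (fun k hk => hlt k fun h => hk.1 (congrArg Prod.fst h)) (hf.mono le_top) ?_).1 (hcol b)
      rintro ⟨x, y⟩ ⟨hx, -⟩ hn
      refine ⟨(x, b), ⟨hx, rfl⟩, lt_of_le_of_ne ⟨le_rfl, hble _⟩ fun h => hn ⟨hx, ?_⟩, ?_⟩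
      · exact congrArg Prod.snd h
      · rintro ⟨x', y'⟩ ⟨-, hy'⟩ h
        exact ⟨h.1, (show y' = b from hy').ge⟩
  -- In the other direction, the columns extend the core to `univ ×ˢ {b}ᶜ`, where the last row is
  -- cofinal.
  refine (isColimAt_iff_of_cofinal (K := Set.univ ×ˢ {b}ᶜ) (L := {a} ×ˢ {b}ᶜ) hC (fun k hk => ⟨trivial, hk.2⟩)
    (fun k hk => hlt k fun h => hk.2 (congrArg Prod.snd h)) (hf.mono le_top) ?_).2
    ((isColimAt_iff_of_kan (L := {a}ᶜ ×ˢ {b}ᶜ) (K := Set.univ ×ˢ {b}ᶜ) (fun k hk => ⟨trivial, hk.2⟩)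
      (fun k hk => hlt k fun h => hk.2 (congrArg Prod.snd h)) (hf.mono le_top) ?_).1 hcore)
  · rintro ⟨x, y⟩ ⟨-, hy⟩ hn
    refine ⟨(a, y), ⟨rfl, hy⟩, lt_of_le_of_ne ⟨hale _, le_rfl⟩ fun h => hn ⟨?_, hy⟩, ?_⟩
    · exact congrArg Prod.fst h
    · rintro ⟨x', y'⟩ ⟨hx', -⟩ h
      exact ⟨(show x' = a from hx').ge, h.2⟩
  · rintro ⟨x, y⟩ ⟨-, hy⟩ hn
    have hx : x = a := by
      by_contra hx
      exact hn ⟨hx, hy⟩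
    subst hx
    refine (isColimAt_iff_of_cofinal (L := {x}ᶜ ×ˢ {y})
      (K := ({x}ᶜ ×ˢ {b}ᶜ) ∩ Set.Iio (x, y)) hC (fun k hk => ⟨⟨hk.1, ?_⟩, ?_⟩) (fun k hk => hk.2)
      (hf.mono le_top) ?_).1 (hcol y)
    · rw [show k.2 = y from hk.2]
      exact hy
    · have h₁ : k ≤ (x, y) := ⟨hale _, (show k.2 = y from hk.2).le⟩
      refine lt_of_le_of_ne h₁ fun h => hk.1 ?_
      exact congrArg Prod.fst h
    · rintro ⟨x', y'⟩ ⟨⟨hx', hy'⟩, hlt'⟩ hn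
      have hyy : y' ≤ y := (Set.mem_Iio.1 hlt').le.2
      refine ⟨(x', y), ⟨hx', rfl⟩, ?_, ?_⟩
      · refine lt_of_le_of_ne ⟨le_rfl, hyy⟩ fun h => hn ⟨hx', congrArg Prod.snd h⟩
      · rintro ⟨x'', y''⟩ ⟨-, hy''⟩ h
        exact ⟨h.1, (show y'' = y from hy'').ge⟩

/-- If all columns of a diagram of cones are limit cones, and all rows but the first one,
then the first row is a limit cone. -/
theorem isLimAt_first_row (hC : HasInnerFillers C) {f : PMap (A × B) C} (hf : f.NatOn ⊤)
    (ha : ∀ x, x ≠ a → a < x) (hb : ∀ y, y ≠ b → b < y)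
    (hcol : ∀ y, IsLimAt f ({a}ᶜ ×ˢ {y}) (a, y))
    (hrow : ∀ x, x ≠ a → IsLimAt f ({x} ×ˢ {b}ᶜ) (x, b)) :
    IsLimAt f ({a} ×ˢ {b}ᶜ) (a, b) := by
  let ψ : Aᵒᵈ × Bᵒᵈ ↪o (A × B)ᵒᵈ :=
    { toFun := fun x => OrderDual.toDual (OrderDual.ofDual x.1, OrderDual.ofDual x.2)
      inj' := fun _ _ h => h
      map_rel_iff' := Iff.rfl }
  have key : ∀ (K : Set A) (L : Set B) (x : A) (y : B), IsLimAt f (K ×ˢ L) (x, y) ↔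
      IsColimAt (f.op.comp (ψ : Aᵒᵈ × Bᵒᵈ →o (A × B)ᵒᵈ))
        ((OrderDual.ofDual ⁻¹' K) ×ˢ (OrderDual.ofDual ⁻¹' L))
        (OrderDual.toDual x, OrderDual.toDual y) := by
    intro K L x y
    rw [← isColimAt_image]
    have : ψ '' ((OrderDual.ofDual ⁻¹' K) ×ˢ (OrderDual.ofDual ⁻¹' L)) =
        OrderDual.ofDual ⁻¹' (K ×ˢ L) := by
      ext z
      constructor
      · rintro ⟨w, hw, rfl⟩
        exact hw
      · intro hz
        exact ⟨(OrderDual.toDual (OrderDual.ofDual z).1, OrderDual.toDual (OrderDual.ofDual z).2),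
          hz, rfl⟩
    rw [this]
    rfl
  refine (key {a} {b}ᶜ a b).2 (isColimAt_last_row (a := OrderDual.toDual a)
    (b := OrderDual.toDual b) hC.op (((natOn_op (A := ⊤)).2 hf).comp _)
    (fun x hx => ha (OrderDual.ofDual x) hx) (fun y hy => hb (OrderDual.ofDual y) hy)
    (fun y => (key {a}ᶜ {OrderDual.ofDual y} a (OrderDual.ofDual y)).1 (hcol _))
    fun x hx => (key {OrderDual.ofDual x} {b}ᶜ (OrderDual.ofDual x) b).1 (hrow _ hx))

end Fubini

end PMap

open PMap

/-! ### Squares and degenerate edges -/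

section

variable {C : SSet.{u}} {W : Type} [PartialOrder W]

lemma N.app_edge_self (σ : N.{u} W ⟶ C) {x : W} (h : x ≤ x) :
    σ.app _ (N.edge h) = (SSet.Edge.id (σ.app _ (N.vertex x))).edge := by
  rw [SSet.Edge.id_edge]
  refine Eq.trans ?_ (NatTrans.naturality_apply σ (SimplexCategory.σ (0 : Fin 1)).op (N.vertex x))
  congr 1
  rw [N.edge_eq, N.vertex_eq]
  refine (congrArg N.simplex ?_).trans (N.map_simplex _ _).symm
  ext i
  simp [N.pair]

lemma isEquivalence_id {C : SSet.{u}} (x : C _⦋0⦌) : IsEquivalence (SSet.Edge.id x) :=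
  ⟨SSet.Edge.InvStruct.invStructId x⟩

lemma compl_top_square : ({(1, 1)}ᶜ : Set (Fin 2 × Fin 2)) = {(0, 0), (0, 1), (1, 0)} := by
  ext ⟨a, b⟩
  fin_cases a <;> fin_cases b <;> simp

lemma compl_bot_square : ({(0, 0)}ᶜ : Set (Fin 2 × Fin 2)) = {(1, 1), (0, 1), (1, 0)} := by
  ext ⟨a, b⟩
  fin_cases a <;> fin_cases b <;> simp

lemma eqOn_const_vertex (σ : N.{u} W ⟶ C) (x : W) :
    EqOn (LowerSet.Iic {x}) (ofHom σ) (PMap.const (σ.app _ (N.vertex x))) := by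
  intro d s hs
  refine Eq.trans ?_ (NatTrans.naturality_apply σ (SimplexCategory.const d ⦋0⦌ 0).op (N.vertex x))
  rw [N.vertex_eq]
  have : s = OrderHom.const _ x := by
    ext i
    exact hs ⟨i, rfl⟩
  rw [this]
  rfl

lemma isCocartesian_of_initial (σ : Square C)
    (h : ∀ x, IsInitialVertex (σ.app _ (N.vertex x))) : IsCocartesian σ := by
  have key : ∀ x, IsColimAt (ofHom σ) ∅ x := fun x =>
    (isInitialVertex_iff (eqOn_const_vertex σ x)).1 (h x)
  exact (isCocartesian_iff σ).2 (isColimAt_of_initial (fun k hk => lt_of_le_of_ne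
    ⟨Fin.le_last _, Fin.le_last _⟩ hk) (natOn_ofHom σ _) (fun k _ => key k) (key _))

lemma isCartesian_of_terminal (σ : Square C)
    (h : ∀ x, IsTerminalVertex (σ.app _ (N.vertex x))) : IsCartesian σ := by
  have key : ∀ x, IsLimAt (ofHom σ) ∅ x := fun x =>
    (isTerminalVertex_iff (eqOn_const_vertex σ x)).1 (h x)
  exact (isCartesian_iff σ).2 (isLimAt_of_terminal (fun k hk => lt_of_le_of_ne
    ⟨Fin.zero_le _, Fin.zero_le _⟩ (Ne.symm hk)) (natOn_ofHom σ _) (fun k _ => key k) (key _))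

lemma eqOn_const_of_fiber {V : Type} [PartialOrder V] (τ : N.{u} V ⟶ C) (j : W →o V) (v : V)
    {S : Set W} (hS : ∀ x ∈ S, j x = v) :
    EqOn (LowerSet.Iic S) (ofHom (N.map j ≫ τ)) (PMap.const (τ.app _ (N.vertex v))) := by
  intro d s hs
  refine Eq.trans ?_ (eqOn_const_vertex τ v d (j.comp s) ?_)
  · rfl
  · rintro _ ⟨i, rfl⟩
    exact hS _ (hs ⟨i, rfl⟩)

/-- A square that is pulled back along a map that does not depend on the row is cocartesian. -/
lemma isCocartesian_of_columns (hC : HasInnerFillers C) (j : Fin 2 × Fin 2 →o W)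
    (hj : ∀ a a' b, j (a, b) = j (a', b)) (τ : N.{u} W ⟶ C) : IsCocartesian (N.map j ≫ τ) := by
  rw [isCocartesian_iff, compl_top_square]
  refine isColimAt_square_of_const hC (natOn_ofHom _ _) (by simp [Prod.lt_iff])
    (by simp [Prod.lt_iff]) (by simp [Prod.lt_iff]) (by simp [Prod.lt_iff]) (by simp [Prod.lt_iff])
    (eqOn_const_of_fiber τ j (j (0, 0)) ?_) (eqOn_const_of_fiber τ j (j (0, 1)) ?_)
  · rintro _ (rfl | rfl)
    · rfl
    · exact hj _ _ _
  · rintro _ (rfl | rfl)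
    · rfl
    · exact hj _ _ _

/-- A square that is pulled back along a map that does not depend on the column is cocartesian. -/
lemma isCocartesian_of_rows (hC : HasInnerFillers C) (j : Fin 2 × Fin 2 →o W)
    (hj : ∀ a b b', j (a, b) = j (a, b')) (τ : N.{u} W ⟶ C) : IsCocartesian (N.map j ≫ τ) := by
  rw [isCocartesian_iff, compl_top_square, Set.pair_comm (0, 1)]
  refine isColimAt_square_of_const hC (natOn_ofHom _ _) (by simp [Prod.lt_iff])
    (by simp [Prod.lt_iff]) (by simp [Prod.lt_iff]) (by simp [Prod.lt_iff]) (by simp [Prod.lt_iff])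
    (eqOn_const_of_fiber τ j (j (0, 0)) ?_) (eqOn_const_of_fiber τ j (j (1, 0)) ?_)
  · rintro _ (rfl | rfl)
    · rfl
    · exact hj _ _ _
  · rintro _ (rfl | rfl)
    · rfl
    · exact hj _ _ _

/-- A square that is pulled back along a map that does not depend on the row is Cartesian. -/
lemma isCartesian_of_columns (hC : HasInnerFillers C) (j : Fin 2 × Fin 2 →o W)
    (hj : ∀ a a' b, j (a, b) = j (a', b)) (τ : N.{u} W ⟶ C) : IsCartesian (N.map j ≫ τ) := by
  rw [isCartesian_iff, compl_bot_square, Set.pair_comm (0, 1)]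
  refine isLimAt_square_of_const hC (natOn_ofHom _ _) (by simp [Prod.lt_iff])
    (by simp [Prod.lt_iff]) (by simp [Prod.lt_iff]) (by simp [Prod.lt_iff]) (by simp [Prod.lt_iff])
    (eqOn_const_of_fiber τ j (j (0, 1)) ?_) (eqOn_const_of_fiber τ j (j (0, 0)) ?_)
  · rintro _ (rfl | rfl)
    · rfl
    · exact hj _ _ _
  · rintro _ (rfl | rfl)
    · rfl
    · exact hj _ _ _

end

section

variable {X : Triple.{u}} {W : Type} [PartialOrder W]

lemma IsExact.hasInnerFillers (hX : IsExact X) : HasInnerFillers X.carrier := by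
  have := hX.quasicategory
  exact ExInf.hasInnerFillers _

end

end ExInf

end

noncomputable section

set_option linter.unusedSectionVars false

namespace ExInf

open PMap

/-! ### Zero objects, cofibrations and fibrations -/

section

variable {V W : Type} [PartialOrder V] [PartialOrder W]

lemma N.map_vertex (j : V →o W) (x : V) : (N.map.{u} j).app _ (N.vertex x) = N.vertex (j x) := by
  rw [N.vertex_eq, N.vertex_eq]
  rfl

lemma N.map_edge (j : V →o W) {x y : V} (h : x ≤ y) :
    (N.map.{u} j).app _ (N.edge h) = N.edge (j.monotone h) := by
  rw [N.edge_eq, N.edge_eq, N.map_app_simplex]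
  congr 1
  ext i
  fin_cases i <;> rfl

lemma N.map_comp_app_vertex {C : SSet.{u}} (j : V →o W) (σ : N.{u} W ⟶ C) (x : V) :
    (N.map j ≫ σ).app _ (N.vertex x) = σ.app _ (N.vertex (j x)) :=
  congrArg (σ.app _) (N.map_vertex j x)

lemma N.map_comp_app_edge {C : SSet.{u}} (j : V →o W) (σ : N.{u} W ⟶ C) {x y : V} (h : x ≤ y) :
    (N.map j ≫ σ).app _ (N.edge h) = σ.app _ (N.edge (j.monotone h)) :=
  congrArg (σ.app _) (N.map_edge j h)

variable {X : Triple.{u}} (hX : IsExact X) (σ : N.{u} W ⟶ X.carrier)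

lemma edge_self_mem_cof (hX : IsExact X) {x : W} (h : x ≤ x) : σ.app _ (N.edge h) ∈ X.cof := by
  rw [N.app_edge_self]
  exact hX.cof_of_equivalence (isEquivalence_id _)

lemma edge_self_mem_fib (hX : IsExact X) {x : W} (h : x ≤ x) : σ.app _ (N.edge h) ∈ X.fib := by
  rw [N.app_edge_self]
  exact hX.fib_of_equivalence (isEquivalence_id _)

/-- A map out of a zero object is a cofibration. -/
lemma edge_mem_cof (hX : IsExact X) {x y : W} (h : x ≤ y)
    (hx : IsZeroVertex (σ.app _ (N.vertex x))) : σ.app _ (N.edge h) ∈ X.cof := by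
  -- Both rows of the square are the given edge and both columns are degenerate. The square is
  -- Cartesian, its lower left corner is `x` and its right edge is an identity, hence a fibration;
  -- now (E3) applies to its upper edge.
  let j : Fin 2 × Fin 2 →o W := (N.pair h).comp OrderHom.snd
  have H := hX.of_cartesian (N.map j ≫ σ) (by
    rw [Square.lowerLeft, N.map_comp_app_vertex]
    exact hx) (by
    rw [Square.right, N.map_comp_app_edge]
    exact edge_self_mem_fib σ hX _)
    (isCartesian_of_columns hX.hasInnerFillers j (fun _ _ _ => rfl) σ)
  have := H.1
  rw [Square.top, N.map_comp_app_edge] at this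
  exact this

/-- A map into a zero object is a fibration. -/
lemma edge_mem_fib (hX : IsExact X) {x y : W} (h : x ≤ y)
    (hy : IsZeroVertex (σ.app _ (N.vertex y))) : σ.app _ (N.edge h) ∈ X.fib := by
  -- The transposed square: both columns are the given edge, the lower left corner is `y` and the
  -- upper edge is an identity.
  let j : Fin 2 × Fin 2 →o W := (N.pair h).comp OrderHom.fst
  have H := hX.of_cocartesian (N.map j ≫ σ) (by
    rw [Square.lowerLeft, N.map_comp_app_vertex]
    exact hy) (by
    rw [Square.top, N.map_comp_app_edge]
    exact edge_self_mem_cof σ hX _)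
    (isCocartesian_of_rows hX.hasInnerFillers j (fun _ _ _ => rfl) σ)
  have := H.1
  rw [Square.right, N.map_comp_app_edge] at this
  exact this

end

/-! ### Families of simplices of functor categories -/

section

variable {A B C : SSet.{u}}

/-- The evaluation of simplices of `Fun(A, C)`. -/
def Fun.val {d : SimplexCategoryᵒᵖ} (a : A.obj d) (α : (Fun A C).obj d) : C.obj d :=
  ((ihom.ev A).app C).app d (show (A ⊗ Fun A C).obj d from (a, α))

lemma Fun.val_curry (k : A ⊗ B ⟶ C) {d : SimplexCategoryᵒᵖ} (a : A.obj d) (b : B.obj d) :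
    Fun.val a ((MonoidalClosed.curry k).app d b) = k.app d (a, b) := by
  let p : (A ⊗ B).obj d := (a, b)
  exact ConcreteCategory.congr_hom (NatTrans.congr_app (MonoidalClosed.uncurry_curry k) d) p

lemma Fun.map_val {d e : SimplexCategoryᵒᵖ} (φ : d ⟶ e) (a : A.obj d) (α : (Fun A C).obj d) :
    C.map φ (Fun.val a α) = Fun.val (A.map φ a) ((Fun A C).map φ α) := by
  let p : (A ⊗ Fun A C).obj d := (a, α)
  exact (NatTrans.naturality_apply ((ihom.ev A).app C) φ p).symm

/-- A `d`-simplex is a map from the product of `A` with a standard simplex, and evaluating all its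
restrictions recovers every value of that map. -/
lemma Fun.ext {d : SimplexCategory} {α β : (Fun A C).obj (op d)}
    (h : ∀ (e : SimplexCategory) (φ : e ⟶ d) (a : A.obj (op e)),
      Fun.val a ((Fun A C).map φ.op α) = Fun.val a ((Fun A C).map φ.op β)) : α = β := by
  apply SSet.yonedaEquiv.symm.injective
  apply MonoidalClosed.uncurry_injective
  ext ⟨e⟩ ⟨a, φ⟩
  obtain ⟨φ, rfl⟩ := SSet.stdSimplex.objEquiv.symm.surjective φ
  exact h e φ a

/-- The simplex of `Fun(A, C)` given by a map out of a product with a standard simplex. -/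
def Fun.mk {d : SimplexCategory} (k : A ⊗ SSet.stdSimplex.obj d ⟶ C) : (Fun A C).obj (op d) :=
  SSet.yonedaEquiv (MonoidalClosed.curry k)

lemma Fun.val_map_mk {d e : SimplexCategory} (k : A ⊗ SSet.stdSimplex.obj d ⟶ C) (φ : e ⟶ d)
    (a : A.obj (op e)) : Fun.val a ((Fun A C).map φ.op (Fun.mk k)) =
      k.app _ (a, SSet.stdSimplex.objEquiv.symm φ) := by
  rw [← Fun.val_curry]
  congr 1

lemma Fun.toHom_app (F : Fun A C _⦋0⦌) {d : SimplexCategory} (a : A.obj (op d)) :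
    (Fun.toHom F).app _ a = Fun.val a ((Fun A C).map (SimplexCategory.const d ⦋0⦌ 0).op F) := by
  rfl

end

namespace PMap

variable {W V Q : Type} [PartialOrder W] [PartialOrder V] [PartialOrder Q] {C : SSet.{u}}

section

/-- The full simplicial subset of `Fun(N(Q), C)` spanned by the diagrams that satisfy `p`. -/
abbrev Diag (Q : Type) [PartialOrder Q] (p : (N.{u} Q ⟶ C) → Prop) : SSet.{u} :=
  (fullSub (Fun (N.{u} Q) C) fun F => p (Fun.toHom F) : SSet.{u})

variable {p : (N.{u} Q ⟶ C) → Prop}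

/-- The evaluation of a family of diagrams. -/
def eval (f : PMap W (Diag Q p)) : PMap (W × Q) C := fun d s =>
  Fun.val (N.simplex (OrderHom.snd.comp s)) (f d (OrderHom.fst.comp s)).1

/-- The vertex sets in `W × Q` whose projection belongs to `A`. -/
abbrev cyl (Q : Type) [PartialOrder Q] (A : LowerSet (Set W)) : LowerSet (Set (W × Q)) :=
  comap OrderHom.fst A

lemma natOn_eval {f : PMap W (Diag Q p)} {A : LowerSet (Set W)} (hf : f.NatOn A) :
    (eval f).NatOn (cyl Q A) := by
  intro d s hs e φ
  have := hf d (OrderHom.fst.comp s) (by rwa [range_comp]) e φ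
  have h := congrArg Subtype.val this
  refine (Fun.map_val _ _ _).trans ?_
  exact congrArg (Fun.val _) h

/-- The inclusion of a slice. -/
def slice {W : Type} [Preorder W] (Q : Type) [Preorder Q] (w : W) : Q →o W × Q :=
  ⟨fun q => (w, q), fun _ _ h => ⟨le_rfl, h⟩⟩

/-- The slice over `w` is the diagram at the vertex `w` of the family, which satisfies `p` by
membership in the full simplicial subset. -/
lemma exists_slice {f : PMap W (Diag Q p)} {A : LowerSet (Set W)} (hf : f.NatOn A) {w : W}
    (hw : {w} ∈ A) :
    ∃ τ : N.{u} Q ⟶ C, p τ ∧ ofHom τ = (eval f).comp (slice Q w) := by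
  let F : (Diag Q p) _⦋0⦌ := f ⦋0⦌ (OrderHom.const _ w)
  refine ⟨Fun.toHom F.1, ?_, ?_⟩
  · have := F.2 (𝟙 _)
    rwa [op_id, Functor.map_id_apply] at this
  · funext d t
    have := hf ⦋0⦌ (OrderHom.const _ w) (by
      refine A.lower ?_ hw
      rintro _ ⟨i, rfl⟩
      rfl) d (SimplexCategory.const d ⦋0⦌ 0)
    exact congrArg (Fun.val _) (congrArg Subtype.val this)

lemma eqOn_of_eval {f g : PMap W (Diag Q p)} {A : LowerSet (Set W)} (hf : f.NatOn A)
    (hg : g.NatOn A) (h : EqOn (cyl Q A) (eval f) (eval g)) : EqOn A f g := by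
  intro d s hs
  apply Subtype.ext
  apply Fun.ext
  intro e φ a
  have h₁ := hf d s hs e φ
  have h₂ := hg d s hs e φ
  let t : Fin (e.len + 1) →o W × Q := (s.comp φ.toOrderHom).prod (N.seq a)
  have h₃ := h e t (by
    change _ ∈ A
    rw [← range_comp]
    exact A.lower (range_comp_subset s φ) hs)
  refine (congrArg (Fun.val a) (congrArg Subtype.val h₁)).trans (Eq.trans ?_
    (congrArg (Fun.val a) (congrArg Subtype.val h₂)).symm)
  exact h₃

/-- The simplex of the functor category given by a family of simplices. -/
def curryAt {g : PMap (W × Q) C} {A : LowerSet (Set W)} (hg : g.NatOn (cyl Q A))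
    {d : SimplexCategory} (s : Fin (d.len + 1) →o W) (hs : Set.range s ∈ A) :
    (Fun (N.{u} Q) C).obj (Opposite.op d) :=
  Fun.mk
    { app := fun e => ↾fun x => g e.unop
        ((s.comp (SSet.stdSimplex.objEquiv x.2).toOrderHom).prod (N.seq x.1))
      naturality := fun e e' φ => by
        ext x
        have := hg e.unop
          ((s.comp (SSet.stdSimplex.objEquiv x.2).toOrderHom).prod (N.seq x.1)) (by
            change _ ∈ A
            rw [← range_comp]
            exact A.lower (range_comp_subset s (SSet.stdSimplex.objEquiv x.2)) hs) e'.unop φ.unop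
        exact this.symm }

lemma val_map_curryAt {g : PMap (W × Q) C} {A : LowerSet (Set W)} (hg : g.NatOn (cyl Q A))
    {d : SimplexCategory} (s : Fin (d.len + 1) →o W) (hs : Set.range s ∈ A)
    {e : SimplexCategory} (φ : e ⟶ d) (t : Fin (e.len + 1) →o Q) :
    Fun.val (N.simplex t) ((Fun (N.{u} Q) C).map φ.op (curryAt hg s hs)) =
      g e ((s.comp φ.toOrderHom).prod t) := by
  rw [curryAt, Fun.val_map_mk]
  rfl

lemma map_curryAt {g : PMap (W × Q) C} {A : LowerSet (Set W)} (hg : g.NatOn (cyl Q A))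
    {d : SimplexCategory} (s : Fin (d.len + 1) →o W) (hs : Set.range s ∈ A)
    {e : SimplexCategory} (φ : e ⟶ d) :
    (Fun (N.{u} Q) C).map φ.op (curryAt hg s hs) =
      curryAt hg (s.comp φ.toOrderHom) (A.lower (range_comp_subset s φ) hs) := by
  apply Fun.ext
  intro e' ψ a
  obtain ⟨t, rfl⟩ : ∃ t, N.simplex t = a := ⟨N.seq a, rfl⟩
  rw [val_map_curryAt, ← Functor.map_comp_apply, ← CategoryTheory.op_comp, val_map_curryAt]
  rfl

open Classical in
/-- A family of simplices in `C` on a product is the evaluation of a family of diagrams, if its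
restrictions to the slices are allowed diagrams. -/
theorem exists_eval_eq {g : PMap (W × Q) C} {A : LowerSet (Set W)} (hg : g.NatOn (cyl Q A))
    (c : (Diag Q p) _⦋0⦌) (h : ∀ w, {w} ∈ A →
      ∃ τ : N.{u} Q ⟶ C, p τ ∧ ofHom τ = g.comp (slice Q w)) :
    ∃ f : PMap W (Diag Q p), f.NatOn A ∧ EqOn (cyl Q A) (eval f) g := by
  -- Membership in a full simplicial subset is tested on vertices, and the vertices of `curryAt` are
  -- the slices of `g`.
  have key : ∀ {d : SimplexCategory} (s : Fin (d.len + 1) →o W) (hs : Set.range s ∈ A),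
      curryAt hg s hs ∈ (fullSub (Fun (N.{u} Q) C) fun F => p (Fun.toHom F)).obj (Opposite.op d) := by
    intro d s hs φ
    rw [← Quiver.Hom.op_unop φ.op, map_curryAt]
    obtain ⟨τ, hτ, hτ'⟩ := h (s (φ.toOrderHom 0)) (A.lower (by
      rintro _ rfl
      exact ⟨_, rfl⟩) hs)
    convert hτ using 1
    apply ofHom_injective
    rw [hτ']
    funext e t
    change (Fun.toHom _).app _ (N.simplex t) = _
    rw [Fun.toHom_app, val_map_curryAt]
    refine congrArg (g e) ?_
    ext i
    · change s (φ.toOrderHom _) = s (φ.toOrderHom 0)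
      congr 2
    · rfl
  let f : PMap W (Diag Q p) := fun d s =>
    if hs : Set.range s ∈ A then ⟨curryAt hg s hs, key s hs⟩ else PMap.const c d s
  have hf : ∀ (d : SimplexCategory) (s : Fin (d.len + 1) →o W) (hs : Set.range s ∈ A),
      f d s = ⟨curryAt hg s hs, key s hs⟩ := fun d s hs => dif_pos hs
  refine ⟨f, fun d s hs e φ => ?_, fun d s hs => ?_⟩
  · rw [hf d s hs, hf e _ (A.lower (range_comp_subset s φ) hs)]
    exact Subtype.ext (map_curryAt hg s hs φ)
  · have hs' : Set.range (OrderHom.fst.comp s) ∈ A := by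
      rw [range_comp]
      exact hs
    rw [eval, hf d _ hs']
    have := val_map_curryAt hg _ hs' (𝟙 d) (OrderHom.snd.comp s)
    rw [op_id, Functor.map_id_apply] at this
    exact this

end

end PMap

end ExInf

end

noncomputable section

set_option linter.unusedSectionVars false

namespace ExInf

namespace PMap

/-! ### Pointwise colimits -/

section

variable {W V Q : Type} [PartialOrder W] [PartialOrder V] [PartialOrder Q] {C : SSet.{u}}
  {p : (N.{u} Q ⟶ C) → Prop}

/-- The inclusion of the fibre over an element of `Q`. -/
def fibre (W : Type) [PartialOrder W] (q : Q) : W ↪o W × Q :=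
  OrderEmbedding.ofMapLEIff (fun w => (w, q)) fun _ _ => ⟨fun h => h.1, fun h => ⟨h, le_rfl⟩⟩

/-- The inclusion of the fibre over an element of `Q`, as a monotone map. -/
def fibreHom (W : Type) [Preorder W] (q : Q) : W →o W × Q :=
  ⟨fun w => (w, q), fun _ _ h => ⟨h, le_rfl⟩⟩

lemma singleton_mem_coneBdry {P : Type} [PartialOrder P] {m : ℕ} (w : P ⊕ₗ Fin (m + 2)) :
    {w} ∈ coneBdry P m := by
  rw [mem_coneBdry]
  by_contra h
  push Not at h
  have h₀ := h 0
  rw [← h 1] at h₀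
  simpa using Sum.inr_injective (congrArg ofLex h₀)

/-- Extensions of evaluations yield extensions of families of diagrams. -/
lemma exists_extension_of_eval {f : PMap W (Diag Q p)} {A : LowerSet (Set W)}
    (hf : f.NatOn A) (hA : ∀ w, {w} ∈ A) (c : (Diag Q p) _⦋0⦌)
    (h : ∃ g : PMap (W × Q) C, g.NatOn ⊤ ∧ EqOn (cyl Q A) (eval f) g) :
    ∃ g : PMap W (Diag Q p), g.NatOn ⊤ ∧ EqOn A f g := by
  obtain ⟨g, hg, hfg⟩ := h
  -- All vertices of `W` already belong to `A`, so the slices of the extension are diagrams of the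
  -- original family and nothing new has to be checked.
  obtain ⟨k, hk, hkg⟩ := exists_eval_eq (A := ⊤) hg c fun w _ => by
    obtain ⟨τ, hτ, hτ'⟩ := exists_slice hf (hA w)
    refine ⟨τ, hτ, hτ'.trans ?_⟩
    funext d s
    refine hfg d _ ?_
    rw [range_comp]
    refine A.lower ?_ (hA w)
    rintro _ ⟨_, ⟨y, -, rfl⟩, rfl⟩
    rfl
  exact ⟨k, hk, eqOn_of_eval hf (hk.mono le_top) (hfg.trans (hkg.symm.mono le_top))⟩

/-- Pointwise colimit cocones are colimit cocones. -/
theorem isColimit_of_eval (hC : HasInnerFillers C) {P : Type} [PartialOrder P]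
    {f : PMap (P ⊕ₗ Fin 1) (Diag Q p)}
    (H : ∀ q, IsColimit ((eval f).comp (fibreHom (P ⊕ₗ Fin 1) q))) :
    IsColimit f := by
  intro m g hg hgf
  refine exists_extension_of_eval hg singleton_mem_coneBdry
    (g ⦋0⦌ (OrderHom.const _ (Sum.inrₗ 0))) ?_
  have hA : ∀ {S : Set ((P ⊕ₗ Fin (m + 2)) × Q)}, S ∈ cyl Q (coneBdry P m) ↔
      ∃ j, ∀ q, (Sum.inrₗ j, q) ∉ S := by
    intro S
    refine mem_coneBdry.trans (exists_congr fun j => ?_)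
    constructor
    · exact fun h q hq => h ⟨_, hq, rfl⟩
    · rintro h ⟨⟨x, q⟩, hx, rfl⟩
      exact h q hx
  -- At the first vertex `e` over the simplex, the cocone to use has as base all vertices over `P`
  -- whose coordinate in `Q` is at most that of `e`.
  refine exists_extension_of_join {x | ∃ j, x.1 = Sum.inrₗ j}
    (fun e => {x | (∃ y, x.1 = Sum.inlₗ y) ∧ x.2 ≤ e.2}) (natOn_eval hg) fun S hS _ hSA => ?_
  have hfull : ∀ j, ∃ q, (Sum.inrₗ j, q) ∈ S := by
    by_contra hcon
    push Not at hcon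
    exact hSA (hA.2 hcon)
  obtain ⟨q₀, hq₀⟩ := hfull 0
  refine ⟨⟨_, hq₀, 0, rfl⟩, ?_⟩
  rintro ⟨e, q⟩ ⟨⟨heS, j, hj⟩, hmin⟩
  -- A new simplex meets the fibre over every vertex of `Δ[m + 1]`, so the first such vertex lies
  -- over `0`.
  obtain rfl : j = 0 := by
    have h₁ : e ≤ Sum.inrₗ 0 := (hmin ⟨hq₀, 0, rfl⟩).1
    rw [show e = Sum.inrₗ j from hj] at h₁
    exact Fin.le_zero_iff.1 (Sum.Lex.inr_le_inr_iff.1 h₁)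
  obtain rfl : e = Sum.inrₗ 0 := hj
  obtain ⟨q₁, hq₁⟩ := hfull 1
  have hlt : ∀ k : (P ⊕ₗ Fin (m + 2)) × Q, (∃ y, k.1 = Sum.inlₗ y) ∧ k.2 ≤ q →
      k < (Sum.inrₗ 0, q) := by
    rintro ⟨_, q'⟩ ⟨⟨y, rfl⟩, h⟩
    refine lt_of_le_of_ne ⟨Sum.Lex.inl_le_inr _ _, h⟩ fun h' => ?_
    cases congrArg (fun z => ofLex z.1) h'
  have hle : LowerSet.Iic (insert ((Sum.inrₗ 0, q) : (P ⊕ₗ Fin (m + 2)) × Q)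
      {x | (∃ y, x.1 = Sum.inlₗ y) ∧ x.2 ≤ q}) ≤ cyl Q (coneBdry P m) := by
    intro T hT
    refine hA.2 ⟨1, fun q' hq' => ?_⟩
    rcases hT hq' with h | ⟨⟨y, hy⟩, -⟩
    · have := Sum.inr_injective (congrArg (fun z => ofLex z.1) h)
      simp at this
    · cases congrArg ofLex hy
  refine ⟨?_, hle, ?_, ?_, ?_, ⟨_, hq₁, ?_⟩, fun _ _ _ => trivial⟩
  -- The part of the base over `q` itself is cofinal, and over `q` the cocone is a colimit cocone by
  -- hypothesis.
  · refine (isColimAt_iff_of_cofinal (L := {x | (∃ y, x.1 = Sum.inlₗ y) ∧ x.2 = q})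
      (K := {x | (∃ y, x.1 = Sum.inlₗ y) ∧ x.2 ≤ q}) hC
      (fun k hk => ⟨hk.1, hk.2.le⟩) hlt ((natOn_eval hg).mono hle) ?_).1 ?_
    · rintro ⟨_, q'⟩ ⟨⟨y, rfl⟩, hq'⟩ hn
      refine ⟨(Sum.inlₗ y, q), ⟨⟨y, rfl⟩, rfl⟩, lt_of_le_of_ne ⟨le_rfl, hq'⟩ fun h => ?_, ?_⟩
      · exact hn ⟨⟨y, rfl⟩, congrArg Prod.snd h⟩
      · rintro ⟨y', q''⟩ ⟨-, hq''⟩ h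
        exact ⟨h.1, (show q'' = q from hq'').ge⟩
    · let ψ : P ⊕ₗ Fin 1 ↪o (P ⊕ₗ Fin (m + 2)) × Q := (coneZeroEmb P m).trans (fibre _ q)
      have hψ := isColimAt_image ψ (f := eval g) (K := Set.range Sum.inlₗ) (e := Sum.inrₗ 0)
      have e₁ : ψ '' Set.range Sum.inlₗ = {x | (∃ y, x.1 = Sum.inlₗ y) ∧ x.2 = q} := by
        ext ⟨x, q'⟩
        constructor
        · rintro ⟨_, ⟨y, rfl⟩, h⟩
          exact ⟨⟨y, (congrArg Prod.fst h).symm⟩, (congrArg Prod.snd h).symm⟩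
        · rintro ⟨⟨y, rfl⟩, rfl⟩
          exact ⟨_, ⟨y, rfl⟩, rfl⟩
      rw [e₁] at hψ
      refine hψ.2 ?_
      have := H q
      rw [← hgf] at this
      exact this.isColimAt
  · rintro _ ⟨⟨y, hy⟩, -⟩ ⟨j, hj⟩
    cases congrArg ofLex (hy.symm.trans hj)
  · rintro ⟨y, q'⟩ hy hn
    have h₁ := (hS.total heS hy).resolve_left hn
    refine ⟨?_, h₁.2⟩
    cases y using lexSum_cases with
    | inl a => exact ⟨a, rfl⟩
    | inr a => exact (hn (hmin ⟨hy, a, rfl⟩)).elim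
  · rw [hA]
    push Not
    intro j
    obtain ⟨q', hq'⟩ := hfull j
    exact ⟨q', hq', hmin ⟨hq', j, rfl⟩⟩
  · refine lt_of_le_of_ne (hmin ⟨hq₁, 1, rfl⟩) fun h => ?_
    have := Sum.inr_injective (congrArg (fun z => ofLex z.1) h)
    simp at this

lemma eval_const_comp_fibre (x : (Diag Q p) _⦋0⦌) (q : Q) :
    (eval (PMap.const x : PMap W (Diag Q p))).comp (fibreHom W q) =
      PMap.const ((Fun.toHom x.1).app _ (N.vertex q)) := by
  funext d s
  exact eqOn_const_vertex (Fun.toHom x.1) q d _ (by rintro _ ⟨i, rfl⟩; rfl)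

lemma isInitialVertex_of_eval (hC : HasInnerFillers C) {x : (Diag Q p) _⦋0⦌}
    (h : ∀ q, IsInitialVertex ((Fun.toHom x.1).app _ (N.vertex q))) : IsInitialVertex x := by
  refine (isColimitCocone_iff _).2 (isColimit_of_eval hC fun q => ?_)
  rw [ofHom_const, eval_const_comp_fibre]
  exact (isColimitCocone_iff _).1 (h q)

lemma isTerminalVertex_of_eval {x : (Diag Q p) _⦋0⦌}
    (h : ∀ q, IsTerminalVertex ((Fun.toHom x.1).app _ (N.vertex q))) : IsTerminalVertex x := by
  refine (isLimitCone_iff _).2 fun m g hg hgx => ?_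
  have hv : ∀ w : Fin (m + 2) ⊕ₗ Empty, {w} ∈ bdryCone Empty m := by
    intro w
    rw [mem_bdryCone]
    by_contra h
    push Not at h
    have h₀ := h 0
    rw [← h 1] at h₀
    simpa using Sum.inl_injective (congrArg ofLex h₀)
  refine exists_extension_of_eval hg hv x ?_
  refine exists_extension_of_terminal (natOn_eval hg) fun S hS _ hSA e he => ?_
  have hfull : ∀ j, ∃ q, (Sum.inlₗ j, q) ∈ S := by
    by_contra hcon
    push Not at hcon
    obtain ⟨j, hj⟩ := hcon
    refine hSA (mem_bdryCone.2 ⟨j, ?_⟩)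
    rintro ⟨⟨_, q⟩, h, rfl⟩
    exact hj q h
  obtain ⟨e, q⟩ := e
  -- A new simplex meets all fibres, so its largest vertex lies over the last vertex, where the
  -- value is terminal.
  obtain rfl : e = Sum.inlₗ (Fin.last _) := by
    obtain ⟨q', hq'⟩ := hfull (Fin.last _)
    have := (he.2 hq').1
    cases e using lexSum_cases with
    | inl a =>
      congr 1
      exact le_antisymm (Fin.le_last _) (Sum.Lex.inl_le_inl_iff.1 this)
    | inr a => exact a.elim
  have hle : {(Sum.inlₗ (Fin.last _), q)} ∈ cyl Q (bdryCone Empty m) := by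
    refine (bdryCone Empty m).lower ?_ (hv (Sum.inlₗ (Fin.last _)))
    rintro _ ⟨_, rfl, rfl⟩
    rfl
  refine ⟨(isTerminalVertex_iff ?_).1 (h q), hle⟩
  intro d s hs
  have hs' : s = ((coneLast Empty m).prodMap OrderHom.id).comp
      ((fibreHom (Fin 1 ⊕ₗ Empty) q).comp
        (OrderHom.const _ (Sum.inlₗ 0))) := by
    ext i : 2
    exact hs ⟨i, rfl⟩
  have h₁ := congrFun (congrFun (congrArg eval hgx) d)
    ((fibreHom (Fin 1 ⊕ₗ Empty) q).comp
        (OrderHom.const _ (Sum.inlₗ 0)))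
  rw [hs']
  refine Eq.trans h₁ ?_
  exact congrFun (congrFun (eval_const_comp_fibre (W := Fin 1 ⊕ₗ Empty) x q) d)
    (OrderHom.const _ (Sum.inlₗ 0))

end

end PMap

end ExInf

end

noncomputable section

set_option linter.unusedSectionVars false

namespace ExInf

open PMap

/-! ### Retracts of initial objects -/

section Retract

variable {C : SSet.{u}} {m : ℕ}

/-- The map that identifies the first three vertices. -/
def collapseHom (m : ℕ) : Fin 3 ⊕ₗ Fin (m + 1) →o Empty ⊕ₗ Fin (m + 2) :=
  sumDesc (OrderHom.const _ (Sum.inrₗ 0))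
    ⟨fun i => Sum.inrₗ i.succ, fun _ _ h => Sum.Lex.inr_le_inr_iff.2 (Fin.succ_le_succ_iff.2 h)⟩
    fun _ _ => Sum.Lex.inr_le_inr_iff.2 (Fin.zero_le _)

/-- The section of `collapseHom` that omits the second and the third vertex. -/
def expandHom (m : ℕ) : Empty ⊕ₗ Fin (m + 2) →o Fin 3 ⊕ₗ Fin (m + 1) :=
  sumDesc ⟨fun x => x.elim, fun x => x.elim⟩
    ⟨fun j => Fin.cases (Sum.inlₗ 0) (fun i => Sum.inrₗ i) j, fun i j => by
      refine Fin.cases ?_ (fun i => ?_) i <;> refine Fin.cases ?_ (fun j => ?_) j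
      · exact fun _ => le_rfl
      · exact fun _ => Sum.Lex.inl_le_inr _ _
      · exact fun h => (Fin.succ_ne_zero i (Fin.le_zero_iff.1 h)).elim
      · exact fun h => Sum.Lex.inr_le_inr_iff.2 (Fin.succ_le_succ_iff.1 h)⟩
    fun x => x.elim

lemma collapse_expand : (collapseHom m).comp (expandHom m) = OrderHom.id := by
  refine lexSum_hom_ext (fun a => a.elim) (fun j => ?_)
  refine Fin.cases ?_ (fun j => ?_) j <;> rfl

lemma inl_notMem_range_expand {i : Fin 3} (hi : 1 ≤ i) :
    Sum.inlₗ i ∉ Set.range (expandHom m) := by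
  rintro ⟨x, hx⟩
  cases x using lexSum_cases with
  | inl a => exact a.elim
  | inr j =>
    revert hx
    refine Fin.cases (fun hx => ?_) (fun j hx => ?_) j
    · have : 0 = i := Sum.inl_injective (congrArg ofLex hx)
      subst this
      exact absurd hi (by decide)
    · cases congrArg ofLex hx

/-- The simplex `t` presents `y` as a retract of `x`. In place of the vertex `0` there are three
vertices `p 0`, `p 1`, `p 2` with values `y`, `x`, `y`. Fillings starting at `p 1` exist because `x`
is initial, and they are pulled back along the edge from `p 0` to `p 1`; the boundary comes out
right because the composite from `p 0` to `p 2` is degenerate. -/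
lemma exists_extension_retract (hC : HasInnerFillers C) {x y : C _⦋0⦌} (hx : IsInitialVertex x)
    {t : PMap (Fin 3) C} (ht : t.NatOn ⊤) (hty : EqOn (LowerSet.Iic {0, 2}) t (PMap.const y))
    (htx : EqOn (LowerSet.Iic {1}) t (PMap.const x)) {g : PMap (Empty ⊕ₗ Fin (m + 2)) C}
    (hg : g.NatOn (coneBdry Empty m))
    (hgy : EqOn (LowerSet.Iic {Sum.inrₗ 0}) g (PMap.const y)) :
    ∃ h : PMap (Empty ⊕ₗ Fin (m + 2)) C, h.NatOn ⊤ ∧ EqOn (coneBdry Empty m) g h := by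
  let p : Fin 3 → Fin 3 ⊕ₗ Fin (m + 1) := fun i => Sum.inlₗ i
  let full : Set (Fin 3 ⊕ₗ Fin (m + 1)) := Set.range Sum.inrₗ
  let A₁ := comap (collapseHom m) (coneBdry Empty m) ⊓ notAbove ⊤ {p 1}
  let A₂ : LowerSet (Set (Fin 3 ⊕ₗ Fin (m + 1))) := LowerSet.Iic (Set.range p)
  have not₁ : ∀ {i T}, T ∈ notAbove (W := Fin 3 ⊕ₗ Fin (m + 1)) ⊤ {p i} ↔ p i ∉ T := by
    intro i T
    rw [mem_notAbove]
    simp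
  have hcases : ∀ {T : Set (Fin 3 ⊕ₗ Fin (m + 1))}, T ∉ A₂ → ∃ j, Sum.inrₗ j ∈ T := by
    intro T hT
    by_contra hcon
    refine hT fun y hy => ?_
    cases y using lexSum_cases with
    | inl a => exact ⟨a, rfl⟩
    | inr a => exact (hcon ⟨a, hy⟩).elim
  have hnotA₂ : ∀ {T : Set (Fin 3 ⊕ₗ Fin (m + 1))} {j}, Sum.inrₗ j ∈ T → T ∉ A₂ := by
    intro T j hj hT
    obtain ⟨i, hi⟩ := hT hj
    cases congrArg ofLex hi
  have A₁_of : ∀ T, p 1 ∉ T → (¬ full ⊆ T ∨ ∀ i, p i ∉ T) → T ∈ A₁ := by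
    rintro T h₁ h
    refine ⟨mem_coneBdry.2 ?_, not₁.2 h₁⟩
    rcases h with h | h
    · obtain ⟨_, ⟨i, rfl⟩, hi⟩ := Set.not_subset.1 h
      refine ⟨i.succ, ?_⟩
      rintro ⟨y, hy, e⟩
      cases y using lexSum_cases with
      | inl a => exact Fin.succ_ne_zero i (Sum.inr_injective (congrArg ofLex e)).symm
      | inr a =>
        have : a.succ = i.succ := Sum.inr_injective (congrArg ofLex e)
        exact hi (Fin.succ_injective _ this ▸ hy)
    · refine ⟨0, ?_⟩
      rintro ⟨y, hy, e⟩
      cases y using lexSum_cases with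
      | inl a => exact h a hy
      | inr a => exact Fin.succ_ne_zero a (Sum.inr_injective (congrArg ofLex e))
  let ρ : Fin 3 ⊕ₗ Fin (m + 1) →o Fin 3 :=
    sumDesc OrderHom.id (OrderHom.const _ 2) fun i _ => Fin.le_last i
  obtain ⟨f, hf, e₁, e₂⟩ := exists_glue ((hg.comp (collapseHom m)).mono inf_le_left)
    ((ht.comp_top ρ).mono (le_top : A₂ ≤ ⊤)) (A := A₁) (by
    rintro d s ⟨hs₁, hs₂⟩
    refine (hgy d _ ?_).trans (hty d _ ?_).symm
    · rw [range_comp]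
      rintro _ ⟨y, hy, rfl⟩
      obtain ⟨i, rfl⟩ := hs₂ hy
      rfl
    · rw [range_comp]
      rintro _ ⟨y, hy, rfl⟩
      obtain ⟨i, rfl⟩ := hs₂ hy
      have : i ≠ 1 := fun h => not₁.1 hs₁.2 (h ▸ hy)
      have : i = 0 ∨ i = 2 := by omega
      exact this)
  let A := A₁ ⊔ A₂
  let B₁ : LowerSet (Set (Fin 3 ⊕ₗ Fin (m + 1))) :=
    A ⊔ (notAbove ⊤ (insert (p 2) full) ⊓ notAbove ⊤ {p 0})
  let B₂ : LowerSet (Set (Fin 3 ⊕ₗ Fin (m + 1))) := B₁ ⊔ notAbove ⊤ full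
  let B₃ : LowerSet (Set (Fin 3 ⊕ₗ Fin (m + 1))) := B₂ ⊔ notAbove ⊤ {p 2}
  have hp : ∀ {i j}, p i = p j → i = j := fun h => Sum.inl_injective (congrArg ofLex h)
  have hlt : ∀ {i j}, i < j → p i < p j := fun h => Sum.Lex.inl_lt_inl_iff.2 h
  -- The simplices starting at `p 1` are filled by initiality. Those containing both `p 2` and
  -- `full` are left out, since the simplex on `p 2` and `full` is as unknown as the one that is
  -- sought.
  obtain ⟨f₁, hf₁, e₃⟩ := exists_extension_of_initial (B := B₁) hf (by
    intro S hS hB hA e he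
    have hB' := hB.resolve_left hA
    have hp0 := not₁.1 hB'.2
    have hp1 : p 1 ∈ S := by
      by_contra hp1
      refine hA (Or.inl (A₁_of S hp1 ?_))
      by_cases hp2 : p 2 ∈ S
      · exact Or.inl fun h => hB'.1.2 (Set.insert_subset hp2 h)
      · right
        intro i
        fin_cases i
        · exact hp0
        · exact hp1
        · exact hp2
    have : e = p 1 := by
      have h₁ := he.2 hp1
      have h₂ := he.1
      cases e using lexSum_cases with
      | inl a =>
        have h₃ : a ≤ 1 := Sum.Lex.inl_le_inl_iff.1 h₁
        have h₄ : a ≠ 0 := fun h => hp0 (h ▸ h₂)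
        have : a = 1 := by omega
        rw [this]
      | inr a => exact (Sum.Lex.not_inr_le_inl h₁).elim
    subst this
    have hA₂ : {p 1} ∈ A₂ := by
      rintro _ rfl
      exact ⟨1, rfl⟩
    refine ⟨(isInitialVertex_iff (x := x) fun d s hs => ?_).1 hx, Or.inr hA₂⟩
    refine (e₂ d s (A₂.lower hs hA₂)).symm.trans (htx d _ ?_)
    rw [range_comp]
    rintro _ ⟨y, hy, rfl⟩
    rw [show y = p 1 from hs hy]
    rfl)
  -- The simplices with `p 0` and `p 1` over the boundary are paired by inserting or removing `p 2`.
  obtain ⟨f₂, hf₂, e₄⟩ := exists_extension_of_pairing (B := B₂) hC {p 1} (fun _ => p 2) (by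
      rintro _ rfl
      exact ⟨hlt (by decide), fun h => absurd (hp h) (by decide)⟩) (by
    intro S hS hB hA
    have hfull := (hB.resolve_left hA).2
    have hp0 : p 0 ∈ S := by
      by_contra hp0
      exact hA (Or.inr ⟨⟨trivial, fun h => hfull ((Set.subset_insert _ _).trans h)⟩, not₁.2 hp0⟩)
    have hp1 : p 1 ∈ S := by
      by_contra hp1
      exact hA (Or.inl (Or.inl (A₁_of S hp1 (Or.inl hfull))))
    obtain ⟨j, hj⟩ := hcases fun h => hA (Or.inl (Or.inr h))
    refine ⟨⟨_, hp1, rfl⟩, fun _ _ => ⟨Or.inr ⟨trivial, fun h => hfull ?_⟩,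
      fun y _ => le_total _ _, ⟨_, hj, Sum.Lex.inl_lt_inr _ _⟩, ?_⟩⟩
    · rintro _ ⟨i, rfl⟩
      exact (h ⟨i, rfl⟩).resolve_left fun e => by cases congrArg ofLex e
    · rintro ((h | h) | h)
      · exact not₁.1 h.2 ⟨hp1, fun e => absurd (hp e) (by decide)⟩
      · exact hnotA₂ (T := S \ {p 2}) (j := j) ⟨hj, fun e => by cases congrArg ofLex e⟩ h
      · exact not₁.1 h.2 ⟨hp0, fun e => absurd (hp e) (by decide)⟩) hf₁
  -- The simplex on `p 0` and `full` is obtained from an inner horn at `p 1`, which has the simplex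
  -- on `p 1` and `full` as a face.
  obtain ⟨f₃, hf₃, e₅⟩ := exists_extension_of_pairing (B := B₃) hC {p 0} (fun _ => p 1) (by
      rintro _ rfl
      exact ⟨hlt (by decide), fun h => absurd (hp h) (by decide)⟩) (by
    intro S hS hB hA
    have hp2 : p 2 ∉ S := not₁.1 (hB.resolve_left hA)
    have hfull : full ⊆ S := by
      by_contra h
      exact hA (Or.inr ⟨trivial, h⟩)
    have hp0 : p 0 ∈ S := by
      by_contra h
      exact hA (Or.inl (Or.inr ⟨⟨trivial, fun h' => hp2 (h' (Set.mem_insert _ _))⟩, not₁.2 h⟩))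
    refine ⟨⟨_, hp0, rfl⟩, fun _ _ => ⟨Or.inr (not₁.2 ?_), fun y _ => le_total _ _,
      ⟨_, hfull ⟨0, rfl⟩, Sum.Lex.inl_lt_inr _ _⟩, ?_⟩⟩
    · rintro (h | h)
      · exact absurd (hp h) (by decide)
      · exact hp2 h
    · have hp0' : p 0 ∈ S \ {p 1} := ⟨hp0, fun e => absurd (hp e) (by decide)⟩
      have hfull' : ∀ j, Sum.inrₗ j ∈ S \ {p 1} := fun j =>
        ⟨hfull ⟨j, rfl⟩, fun e => by cases congrArg ofLex e⟩
      rintro (((h | h) | h) | h)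
      · obtain ⟨j, hj⟩ := mem_coneBdry.1 h.1
        revert hj
        refine Fin.cases (fun hj => ?_) (fun j hj => ?_) j
        · exact hj ⟨p 0, hp0', rfl⟩
        · exact hj ⟨Sum.inrₗ j, hfull' j, rfl⟩
      · exact hnotA₂ (hfull' 0) h
      · exact not₁.1 h.2 hp0'
      · refine h.2 ?_
        rintro _ ⟨j, rfl⟩
        exact hfull' j) hf₂
  refine ⟨f₃.comp (expandHom m), (hf₃.comp _).mono fun S _ => Or.inr (not₁.2 fun h => ?_),
    fun d s hs => ?_⟩
  · exact inl_notMem_range_expand (by decide) (Set.image_subset_range _ _ h)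
  · have hfu : (collapseHom m).comp ((expandHom m).comp s) = s := congrArg (·.comp s) collapse_expand
    have hA₁ : Set.range ((expandHom m).comp s) ∈ A₁ := by
      refine ⟨?_, not₁.2 fun h => ?_⟩
      · change _ ∈ coneBdry Empty m
        rw [← range_comp, hfu]
        exact hs
      · rw [range_comp] at h
        exact inl_notMem_range_expand (by decide) (Set.image_subset_range _ _ h)
    calc g d s = g d ((collapseHom m).comp ((expandHom m).comp s)) := congrArg (g d) hfu.symm
      _ = f d _ := e₁ d _ hA₁
      _ = f₁ d _ := e₃ d _ (Or.inl hA₁)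
      _ = f₂ d _ := e₄ d _ (Or.inl (Or.inl hA₁))
      _ = f₃ d _ := e₅ d _ (Or.inl (Or.inl (Or.inl hA₁)))

lemma isInitialVertex_of_retract (hC : HasInnerFillers C) {x y : C _⦋0⦌} (hx : IsInitialVertex x)
    {t : PMap (Fin 3) C} (ht : t.NatOn ⊤) (hty : EqOn (LowerSet.Iic {0, 2}) t (PMap.const y))
    (htx : EqOn (LowerSet.Iic {1}) t (PMap.const x)) : IsInitialVertex y := by
  refine (isColimitCocone_iff _).2 fun m g hg hgy => ?_
  refine exists_extension_retract hC hx ht hty htx hg fun d s hs => ?_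
  obtain ⟨s', rfl⟩ := exists_comp_eq (coneZeroEmb Empty m) (s := s) (by
    refine hs.trans ?_
    rintro _ rfl
    exact ⟨Sum.inrₗ 0, rfl⟩)
  exact congrFun (congrFun hgy d) s'

lemma isTerminalVertex_of_retract (hC : HasInnerFillers C) {x y : C _⦋0⦌}
    (hx : IsTerminalVertex x) {t : PMap (Fin 3) C} (ht : t.NatOn ⊤)
    (hty : EqOn (LowerSet.Iic {0, 2}) t (PMap.const y))
    (htx : EqOn (LowerSet.Iic {1}) t (PMap.const x)) : IsTerminalVertex y := by
  let r : Fin 3 →o (Fin 3)ᵒᵈ := (Fin.revOrderIso (n := 3)).symm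
  rw [isTerminalVertex_iff_op] at hx ⊢
  refine isInitialVertex_of_retract hC.op hx (t := t.op.comp r)
    (((natOn_op (A := ⊤)).2 ht).comp r) ?_ ?_
  · intro d s hs
    refine (eqOn_op.2 hty d (r.comp s) ?_).trans
      (congrFun (congrFun (op_const (W := Fin 3) y) d) (r.comp s))
    rintro _ ⟨i, hi⟩
    have h : s i = 0 ∨ s i = 2 := hs ⟨i, rfl⟩
    have hi' : (s i).rev = _ := hi
    rcases h with h | h <;> rw [h] at hi'
    · exact Or.inr hi'.symm
    · exact Or.inl hi'.symm
  · intro d s hs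
    refine (eqOn_op.2 htx d (r.comp s) ?_).trans
      (congrFun (congrFun (op_const (W := Fin 3) x) d) (r.comp s))
    rintro _ ⟨i, hi⟩
    have h : s i = 1 := hs ⟨i, rfl⟩
    have hi' : (s i).rev = _ := hi
    rw [h] at hi'
    exact hi'.symm

/-- Every vertex of the triangle is initial, so the prescribed degenerate edge and the middle vertex
extend to all of it. -/
lemma exists_retract {x y : C _⦋0⦌} (hx : IsInitialVertex x) (hy : IsInitialVertex y) :
    ∃ t : PMap (Fin 3) C, t.NatOn ⊤ ∧ EqOn (LowerSet.Iic {0, 2}) t (PMap.const y) ∧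
      EqOn (LowerSet.Iic {1}) t (PMap.const x) := by
  obtain ⟨f, hf, e₁, e₂⟩ := exists_glue (natOn_const (W := Fin 3) y (LowerSet.Iic {0, 2}))
    (natOn_const (W := Fin 3) x (LowerSet.Iic {1})) (by
      rintro d s ⟨h₁, h₂⟩
      have h₃ : s 0 = 1 := h₂ ⟨0, rfl⟩
      have h₄ : s 0 = 0 ∨ s 0 = 2 := h₁ ⟨0, rfl⟩
      rw [h₃] at h₄
      exact absurd h₄ (by decide))
  obtain ⟨t, ht, e⟩ := exists_extension_of_initial (B := ⊤) hf (by
    intro S _ _ _ v _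
    by_cases hv : v = 1
    · subst hv
      have h : ({1} : Set (Fin 3)) ∈ LowerSet.Iic ({1} : Set (Fin 3)) := Set.Subset.refl _
      exact ⟨(isInitialVertex_iff (e₂.symm.mono (LowerSet.Iic_le.2 h))).1 hx, Or.inr h⟩
    · have h : ({v} : Set (Fin 3)) ∈ LowerSet.Iic ({0, 2} : Set (Fin 3)) := by
        have : v = 0 ∨ v = 2 := by omega
        exact Set.singleton_subset_iff.2 this
      exact ⟨(isInitialVertex_iff (e₁.symm.mono (LowerSet.Iic_le.2 h))).1 hy, Or.inl h⟩)
  exact ⟨t, ht, (e.symm.mono le_sup_left).trans e₁.symm, (e.symm.mono le_sup_right).trans e₂.symm⟩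

/-- If there is a pointwise zero diagram, then all zero diagrams are pointwise zero. -/
lemma isZeroVertex_eval (hC : HasInnerFillers C) {Q : Type} [PartialOrder Q]
    {p : (N.{u} Q ⟶ C) → Prop} {x y : (Diag Q p) _⦋0⦌}
    (hx : ∀ q, IsZeroVertex ((Fun.toHom x.1).app _ (N.vertex q))) (hy : IsZeroVertex y) (q : Q) :
    IsZeroVertex ((Fun.toHom y.1).app _ (N.vertex q)) := by
  -- The pointwise zero diagram `x` is initial, so `y` is a retract of it; evaluation at `q`
  -- preserves retracts.
  obtain ⟨t, ht, e₁, e₂⟩ := exists_retract (isInitialVertex_of_eval hC fun q => (hx q).1) hy.1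
  have h : ∀ (S : Set (Fin 3)) (z : (Diag Q p) _⦋0⦌), EqOn (LowerSet.Iic S) t (PMap.const z) →
      EqOn (LowerSet.Iic S) ((eval t).comp (fibreHom (Fin 3) q))
        (PMap.const ((Fun.toHom z.1).app _ (N.vertex q))) := by
    intro S z hz d s hs
    rw [← eval_const_comp_fibre (W := Fin 3) z q]
    exact congrArg (fun a : (Diag Q p).obj (op d) => Fun.val _ a.1) (hz d s hs)
  exact ⟨isInitialVertex_of_retract hC (hx q).1 ((natOn_eval ht).comp _) (h _ _ e₁) (h _ _ e₂),
    isTerminalVertex_of_retract hC (hx q).2 ((natOn_eval ht).comp _) (h _ _ e₁) (h _ _ e₂)⟩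

end Retract

end ExInf

end

noncomputable section

set_option linter.unusedSectionVars false

namespace ExInf

namespace PMap

/-! ### Evaluation functors that preserve colimits -/

section

variable {C : SSet.{u}} {E Q : Type} [PartialOrder E] [PartialOrder Q]

/-- A map `π : Q ⟶ [2]` together with a closure operator `cl` on the preimage of `{0, 1}`
such that `v` is the only closed element over `1`. The diagrams `π^*(0 ⟶ c ⟶ 0)` are coinduced
from `c` at `v` among the diagrams that vanish on the closed elements over `0`. -/
structure Coinduction (Q : Type) [PartialOrder Q] where
  π : Q →o Fin 3
  cl : Q → Q
  v : Q
  top : Q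
  le_top : ∀ w, w ≤ top
  π_v : π v = 1
  le_cl : ∀ w, π w ≤ 1 → w ≤ cl w
  π_cl : ∀ w, π w ≤ 1 → π (cl w) = π w
  cl_mono : ∀ w w', w ≤ w' → π w' ≤ 1 → cl w ≤ cl w'
  cl_cl : ∀ w, π w ≤ 1 → cl (cl w) = cl w
  cl_eq : ∀ w, π w = 1 → cl w = v

open Classical in
/-- The index of the object that determines the value at `(s, w)`. For `s` in `L` it is `(s, w)`,
otherwise it only depends on `s` and on `π w`. -/
def Coinduction.index (R : Coinduction Q) (L : Set E) (hL : ∀ s ∈ L, ∀ j ∉ L, s < j) :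
    E × Q →o E × Q × Fin 3 where
  toFun x := (x.1, if x.1 ∈ L then x.2 else R.top, R.π x.2)
  monotone' := by
    rintro ⟨s, w⟩ ⟨s', w'⟩ ⟨h₁, h₂⟩
    refine ⟨h₁, ?_, R.π.monotone h₂⟩
    dsimp only at h₁ ⊢
    split_ifs with h h' h'
    · exact h₂
    · exact R.le_top _
    · exact ((hL _ h' _ h).not_ge h₁).elim
    · exact le_rfl

/-- A map out of the objects in `L` to a coinduced diagram is determined by its value at `v`. -/
theorem Coinduction.exists_extension (hC : HasInnerFillers C) (R : Coinduction Q) {L : Set E}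
    (hL : ∀ s ∈ L, ∀ j ∉ L, s < j) {Z : LowerSet (Set E)} {f : PMap (E × Q) C} (hf : f.NatOn ⊤)
    {g : PMap E C} (hg : g.NatOn Z)
    (hfg : EqOn (LowerSet.Iic L) g (f.comp (fibreHom E R.v))) {z : C _⦋0⦌} (hz : IsZeroVertex z)
    (hf₀ : ∀ s ∈ L, ∀ w, R.π w = 0 → R.cl w = w → IsColimAt f ∅ (s, w)) :
    ∃ h : PMap (E × Q) C, h.NatOn (cyl Q Z) ∧
      EqOn (cyl Q Z ⊓ cyl Q (LowerSet.Iic L)) f h ∧ EqOn Z g (h.comp (fibreHom E R.v)) ∧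
      ∀ j ∉ L, {j} ∈ Z → ∃ t : PMap (Fin 3) C, t.NatOn ⊤ ∧
        EqOn (LowerSet.Iic {0}) t (PMap.const z) ∧ EqOn (LowerSet.Iic {2}) t (PMap.const z) ∧
        h.comp (slice Q j) = t.comp R.π := by
  classical
  -- The extension is built on an auxiliary shape. `X₀` is a copy of `L × Q` and carries `f`. Over
  -- each remaining object, `X₁` has only a chain of three elements, to which `R.π` will be applied.
  -- The given data are `f` on `A₁`, the map `g` on the middle level `A₂`, and the zero object on
  -- the outer levels `A₃`.
  let X₀ : Set (E × Q × Fin 3) := {x | x.1 ∈ L ∧ x.2.2 = R.π x.2.1}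
  let X₁ : Set (E × Q × Fin 3) := {x | x.1 ∉ L ∧ x.2.1 = R.top}
  let 𝒵 : LowerSet (Set (E × Q × Fin 3)) :=
    LowerSet.Iic (X₀ ∪ X₁) ⊓ comap (OrderHom.fst (α := E) (β := Q × Fin 3)) Z
  let A₁ : LowerSet (Set (E × Q × Fin 3)) := LowerSet.Iic X₀
  let A₂ : LowerSet (Set (E × Q × Fin 3)) :=
    𝒵 ⊓ LowerSet.Iic {x | x.2.2 = 1 ∧ (x.1 ∈ L → x.2.1 = R.v)}
  let A₃ : LowerSet (Set (E × Q × Fin 3)) := LowerSet.Iic (X₁ ∩ {x | x.2.2 ≠ 1})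
  let pr : E × Q × Fin 3 →o E × Q := OrderHom.fst.prod (OrderHom.fst.comp OrderHom.snd)
  obtain ⟨f₁, hf₁, e₁, e₂⟩ := exists_glue (A := A₁) (B := A₂) ((hf.comp_top pr).mono _root_.le_top)
    ((hg.comp (OrderHom.fst (α := E) (β := Q × Fin 3))).mono fun S hS => hS.1.2) (by
      rintro d s ⟨h₁, h₂⟩
      refine Eq.trans ?_ (hfg d (OrderHom.fst.comp s) ?_).symm
      · refine congrArg (f d) ?_
        ext i
        · rfl
        · exact (h₂.2 ⟨i, rfl⟩).2 (h₁ ⟨i, rfl⟩).1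
      · rintro _ ⟨i, rfl⟩
        exact (h₁ ⟨i, rfl⟩).1)
  obtain ⟨f₂, hf₂, e₃, e₄⟩ := exists_glue (B := A₃) hf₁ (natOn_const z _) (by
      rintro d s ⟨h₁ | h₁, h₂⟩
      · exact ((h₂ ⟨0, rfl⟩).1.1 (h₁ ⟨0, rfl⟩).1).elim
      · exact ((h₂ ⟨0, rfl⟩).2 (h₁.2 ⟨0, rfl⟩).1).elim)
  let A : LowerSet (Set (E × Q × Fin 3)) := A₁ ⊔ A₂ ⊔ A₃
  have hnew : ∀ {S}, S ∈ 𝒵 → S ∉ A → ∃ y ∈ S, y ∈ X₁ := by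
    intro S hS hA
    by_contra hcon
    push Not at hcon
    exact hA (Or.inl (Or.inl fun y hy => (hS.1 hy).resolve_right (hcon y hy)))
  have hX : ∀ {x}, x ∈ X₀ → x ∉ X₁ := fun h h' => h'.1 h.1
  have mem₃ : ∀ {x}, x ∈ X₁ → x.2.2 ≠ 1 → {x} ∈ A₃ := by
    rintro x hx hx' _ rfl
    exact ⟨hx, hx'⟩
  let B₁ : LowerSet (Set (E × Q × Fin 3)) :=
    A ⊔ (𝒵 ⊓ LowerSet.Iic {x | x.2.2 ≤ 1 ∧ (x.1 ∈ L → R.cl x.2.1 = x.2.1)})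
  let B₂ : LowerSet (Set (E × Q × Fin 3)) := B₁ ⊔ (𝒵 ⊓ LowerSet.Iic {x | x.2.2 ≤ 1})
  -- Levels `0` and `1`, using only closed elements over `L`. On level `1` the only closed element
  -- is `v`, which is covered by `g`; so a new simplex starts on level `0`, where all values are
  -- initial.
  obtain ⟨f₃, hf₃, e₅⟩ := exists_extension_of_initial (B := B₁) hf₂ (by
    rintro S hS hB hA ⟨s, w, t⟩ he
    obtain ⟨hZ, hcl⟩ := hB.resolve_left hA
    have ht : t = 0 := by
      by_contra ht
      refine hA (Or.inl (Or.inr ⟨hZ, fun y hy => ?_⟩))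
      have h₁ : t ≤ y.2.2 := (he.2 hy).2.2
      have h₂ : y.2.2 ≤ 1 := (hcl hy).1
      have h₃ : y.2.2 = 1 := by omega
      refine ⟨h₃, fun hyL => ?_⟩
      rw [← (hcl hy).2 hyL]
      refine R.cl_eq _ ?_
      rcases hZ.1 hy with h | h
      · rw [← h.2, h₃]
      · exact (h.1 hyL).elim
    subst ht
    rcases hZ.1 he.1 with h | h
    · have hA₁ : {(s, w, 0)} ∈ A₁ := by
        rintro _ rfl
        exact h
      refine ⟨?_, Or.inl (Or.inl hA₁)⟩
      let ψ : Unit ↪o E × Q := OrderEmbedding.ofMapLEIff (fun _ => (s, w)) (by simp)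
      let ψ' : Unit ↪o E × Q × Fin 3 := OrderEmbedding.ofMapLEIff (fun _ => (s, w, 0)) (by simp)
      have h₁ := (isColimAt_image ψ (f := f) (K := ∅) (e := ())).1 (by
        rw [Set.image_empty]
        exact hf₀ s h.1 w h.2.symm ((hcl he.1).2 h.1))
      have h₂ : IsColimAt (f₂.comp (ψ' : Unit →o E × Q × Fin 3)) ∅ () := by
        refine h₁.congr fun d s' _ => ?_
        have hs' : Set.range ((ψ' : Unit →o E × Q × Fin 3).comp s') ∈ A₁ := by
          refine A₁.lower ?_ hA₁
          rintro _ ⟨i, rfl⟩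
          rfl
        exact (e₁ d _ hs').trans (e₃ d _ (Or.inl hs'))
      have h₃ := (isColimAt_image ψ' (f := f₂) (K := ∅) (e := ())).2 h₂
      rwa [Set.image_empty] at h₃
    · have h₃ := mem₃ h (by simp)
      exact ⟨(isInitialVertex_iff (e₄.symm.mono (LowerSet.Iic_le.2 h₃))).1 hz.1, Or.inr h₃⟩)
  -- The other elements over `L` are added by inserting closures: a map out of the value at `w`
  -- factors through the value at `R.cl w`.
  obtain ⟨f₄, hf₄, e₆⟩ := exists_extension_of_pairing (B := B₂) hC
    {x | x ∈ X₀ ∧ x.2.2 ≤ 1 ∧ R.cl x.2.1 ≠ x.2.1} (fun x => (x.1, R.cl x.2.1, x.2.2)) (by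
      rintro ⟨s, w, t⟩ ⟨h, h', h''⟩
      have ht : R.π w ≤ 1 := h.2 ▸ h'
      refine ⟨lt_of_le_of_ne ⟨le_rfl, R.le_cl w ht, le_rfl⟩ fun e => h'' ?_, fun hn => hn.2.2 ?_⟩
      · exact (congrArg (fun y : E × Q × Fin 3 => y.2.1) e).symm
      · exact R.cl_cl w ht) (by
    intro S hS hB hA
    obtain ⟨hZ, ht⟩ := hB.resolve_left hA
    obtain ⟨y₁, hy₁, hy₁'⟩ := hnew hZ fun h => hA (Or.inl h)
    refine ⟨?_, ?_⟩
    · by_contra hcon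
      refine hA (Or.inr ⟨hZ, fun y hy => ⟨ht hy, fun hyL => ?_⟩⟩)
      by_contra hcl
      exact hcon ⟨y, hy, (hZ.1 hy).resolve_right fun h => h.1 hyL, ht hy, hcl⟩
    · rintro ⟨s, w, t⟩ ⟨⟨hxS, hx₀, ht₁, hcl⟩, hmax⟩
      have htw : R.π w ≤ 1 := hx₀.2 ▸ ht₁
      have hx₀' : (s, R.cl w, t) ∈ X₀ := ⟨hx₀.1, hx₀.2.trans (R.π_cl w htw).symm⟩
      have hcomp : ∀ y ∈ S, y ∈ X₁ → (s, R.cl w, t) < y := by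
        intro y hy hy₁
        have h₁ := hL s hx₀.1 _ hy₁.1
        have hxy : (s, w, t) ≤ y := (hS.total hxS hy).resolve_right fun h => h₁.not_ge h.1
        refine lt_of_le_of_ne ⟨h₁.le, ?_, hxy.2.2⟩ fun e => h₁.ne (congrArg Prod.fst e)
        rw [show y.2.1 = R.top from hy₁.2]
        exact R.le_top _
      refine ⟨Or.inr ⟨⟨?_, ?_⟩, ?_⟩, fun y hy => ?_, ⟨y₁, hy₁, hcomp y₁ hy₁ hy₁'⟩, ?_⟩
      · exact Set.insert_subset (Or.inl hx₀') hZ.1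
      · refine Z.lower ?_ hZ.2
        rintro _ ⟨y, rfl | hy, rfl⟩
        · exact ⟨_, hxS, rfl⟩
        · exact ⟨y, hy, rfl⟩
      · exact Set.insert_subset ht₁ ht
      · rcases hS.total hy hxS with h | h
        · exact Or.inl (h.trans ⟨le_rfl, R.le_cl w htw, le_rfl⟩)
        · rcases hZ.1 hy with hy₀ | hy₁
          · by_cases hycl : R.cl y.2.1 = y.2.1
            · refine Or.inr ⟨h.1, ?_, h.2.2⟩
              have hyt : R.π y.2.1 ≤ 1 := hy₀.2 ▸ (ht hy : y.2.2 ≤ 1)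
              have := R.cl_mono w y.2.1 h.2.1 hyt
              rwa [hycl] at this
            · exact Or.inl ((hmax ⟨hy, hy₀, ht hy, hycl⟩).trans ⟨le_rfl, R.le_cl w htw, le_rfl⟩)
          · exact Or.inr (hcomp y hy hy₁).le
      · have hx' : (s, w, t) ∈ S \ {(s, R.cl w, t)} :=
          ⟨hxS, fun e => hcl (congrArg (fun y : E × Q × Fin 3 => y.2.1) e).symm⟩
        have hy₁'' : y₁ ∈ S \ {(s, R.cl w, t)} := ⟨hy₁, fun e => hX hx₀' (e ▸ hy₁')⟩
        rintro (((h | h) | h) | h)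
        · exact hX (h hy₁'') hy₁'
        · have h₁ := h.2 hx'
          refine hcl ?_
          rw [show w = R.v from h₁.2 hx₀.1]
          exact R.cl_eq _ R.π_v
        · exact hX hx₀ (h hx').1
        · exact hcl ((h.2 hx').2 hx₀.1)) hf₃
  -- The remaining simplices end on level `2` of `X₁`, where the value is a terminal object.
  obtain ⟨f₅, hf₅, e₇⟩ := exists_extension_of_terminal (B := 𝒵 ⊔ B₂) hf₄ (by
    rintro S hS hB hA ⟨s, w, t⟩ he
    have hZ := hB.resolve_right hA
    obtain ⟨y₁, hy₁, hy₁'⟩ := hnew hZ fun h => hA (Or.inl (Or.inl h))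
    have ht : t = 2 := by
      by_contra ht
      refine hA (Or.inr ⟨hZ, fun y hy => ?_⟩)
      have h₁ : y.2.2 ≤ t := (he.2 hy).2.2
      change y.2.2 ≤ 1
      omega
    subst ht
    have hX₁ : (s, w, 2) ∈ X₁ := (hZ.1 he.1).resolve_left fun h =>
      (hL s h.1 _ hy₁'.1).not_ge (he.2 hy₁).1
    have h₃ := mem₃ hX₁ (by simp)
    refine ⟨(isTerminalVertex_iff (x := z) fun d s' hs' => ?_).1 hz.2, Or.inl (Or.inl (Or.inr h₃))⟩
    have hs₃ := A₃.lower hs' h₃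
    exact ((e₄ d s' hs₃).trans ((e₅ d s' (Or.inr hs₃)).trans (e₆ d s' (Or.inl (Or.inr hs₃))))).symm)
  have e₈ : EqOn A f₂ f₅ := e₅.trans ((e₆.mono le_sup_left).trans
    (e₇.mono (le_sup_left.trans le_sup_left)))
  have hΘ₀ : ∀ x : E × Q, x.1 ∈ L → R.index L hL x = (x.1, x.2, R.π x.2) := fun x hx => by
    change (x.1, (if x.1 ∈ L then x.2 else R.top), R.π x.2) = _
    rw [if_pos hx]
  have hΘ₁ : ∀ x : E × Q, x.1 ∉ L → R.index L hL x = (x.1, R.top, R.π x.2) := fun x hx => by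
    change (x.1, (if x.1 ∈ L then x.2 else R.top), R.π x.2) = _
    rw [if_neg hx]
  have hΘ : ∀ x, R.index L hL x ∈ X₀ ∪ X₁ := by
    intro x
    by_cases hx : x.1 ∈ L
    · rw [hΘ₀ x hx]
      exact Or.inl ⟨hx, rfl⟩
    · rw [hΘ₁ x hx]
      exact Or.inr ⟨hx, rfl⟩
  have hΘZ : ∀ S ∈ cyl Q Z, R.index L hL '' S ∈ 𝒵 := by
    intro S hS
    refine ⟨?_, ?_⟩
    · rintro _ ⟨x, -, rfl⟩
      exact hΘ x
    · refine Z.lower ?_ hS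
      rintro _ ⟨_, ⟨x, hx, rfl⟩, rfl⟩
      exact ⟨x, hx, rfl⟩
  refine ⟨f₅.comp (R.index L hL), (hf₅.comp _).mono fun S hS => Or.inl (hΘZ S hS), ?_, ?_, ?_⟩
  · rintro d s ⟨-, hs⟩
    have hsL : ∀ i, (s i).1 ∈ L := fun i => hs ⟨_, ⟨i, rfl⟩, rfl⟩
    have hs₁ : Set.range ((R.index L hL).comp s) ∈ A₁ := by
      rintro _ ⟨i, rfl⟩
      change R.index L hL (s i) ∈ X₀
      rw [hΘ₀ _ (hsL i)]
      exact ⟨hsL i, rfl⟩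
    refine Eq.trans ?_ ((e₁ d _ hs₁).trans ((e₃ d _ (Or.inl hs₁)).trans
      (e₈ d _ (Or.inl (Or.inl hs₁)))))
    refine congrArg (f d) ?_
    ext i
    · rfl
    · change (s i).2 = (R.index L hL (s i)).2.1
      rw [hΘ₀ _ (hsL i)]
  · intro d s hs
    have hs₂ : Set.range ((R.index L hL).comp ((fibreHom E R.v).comp s)) ∈ A₂ := by
      refine ⟨?_, ?_⟩
      · rw [range_comp]
        refine hΘZ _ ?_
        change _ ∈ Z
        rwa [← range_comp]
      · rintro _ ⟨i, rfl⟩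
        refine ⟨R.π_v, fun h => ?_⟩
        change (R.index L hL (s i, R.v)).2.1 = R.v
        rw [hΘ₀ (s i, R.v) h]
    exact (e₂ d _ hs₂).trans ((e₃ d _ (Or.inr hs₂)).trans (e₈ d _ (Or.inl (Or.inr hs₂))))
  · intro j hj hjZ
    let κ : Fin 3 →o E × Q × Fin 3 := ⟨fun i => (j, R.top, i), fun _ _ h => ⟨le_rfl, le_rfl, h⟩⟩
    have hκ : ∀ i : Fin 3, i ≠ 1 → EqOn (LowerSet.Iic {i}) (f₅.comp κ) (PMap.const z) := by
      intro i hi d s hs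
      have h₃ : Set.range (κ.comp s) ∈ A₃ := by
        rintro _ ⟨k, rfl⟩
        have hk : s k = i := hs ⟨k, rfl⟩
        refine ⟨⟨hj, rfl⟩, ?_⟩
        change s k ≠ 1
        rwa [hk]
      exact ((e₄ d _ h₃).trans (e₈ d _ (Or.inr h₃))).symm
    refine ⟨f₅.comp κ, (hf₅.comp κ).mono fun S _ => Or.inl ⟨?_, ?_⟩, hκ 0 (by decide),
      hκ 2 (by decide), ?_⟩
    · rintro _ ⟨i, -, rfl⟩
      exact Or.inr ⟨hj, rfl⟩
    · refine Z.lower ?_ hjZ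
      rintro _ ⟨_, ⟨i, -, rfl⟩, rfl⟩
      rfl
    · rw [comp_comp, comp_comp]
      congr 1
      ext x : 2
      exact hΘ₁ (j, x) hj

lemma eqOn_eval {W : Type} [PartialOrder W] {p : (N.{u} Q ⟶ C) → Prop}
    {f g : PMap W (Diag Q p)} {A : LowerSet (Set W)} (h : EqOn A f g) :
    EqOn (cyl Q A) (eval f) (eval g) := by
  intro d s hs
  refine congrArg (fun a : (Diag Q p).obj (Opposite.op d) => Fun.val _ a.1) (h d _ ?_)
  rwa [range_comp]

lemma map_const_zero (z : C _⦋0⦌) : C.map (SimplexCategory.const ⦋0⦌ ⦋0⦌ 0).op z = z := by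
  rw [SimplexCategory.const_eq_id, op_id, Functor.map_id_apply]

lemma toHom_app_vertex {W : Type} [PartialOrder W] {t : PMap W C} (ht : t.NatOn ⊤) {w : W}
    {z : C _⦋0⦌} (h : EqOn (LowerSet.Iic {w}) t (PMap.const z)) :
    (t.toHom ht).app _ (N.vertex w) = z := by
  have := h ⦋0⦌ (OrderHom.const _ w) (by rintro _ ⟨i, rfl⟩; rfl)
  exact this.trans (map_const_zero z)

/-- The map that collapses the cone points to the first one. -/
def coneCollapse (P : Type) [Preorder P] (m : ℕ) : P ⊕ₗ Fin (m + 2) →o P ⊕ₗ Fin 1 :=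
  sumDesc ⟨Sum.inlₗ, fun _ _ h => Sum.Lex.inl_le_inl_iff.2 h⟩ (OrderHom.const _ (Sum.inrₗ 0))
    fun x _ => Sum.Lex.inl_le_inr x 0

lemma coneCollapse_coneZero (P : Type) [Preorder P] (m : ℕ) (x : P ⊕ₗ Fin 1) :
    coneCollapse P m (coneZero P m x) = x := by
  cases x using lexSum_cases with
  | inl a => rfl
  | inr b =>
    rw [Subsingleton.elim b 0]
    rfl

lemma lt_of_mem_range_coneZero {P : Type} [PartialOrder P] {m : ℕ} :
    ∀ s ∈ Set.range (coneZero P m), ∀ j ∉ Set.range (coneZero P m), s < j := by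
  rintro _ ⟨s, rfl⟩ j hj
  refine lt_of_le_of_ne ?_ fun h => hj ⟨s, h⟩
  cases j using lexSum_cases with
  | inl a => exact (hj ⟨Sum.inlₗ a, rfl⟩).elim
  | inr b =>
    cases s using lexSum_cases with
    | inl a => exact Sum.Lex.inl_le_inr _ _
    | inr c => exact Sum.Lex.inr_le_inr_iff.2 (Fin.zero_le b)

/-- The evaluation at `v` preserves colimits if the diagrams vanish on the closed elements over
`0` and include the diagrams that are coinduced at `v`. -/
theorem Coinduction.isColimit_eval (hC : HasInnerFillers C) (R : Coinduction Q)
    {p : (N.{u} Q ⟶ C) → Prop} {P : Type} [PartialOrder P] {σ : PMap (P ⊕ₗ Fin 1) (Diag Q p)}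
    (hσ : σ.NatOn ⊤) (hcol : IsColimit σ) {z : C _⦋0⦌} (hz : IsZeroVertex z)
    (hp₀ : ∀ τ, p τ → ∀ w, R.π w = 0 → R.cl w = w → IsInitialVertex (τ.app _ (N.vertex w)))
    (hp₁ : ∀ τ : N.{u} (Fin 3) ⟶ C, IsZeroVertex (τ.app _ (N.vertex 0)) →
      IsZeroVertex (τ.app _ (N.vertex 2)) → p (N.map R.π ≫ τ)) :
    IsColimit ((eval σ).comp (fibreHom (P ⊕ₗ Fin 1) R.v)) := by
  intro m g hg hgσ
  -- The auxiliary extension asks for diagrams on the whole cone. Only their restriction to the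
  -- initial part, which is `σ`, is used.
  have hσr : (σ.comp (coneCollapse P m)).NatOn ⊤ := hσ.comp_top _
  have hf : (eval (σ.comp (coneCollapse P m))).NatOn ⊤ := natOn_eval hσr
  have hev : eval (σ.comp (coneCollapse P m)) =
      (eval σ).comp ((coneCollapse P m).prodMap OrderHom.id) := rfl
  have hlift : ∀ {d : SimplexCategory} (s : Fin (d.len + 1) →o P ⊕ₗ Fin (m + 2)),
      Set.range s ∈ LowerSet.Iic (Set.range (coneZero P m)) → ∃ t, (coneZero P m).comp t = s :=
    fun s hs => exists_comp_eq (coneZeroEmb P m) hs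
  have hslice : ∀ w, ∃ τ : N.{u} Q ⟶ C, p τ ∧
      ofHom τ = (eval (σ.comp (coneCollapse P m))).comp (slice Q w) := by
    intro w
    exact exists_slice (A := ⊤) hσr (w := w) (LowerSet.mem_top)
  obtain ⟨h, hh, e₁, e₂, hj⟩ := R.exists_extension hC lt_of_mem_range_coneZero hf hg (by
      intro d s hs
      obtain ⟨t, rfl⟩ := hlift s hs
      refine (congrFun (congrFun hgσ d) t).trans ?_
      rw [hev]
      refine congrArg (eval σ d) ?_
      ext i : 2
      exact Prod.ext (coneCollapse_coneZero P m (t i)).symm rfl) hz (by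
      intro s _ w hw hcl
      obtain ⟨τ, hτ, e⟩ := hslice s
      refine (isInitialVertex_iff fun d s' hs' => ?_).1 (hp₀ τ hτ w hw hcl)
      have hs : s' = (slice Q s).comp (OrderHom.const _ w) := by
        ext i : 2
        exact hs' ⟨i, rfl⟩
      rw [hs]
      refine (congrFun (congrFun e d) (OrderHom.const _ w)).symm.trans ?_
      exact eqOn_const_vertex τ w d _ (by rintro _ ⟨i, rfl⟩; rfl))
  -- The diagrams over the old vertices are those of `σ`, and the new ones are coinduced, so all are
  -- allowed. In this way a lifting problem for the values at `v` becomes one for the diagrams.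
  obtain ⟨k, hk, hkh⟩ := exists_eval_eq hh (σ ⦋0⦌ (OrderHom.const _ (Sum.inrₗ 0))) fun w hw => by
    by_cases hwL : w ∈ Set.range (coneZero P m)
    · obtain ⟨τ, hτ, e⟩ := hslice w
      refine ⟨τ, hτ, e.trans ?_⟩
      funext d s
      refine e₁ d _ ⟨?_, ?_⟩
      · refine (coneBdry P m).lower ?_ hw
        rintro _ ⟨_, ⟨i, rfl⟩, rfl⟩
        rfl
      · rintro _ ⟨_, ⟨i, rfl⟩, rfl⟩
        exact hwL
    · obtain ⟨t, ht, t₀, t₂, e⟩ := hj w hwL hw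
      refine ⟨N.map R.π ≫ t.toHom ht, hp₁ _ ?_ ?_, e.symm⟩
      · rwa [toHom_app_vertex ht t₀]
      · rwa [toHom_app_vertex ht t₂]
  have hkσ : k.comp (coneZero P m) = σ := by
    have : EqOn ⊤ (k.comp (coneZero P m)) σ := by
      refine eqOn_of_eval ((hk.comp _).mono fun S _ => ?_) hσ ?_
      · exact mem_coneBdry.2 ⟨1, by
          rintro ⟨x, -, hx⟩
          cases x using lexSum_cases with
          | inl a => cases congrArg ofLex hx
          | inr b =>
            have := Sum.inr_injective (congrArg ofLex hx)
            simp at this⟩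
      · intro d s _
        have hs : Set.range (((coneZero P m).prodMap OrderHom.id).comp s) ∈
            cyl Q (coneBdry P m) ⊓ cyl Q (LowerSet.Iic (Set.range (coneZero P m))) := by
          refine ⟨?_, ?_⟩
          · change _ ∈ coneBdry P m
            rw [← range_comp]
            exact range_coneZero_comp_mem (OrderHom.fst.comp s)
          · rintro _ ⟨_, ⟨i, rfl⟩, rfl⟩
            exact ⟨(s i).1, rfl⟩
        refine (hkh d _ hs.1).trans ((e₁ d _ hs).symm.trans ?_)
        rw [hev]
        refine congrArg (eval σ d) ?_
        ext i : 2
        exact Prod.ext (coneCollapse_coneZero P m (s i).1) rfl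
    funext d s
    exact this d s trivial
  -- The colimit property of `σ` solves the lifting problem of diagrams, and evaluation at `v`
  -- solves the original one.
  obtain ⟨K, hK, hkK⟩ := hcol m k hk hkσ
  refine ⟨(eval K).comp (fibreHom _ R.v), (natOn_eval hK).comp_top _, e₂.trans ?_⟩
  intro d s hs
  have hs' : Set.range ((fibreHom (P ⊕ₗ Fin (m + 2)) R.v).comp s) ∈ cyl Q (coneBdry P m) := by
    change _ ∈ coneBdry P m
    rwa [← range_comp]
  exact (hkh d _ hs').symm.trans (eqOn_eval hkK d _ hs')

end

end PMap

end ExInf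

end

noncomputable section

set_option linter.unusedSectionVars false

namespace ExInf

open PMap

/-! ### The functors coinduced from a vertex without coordinate `01` -/

/-- The element `12` or `02` of `T_2`. -/
def T.hi (b : Bool) : T 2 := if b then ⟨(1, 2), by decide⟩ else ⟨(0, 2), by decide⟩

/-- The element `02` below `12`, or the element `01` below `02`. -/
def T.lo (b : Bool) : T 2 := if b then ⟨(0, 2), by decide⟩ else ⟨(0, 1), by decide⟩

/-- The diagonal element `11` below `12`, or the diagonal element `00` below `02`. -/
def T.di (b : Bool) : T 2 := if b then ⟨(1, 1), by decide⟩ else ⟨(0, 0), by decide⟩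

instance : DecidableLE (T 2) := fun x y => inferInstanceAs (Decidable (x.1 ≤ y.1))

lemma T.lo_le_hi : ∀ b, T.lo b ≤ T.hi b := by decide

lemma T.di_le_hi : ∀ b, T.di b ≤ T.hi b := by decide

lemma T.not_lo_le_di : ∀ b, ¬ T.lo b ≤ T.di b := by decide

/-- The elements below `T.hi b` outside the interval have the diagonal element `T.di b` as their
largest one. It serves as their closure, and allowed diagrams vanish there. -/
lemma T.le_di : ∀ b x, x ≤ T.hi b → ¬ T.lo b ≤ x → x ≤ T.di b := by decide

lemma T.di_fst_eq_snd : ∀ b, (T.di b).1.1 = (T.di b).1.2 := by decide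

lemma T.fst_ne_snd : ∀ b x, x ≤ T.hi b → T.lo b ≤ x → x.1.1 ≠ x.1.2 := by decide

section

variable {n : ℕ} (b : Fin n → Bool)

open Classical in
/-- The map that sends the interval between the elements `lo` and `hi` to `1`, the other elements
below `hi` to `0` and the elements not below `hi` to `2`. -/
def boxHom : (Fin n → T 2) →o Fin 3 where
  toFun w := if ∀ i, w i ≤ T.hi (b i) then if ∀ i, T.lo (b i) ≤ w i then 1 else 0 else 2
  monotone' := by
    intro w w' h
    dsimp only
    by_cases h₁ : ∀ i, w' i ≤ T.hi (b i)
    · have h₂ : ∀ i, w i ≤ T.hi (b i) := fun i => (h i).trans (h₁ i)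
      rw [if_pos h₁, if_pos h₂]
      by_cases h₃ : ∀ i, T.lo (b i) ≤ w i
      · rw [if_pos h₃, if_pos fun i => (h₃ i).trans (h i)]
      · rw [if_neg h₃]
        exact Fin.zero_le _
    · rw [if_neg h₁]
      exact Fin.le_last _

variable {b} {w w' : Fin n → T 2}

lemma boxHom_eq_one_iff :
    boxHom b w = 1 ↔ (∀ i, w i ≤ T.hi (b i)) ∧ ∀ i, T.lo (b i) ≤ w i := by
  classical
  change (if ∀ i, w i ≤ T.hi (b i) then if ∀ i, T.lo (b i) ≤ w i then (1 : Fin 3) else 0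
    else 2) = 1 ↔ _
  split_ifs <;> simp_all

lemma boxHom_eq_two_iff : boxHom b w = 2 ↔ ¬ ∀ i, w i ≤ T.hi (b i) := by
  classical
  change (if ∀ i, w i ≤ T.hi (b i) then if ∀ i, T.lo (b i) ≤ w i then (1 : Fin 3) else 0
    else 2) = 2 ↔ _
  split_ifs <;> simp_all

lemma boxHom_le_one_iff : boxHom b w ≤ 1 ↔ ∀ i, w i ≤ T.hi (b i) := by
  rw [← not_iff_not, ← boxHom_eq_two_iff]
  omega

lemma boxHom_congr (h₁ : (∀ i, w i ≤ T.hi (b i)) ↔ ∀ i, w' i ≤ T.hi (b i))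
    (h₂ : (∀ i, T.lo (b i) ≤ w i) ↔ ∀ i, T.lo (b i) ≤ w' i) : boxHom b w = boxHom b w' := by
  have h₃ := boxHom_eq_one_iff (b := b) (w := w)
  rw [h₁, h₂, ← boxHom_eq_one_iff] at h₃
  have h₄ := boxHom_eq_two_iff (b := b) (w := w)
  rw [h₁, ← boxHom_eq_two_iff] at h₄
  omega

variable (b)

/-- The closure operator and the map to `[2]` given by the intervals between `lo` and `hi`. -/
def boxCoinduction : Coinduction (Fin n → T 2) where
  π := boxHom b
  cl w i := if T.lo (b i) ≤ w i then T.hi (b i) else T.di (b i)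
  v i := T.hi (b i)
  top _ := ⟨(2, 2), le_rfl⟩
  le_top w i := ⟨Fin.le_last _, Fin.le_last _⟩
  π_v := boxHom_eq_one_iff.2 ⟨fun _ => le_rfl, fun i => T.lo_le_hi _⟩
  le_cl w hw i := by
    dsimp only
    split_ifs with h
    · exact boxHom_le_one_iff.1 hw i
    · exact T.le_di _ _ (boxHom_le_one_iff.1 hw i) h
  π_cl w hw := by
    refine boxHom_congr (iff_of_true (fun i => ?_) (boxHom_le_one_iff.1 hw))
      (forall_congr' fun i => ?_)
    · split_ifs
      · exact le_rfl
      · exact T.di_le_hi _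
    · split_ifs with h
      · exact iff_of_true (T.lo_le_hi _) h
      · exact iff_of_false (T.not_lo_le_di _) h
  cl_mono w w' h hw i := by
    dsimp only
    split_ifs with h₁ h₂ h₂
    · exact le_rfl
    · exact (h₂ (h₁.trans (h i))).elim
    · exact T.di_le_hi _
    · exact le_rfl
  cl_cl w hw := by
    funext i
    dsimp only
    split_ifs with h₁ h₂ h₂
    · rfl
    · exact (h₂ (T.lo_le_hi _)).elim
    · exact (T.not_lo_le_di _ h₂).elim
    · rfl
  cl_eq w hw := by
    funext i
    exact if_pos ((boxHom_eq_one_iff.1 hw).2 i)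

end

section

variable {X : Triple.{u}} {n : ℕ} (b : Fin n → Bool)

lemma edge_mem_cof_of_eq {W : Type} [PartialOrder W] (hX : IsExact X) (σ : N.{u} W ⟶ X.carrier)
    {x y : W} (h : x ≤ y) (hxy : x = y ∨ IsZeroVertex (σ.app _ (N.vertex x))) :
    σ.app _ (N.edge h) ∈ X.cof := by
  rcases hxy with rfl | hx
  · exact edge_self_mem_cof σ hX h
  · exact edge_mem_cof σ hX h hx

lemma edge_mem_fib_of_eq {W : Type} [PartialOrder W] (hX : IsExact X) (σ : N.{u} W ⟶ X.carrier)
    {x y : W} (h : x ≤ y) (hxy : x = y ∨ IsZeroVertex (σ.app _ (N.vertex y))) :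
    σ.app _ (N.edge h) ∈ X.fib := by
  rcases hxy with rfl | hx
  · exact edge_self_mem_fib σ hX h
  · exact edge_mem_fib σ hX h hx

lemma forall_update_iff {ι α : Type} [DecidableEq ι] {v : ι → α} {r : ι} {x y : α}
    {q : ι → α → Prop} (h : q r x ↔ q r y) :
    (∀ i, q i (Function.update v r x i)) ↔ ∀ i, q i (Function.update v r y i) := by
  refine forall_congr' fun i => ?_
  rcases eq_or_ne i r with rfl | hi
  · simpa using h
  · simp [hi]

lemma boxHom_update (v : Fin n → T 2) (r : Fin n) {x y : T 2}
    (h : (x ≤ T.hi (b r) ↔ y ≤ T.hi (b r)) ∧ (T.lo (b r) ≤ x ↔ T.lo (b r) ≤ y)) :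
    boxHom b (T.insert v r x) = boxHom b (T.insert v r y) :=
  boxHom_congr (forall_update_iff (q := fun i x => x ≤ T.hi (b i)) h.1)
    (forall_update_iff (q := fun i x => T.lo (b i) ≤ x) h.2)

/-- In the square on `01`, `02`, `11`, `12` the interval is either the upper row or the right
column, so a coinduced diagram is constant in one direction; the other squares are degenerate. This
makes the squares of coinduced diagrams cocartesian. -/
lemma T.square_cases : ∀ (b : Bool) (p q : Fin 3) (h : p ≤ q),
    (∀ a c c', (T.square p q h (a, c) ≤ T.hi b ↔ T.square p q h (a, c') ≤ T.hi b) ∧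
      (T.lo b ≤ T.square p q h (a, c) ↔ T.lo b ≤ T.square p q h (a, c'))) ∨
    (∀ a a' c, (T.square p q h (a, c) ≤ T.hi b ↔ T.square p q h (a', c) ≤ T.hi b) ∧
      (T.lo b ≤ T.square p q h (a, c) ↔ T.lo b ≤ T.square p q h (a', c))) := by
  decide

/-- A row never leaves the interval, so the row maps of a coinduced diagram are identities or start
at a zero object. -/
lemma T.row_mem : ∀ (b : Bool) (a j j' : Fin 3) (h : a ≤ j) (h' : j ≤ j'),
    T.mk a j h ≤ T.hi b → T.lo b ≤ T.mk a j h →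
      T.mk a j' (h.trans h') ≤ T.hi b ∧ T.lo b ≤ T.mk a j' (h.trans h') := by
  decide

/-- Dually, a column never enters the interval from outside, so the column maps are identities or
end at a zero object. -/
lemma T.column_mem : ∀ (b : Bool) (i i' a : Fin 3) (h : i ≤ i') (h' : i' ≤ a),
    T.mk i' a h' ≤ T.hi b → T.lo b ≤ T.mk i' a h' →
      T.mk i a (h.trans h') ≤ T.hi b ∧ T.lo b ≤ T.mk i a (h.trans h') := by
  decide

/-- The coinduced diagrams are allowed. -/
lemma isExDiagram_box (hX : IsExact X) (τ : N.{u} (Fin 3) ⟶ X.carrier)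
    (h₀ : IsZeroVertex (τ.app _ (N.vertex 0))) (h₂ : IsZeroVertex (τ.app _ (N.vertex 2))) :
    IsExDiagram X 2 n (N.map (boxHom b) ≫ τ) where
  zero v i hi := by
    rw [N.map_comp_app_vertex]
    have h₁ : boxHom b v ≠ 1 := fun h =>
      T.fst_ne_snd _ _ ((boxHom_eq_one_iff.1 h).1 i) ((boxHom_eq_one_iff.1 h).2 i) hi
    have : boxHom b v = 0 ∨ boxHom b v = 2 := by omega
    rcases this with h | h <;> rw [h] <;> assumption
  horizontal v s a j j' h h' := by
    rw [N.map_comp_app_edge]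
    refine edge_mem_cof_of_eq hX τ _ ?_
    have hle := (boxHom b).monotone ((T.insert v s).monotone
      (T.mk_le (h := h) (h' := h.trans h') le_rfl h'))
    generalize hx : boxHom b (T.insert v s (T.mk a j h)) = x at hle ⊢
    rcases (by omega : x = 0 ∨ x = 1 ∨ x = 2) with rfl | rfl | rfl
    · exact Or.inr h₀
    · obtain ⟨h₃, h₄⟩ := boxHom_eq_one_iff.1 hx
      have h₃ := h₃ s
      have h₄ := h₄ s
      rw [show T.insert v s (T.mk a j h) s = T.mk a j h from Function.update_self ..] at h₃ h₄
      have h₅ := T.row_mem _ _ _ _ h h' h₃ h₄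
      exact Or.inl (hx.symm.trans
        (boxHom_update b v s ⟨iff_of_true h₃ h₅.1, iff_of_true h₄ h₅.2⟩))
    · exact Or.inl (le_antisymm hle (Fin.le_last _))
  vertical v t i i' a h h' := by
    rw [N.map_comp_app_edge]
    refine edge_mem_fib_of_eq hX τ _ ?_
    have hle := (boxHom b).monotone ((T.insert v t).monotone
      (T.mk_le (h := h.trans h') (h' := h') h le_rfl))
    generalize hx : boxHom b (T.insert v t (T.mk i' a h')) = x at hle ⊢
    rcases (by omega : x = 0 ∨ x = 1 ∨ x = 2) with rfl | rfl | rfl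
    · exact Or.inl (le_antisymm hle (Fin.zero_le _))
    · obtain ⟨h₃, h₄⟩ := boxHom_eq_one_iff.1 hx
      have h₃ := h₃ t
      have h₄ := h₄ t
      rw [show T.insert v t (T.mk i' a h') t = T.mk i' a h' from Function.update_self ..]
        at h₃ h₄
      have h₅ := T.column_mem _ _ _ _ h h' h₃ h₄
      exact Or.inl ((boxHom_update b v t ⟨iff_of_true h₅.1 h₃, iff_of_true h₅.2 h₄⟩).trans hx)
    · exact Or.inr h₂
  cocartesian v r p q h := by
    rcases T.square_cases (b r) p q h with H | H
    · exact isCocartesian_of_rows hX.hasInnerFillers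
        ((boxHom b).comp ((T.insert v r).comp (T.square p q h)))
        (fun a c c' => boxHom_update b v r (H a c c')) τ
    · exact isCocartesian_of_columns hX.hasInnerFillers
        ((boxHom b).comp ((T.insert v r).comp (T.square p q h)))
        (fun a a' c => boxHom_update b v r (H a a' c)) τ

end

end ExInf

end

noncomputable section

set_option linter.unusedSectionVars false

namespace ExInf

open PMap

/-! ### Squares of diagrams -/

section

variable {C : SSet.{u}} {W V Q : Type} [PartialOrder W] [PartialOrder V] [PartialOrder Q]
  {p : (N.{u} Q ⟶ C) → Prop}

lemma PMap.isLimAt_image (ψ : V ↪o W) {f : PMap W C} {K : Set V} {e : V} :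
    IsLimAt f (ψ '' K) (ψ e) ↔ IsLimAt (f.comp (ψ : V →o W)) K e :=
  isColimAt_image (ψ.dual) (f := f.op) (K := OrderDual.ofDual ⁻¹' K) (e := OrderDual.toDual e)

lemma isCartesian_of_isLimAt {f : PMap W C} (ψ : Fin 2 × Fin 2 ↪o W) (σ : Square C)
    (hσ : ofHom σ = f.comp (ψ : Fin 2 × Fin 2 →o W)) :
    IsCartesian σ ↔ IsLimAt f (ψ '' {(0, 0)}ᶜ) (ψ (0, 0)) := by
  rw [isLimAt_image, isCartesian_iff, hσ]

/-- The evaluation of diagrams at an element. -/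
def PMap.Diag.ev (p : (N.{u} Q ⟶ C) → Prop) (q : Q) : Diag Q p ⟶ C :=
  (fullSub (Fun (N.{u} Q) C) fun F => p (Fun.toHom F)).ι ≫ Fun.evalAt (N.vertex q)

lemma ofHom_comp_ev (σ : N.{u} W ⟶ Diag Q p) (q : Q) :
    ofHom (σ ≫ Diag.ev p q) = (eval (ofHom σ)).comp (fibreHom W q) := rfl

/-- A pointwise cocartesian square is cocartesian. -/
lemma isCocartesian_of_ev (hC : HasInnerFillers C) (σ : Square (Diag Q p))
    (h : ∀ q, IsCocartesian (σ ≫ Diag.ev p q)) : IsCocartesian σ := by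
  refine (isColimitCocone_iff _).2 (isColimit_of_eval hC fun q => ?_)
  exact (isColimitCocone_iff _).1 (h q)

/-- The diagram at a vertex of a family of diagrams. -/
def PMap.Diag.at (γ : N.{u} W ⟶ Diag Q p) (w : W) : N.{u} Q ⟶ C :=
  Fun.toHom (γ.app _ (N.vertex w)).1

lemma Diag.prop_at (γ : N.{u} W ⟶ Diag Q p) (w : W) : p (Diag.at γ w) := by
  have := (γ.app _ (N.vertex w)).2 (𝟙 _)
  rwa [op_id, Functor.map_id_apply] at this

lemma ofHom_at (γ : N.{u} W ⟶ Diag Q p) (w : W) :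
    ofHom (Diag.at γ w) = (eval (ofHom γ)).comp (slice Q w) := by
  funext d t
  have := natOn_ofHom γ ⊤ ⦋0⦌ (OrderHom.const _ w) trivial d (SimplexCategory.const d ⦋0⦌ 0)
  exact congrArg (Fun.val _) (congrArg Subtype.val this)

lemma ev_app_vertex (γ : N.{u} W ⟶ Diag Q p) (w : W) (q : Q) :
    (γ ≫ Diag.ev p q).app _ (N.vertex w) = (Diag.at γ w).app _ (N.vertex q) := by
  have h := congrFun (congrFun (ofHom_at γ w) ⦋0⦌) (OrderHom.const _ q)
  exact h.symm

end

/-! ### Cocartesian squares of allowed diagrams are pointwise cocartesian. -/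

section

variable {X : Triple.{u}} {n : ℕ}

/-- The allowed diagrams. -/
abbrev ExDiag (X : Triple.{u}) (n : ℕ) : SSet.{u} := Diag (Fin n → T 2) (IsExDiagram X 2 n)

/-- The evaluation of allowed diagrams. -/
abbrev ExDiag.ev (X : Triple.{u}) {n : ℕ} (v : Fin n → T 2) : ExDiag X n ⟶ X.carrier :=
  Diag.ev (IsExDiagram X 2 n) v

/-- Evaluation at a vertex with all coordinates `02` or `12` preserves colimits by coinduction from
the box below that vertex. -/
lemma isCocartesian_ev_box (hX : IsExact X) (b : Fin n → Bool) (σ : Square (ExDiag X n))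
    (hσ : IsCocartesian σ) : IsCocartesian (σ ≫ ExDiag.ev X fun i => T.hi (b i)) := by
  obtain ⟨z, hz⟩ := hX.additive.exists_zero
  refine (isColimitCocone_iff _).2 ?_
  refine (boxCoinduction b).isColimit_eval hX.hasInnerFillers
    (natOn_ofHom (N.map spanCocone ≫ σ) ⊤) ((isColimitCocone_iff _).1 hσ) hz ?_
    (isExDiagram_box b hX)
  intro τ hτ w hw hcl
  -- An element over `0` lies outside the box, so some coordinate is outside its interval. Being
  -- closed, that coordinate is diagonal, and allowed diagrams vanish there.
  have h₁ : ∃ i, ¬ T.lo (b i) ≤ w i := by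
    by_contra! h
    have : boxHom b w = 1 := boxHom_eq_one_iff.2
      ⟨boxHom_le_one_iff.1 ((show boxHom b w = 0 from hw).le.trans (by decide)), h⟩
    rw [show boxHom b w = 0 from hw] at this
    exact absurd this (by decide)
  obtain ⟨i, hi⟩ := h₁
  refine (hτ.zero w i ?_).1
  have h₂ : (if T.lo (b i) ≤ w i then T.hi (b i) else T.di (b i)) = w i := congrFun hcl i
  rw [if_neg hi] at h₂
  rw [← h₂]
  exact T.di_fst_eq_snd _

/-- The square `01`, `02`, `11`, `12` in one coordinate. -/
abbrev T.main : Fin 2 × Fin 2 →o T 2 := T.square 1 2 (by decide)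

lemma T.eq_of_ne : ∀ x : T 2, x.1.1 ≠ x.1.2 → x ≠ T.main (0, 0) → ∃ b, x = T.hi b := by
  decide

lemma T.main_ne : ∀ x, x ≠ (0, 0) → T.main x ≠ T.main (0, 0) := by
  decide

/-- A cocartesian square of allowed diagrams is pointwise cocartesian if it is pointwise a
square as in the axioms of exact quasi-categories. -/
lemma isCocartesian_ev (hX : IsExact X) (σ : Square (ExDiag X n)) (hσ : IsCocartesian σ)
    (h₀ : ∀ v, IsZeroVertex (Square.lowerLeft (σ ≫ ExDiag.ev X v)))
    (h₁ : ∀ v, Square.top (σ ≫ ExDiag.ev X v) ∈ X.cof) (h₂ : ∀ v, Square.right (σ ≫ ExDiag.ev X v) ∈ X.fib)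
    (v : Fin n → T 2) : IsCocartesian (σ ≫ ExDiag.ev X v) := by
  have hzero : ∀ (v : Fin n → T 2) (i : Fin n), (v i).1.1 = (v i).1.2 → ∀ x,
      IsZeroVertex ((σ ≫ ExDiag.ev X v).app _ (N.vertex x)) := by
    intro v i hi x
    rw [ev_app_vertex]
    exact (Diag.prop_at σ x).zero v i hi
  -- The induction is on the number of coordinates equal to `01`, which is `T.main (0, 0)`.
  induction hk : (Finset.univ.filter fun i => v i = T.main (0, 0)).card using
    Nat.strong_induction_on generalizing v with
  | _ k ih =>
    subst hk
    by_cases hd : ∃ i, (v i).1.1 = (v i).1.2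
    · obtain ⟨i, hi⟩ := hd
      exact isCocartesian_of_initial _ fun x => (hzero v i hi x).1
    push Not at hd
    by_cases hv : ∃ i, v i = T.main (0, 0)
    · obtain ⟨i, hi⟩ := hv
      -- The coordinate `01` is embedded in the square `01`, `02`, `11`, `12`, and the four squares
      -- at `q x` form a diagram of shape square times square.
      let q : Fin 2 × Fin 2 →o (Fin n → T 2) := (T.insert v i).comp T.main
      have hq : q (0, 0) = v := by
        change Function.update v i (T.main (0, 0)) = v
        rw [← hi, Function.update_eq_self]
      have hrow : ∀ x, x ≠ (0, 0) → IsCartesian (σ ≫ ExDiag.ev X (q x)) := by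
        intro x hx
        by_cases hx' : (T.main x).1.1 = (T.main x).1.2
        · refine isCartesian_of_terminal _ fun y => (hzero (q x) i ?_ y).2
          change (Function.update v i (T.main x) i).1.1 = (Function.update v i (T.main x) i).1.2
          rwa [Function.update_self]
        -- With `02` or `12` in place of `01` the square is cocartesian by induction, hence
        -- Cartesian by (E3).
        · refine (hX.of_cocartesian _ (h₀ _) (h₁ _) (ih _ ?_ (q x) rfl)).2
          refine Finset.card_lt_card ⟨fun j hj => ?_, fun h => ?_⟩
          · have hj' : Function.update v i (T.main x) j = T.main (0, 0) :=
              (Finset.mem_filter.1 hj).2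
            rcases eq_or_ne j i with rfl | hji
            · exact Finset.mem_filter.2 ⟨Finset.mem_univ _, hi⟩
            · rw [Function.update_of_ne hji] at hj'
              exact Finset.mem_filter.2 ⟨Finset.mem_univ _, hj'⟩
          · have hi' : Function.update v i (T.main x) i = T.main (0, 0) :=
              (Finset.mem_filter.1 (h (Finset.mem_filter.2 ⟨Finset.mem_univ i, hi⟩))).2
            rw [Function.update_self] at hi'
            exact T.main_ne x hx hi'
      let f : PMap ((Fin 2 × Fin 2) × (Fin 2 × Fin 2)) X.carrier :=
        (eval (ofHom σ)).comp (OrderHom.snd.prod (q.comp OrderHom.fst))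
      have hf : f.NatOn ⊤ := (natOn_eval (natOn_ofHom σ ⊤)).comp_top _
      have hpos : ∀ x : Fin 2 × Fin 2, x ≠ (0, 0) → (0, 0) < x := fun x hx =>
        lt_of_le_of_ne ⟨Fin.zero_le _, Fin.zero_le _⟩ hx.symm
      have hrow' : ∀ x, IsCartesian (σ ≫ ExDiag.ev X (q x)) ↔
          IsLimAt f ({x} ×ˢ {(0, 0)}ᶜ) (x, (0, 0)) := by
        intro x
        let ψ : Fin 2 × Fin 2 ↪o (Fin 2 × Fin 2) × (Fin 2 × Fin 2) :=
          OrderEmbedding.ofMapLEIff (fun y => (x, y)) fun _ _ => by simp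
        have := isCartesian_of_isLimAt (f := f) ψ (σ ≫ ExDiag.ev X (q x)) rfl
        rwa [show ψ '' {(0, 0)}ᶜ = {x} ×ˢ {(0, 0)}ᶜ by rw [Set.singleton_prod]; rfl] at this
      -- For each corner of `σ`, the square of its diagram in the coordinate `i` is cocartesian with
      -- lower left corner `11`, hence Cartesian by (E3). So the value at `01` is a fibre.
      have hcol : ∀ y, IsLimAt f ({(0, 0)}ᶜ ×ˢ {y}) ((0, 0), y) := by
        intro y
        let ψ : Fin 2 × Fin 2 ↪o (Fin 2 × Fin 2) × (Fin 2 × Fin 2) :=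
          OrderEmbedding.ofMapLEIff (fun x => (x, y)) fun _ _ => by simp
        have hψ := isCartesian_of_isLimAt (f := f) ψ (N.map q ≫ Diag.at σ y) (by
          rw [ofHom_comp, ofHom_at]
          rfl)
        rw [show ψ '' {(0, 0)}ᶜ = {(0, 0)}ᶜ ×ˢ {y} by rw [Set.prod_singleton]; rfl] at hψ
        have hy := Diag.prop_at σ y
        refine hψ.1 (hX.of_cocartesian _ ?_ ?_ (hy.cocartesian v i _)).2
        · rw [Square.lowerLeft, N.map_comp_app_vertex]
          refine hy.zero _ i ?_
          change (Function.update v i (T.main (1, 0)) i).1.1 =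
            (Function.update v i (T.main (1, 0)) i).1.2
          rw [Function.update_self]
          rfl
        · rw [Square.top, N.map_comp_app_edge]
          exact hy.horizontal v i (a := 0) (j := 1) (j' := 2) (by decide) (by decide)
      -- Limits commute with limits, so the square at `v` is Cartesian; (E3) then turns it into a
      -- cocartesian one.
      have := (hrow' (0, 0)).2 (isLimAt_first_row hX.hasInnerFillers hf hpos hpos hcol
        fun x hx => (hrow' x).1 (hrow x hx))
      rw [hq] at this
      exact (hX.of_cartesian _ (h₀ v) (h₂ v) this).2
    · push Not at hv
      choose b hb using fun i => T.eq_of_ne (v i) (hd i) (hv i)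
      rw [show v = fun i => T.hi (b i) from funext hb]
      exact isCocartesian_ev_box hX b σ hσ

end

end ExInf

end

noncomputable section

set_option linter.unusedSectionVars false

namespace ExInf

open PMap

/-! ### Diagrams of diagrams -/

section

variable {n k : ℕ}

/-- The element of `T_n ^ (k + 1)` with given first and remaining coordinates. -/
def T.cons (n k : ℕ) : (Fin 1 → T n) × (Fin k → T n) →o (Fin (k + 1) → T n) where
  toFun x := Fin.cons (x.1 0) x.2
  monotone' x y h i := by
    refine Fin.cases ?_ (fun i => ?_) i
    · exact h.1 0
    · exact h.2 i

lemma T.cons_head_tail (w : Fin (k + 1) → T n) : T.cons n k (T.head n k w, T.tail n k w) = w :=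
  Fin.cons_self_tail w

lemma T.head_cons (x : (Fin 1 → T n) × (Fin k → T n)) : T.head n k (T.cons n k x) = x.1 := by
  funext i
  rw [Subsingleton.elim i 0]
  rfl

/-- Fixing the first coordinate. -/
abbrev T.consLeft (x : Fin 1 → T n) : (Fin k → T n) →o (Fin (k + 1) → T n) :=
  (T.cons n k).comp (slice _ x)

/-- Fixing the remaining coordinates. -/
abbrev T.consRight (v : Fin k → T n) : (Fin 1 → T n) →o (Fin (k + 1) → T n) :=
  (T.cons n k).comp (fibreHom _ v)

lemma T.consLeft_comp_insert (x : Fin 1 → T n) (v : Fin k → T n) (r : Fin k) :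
    (T.consLeft x).comp (T.insert v r) = T.insert (T.cons n k (x, v)) r.succ := by
  ext t : 2
  exact Fin.cons_update (α := fun _ => T n) (x 0) v r t

lemma T.consRight_comp_insert (x : Fin 1 → T n) (v : Fin k → T n) (r : Fin 1) :
    (T.consRight v).comp (T.insert x r) = T.insert (T.cons n k (x, v)) 0 := by
  ext t : 2
  obtain rfl : r = 0 := Subsingleton.elim _ _
  have h : Function.update x 0 t 0 = t := Function.update_self (β := fun _ => T n) 0 t x
  refine Eq.trans ?_ (Fin.update_cons_zero (α := fun _ => T n) (x 0) v t).symm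
  exact congrArg (fun y => Fin.cons (α := fun _ => T n) y v) h

lemma N.app_edge_congr {C : SSet.{u}} {V W : Type} [PartialOrder V] [PartialOrder W]
    (τ : N.{u} W ⟶ C) {f g : V →o W} (h : f = g) {x y : V} (hxy : x ≤ y) :
    τ.app _ (N.edge (f.monotone hxy)) = τ.app _ (N.edge (g.monotone hxy)) := by
  rw [h]

variable {X : Triple.{u}} {τ : N.{u} (Fin (k + 1) → T n) ⟶ X.carrier}

lemma IsExDiagram.consLeft (hτ : IsExDiagram X n (k + 1) τ) (x : Fin 1 → T n) :
    IsExDiagram X n k (N.map (T.consLeft x) ≫ τ) where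
  zero v i hi := by
    rw [N.map_comp_app_vertex]
    exact hτ.zero _ i.succ hi
  horizontal v s a j j' h h' := by
    rw [N.map_comp_app_edge]
    have := hτ.horizontal (T.cons n k (x, v)) s.succ h h'
    rwa [← N.app_edge_congr τ (T.consLeft_comp_insert x v s)
      (T.mk_le (h := h) (h' := h.trans h') le_rfl h')] at this
  vertical v t i i' a h h' := by
    rw [N.map_comp_app_edge]
    have := hτ.vertical (T.cons n k (x, v)) t.succ h h'
    rwa [← N.app_edge_congr τ (T.consLeft_comp_insert x v t)
      (T.mk_le (h := h.trans h') (h' := h') h le_rfl)] at this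
  cocartesian v r p q h := by
    have := hτ.cocartesian (T.cons n k (x, v)) r.succ h
    rwa [← T.consLeft_comp_insert] at this

end

section

variable {k : ℕ} {X : Triple.{u}} {τ : N.{u} (Fin (k + 1) → T 2) ⟶ X.carrier}
  {γ : N.{u} (Fin 1 → T 2) ⟶ ExDiag X k}

lemma comp_ev_eq (h : eval (ofHom γ) = (ofHom τ).comp (T.cons 2 k)) (v : Fin k → T 2) :
    γ ≫ ExDiag.ev X v = N.map (T.consRight v) ≫ τ := by
  apply ofHom_injective
  rw [ofHom_comp_ev, h]
  rfl

lemma at_eq (h : eval (ofHom γ) = (ofHom τ).comp (T.cons 2 k)) (x : Fin 1 → T 2) :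
    Diag.at γ x = N.map (T.consLeft x) ≫ τ := by
  apply ofHom_injective
  rw [ofHom_at, h]
  rfl

lemma app_vertex_at (h : eval (ofHom γ) = (ofHom τ).comp (T.cons 2 k)) (x : Fin 1 → T 2)
    (v : Fin k → T 2) :
    (Diag.at γ x).app _ (N.vertex v) = τ.app _ (N.vertex (T.cons 2 k (x, v))) := by
  rw [at_eq h, N.map_comp_app_vertex]
  rfl

lemma square_comp_ev (h : eval (ofHom γ) = (ofHom τ).comp (T.cons 2 k)) (x : Fin 1 → T 2)
    (r : Fin 1) {p q : Fin 3} (hpq : p ≤ q) (v : Fin k → T 2) :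
    (N.map ((T.insert x r).comp (T.square p q hpq)) ≫ γ) ≫ ExDiag.ev X v =
      N.map ((T.insert (T.cons 2 k (x, v)) 0).comp (T.square p q hpq)) ≫ τ := by
  rw [Category.assoc, comp_ev_eq h, ← T.consRight_comp_insert x v r]
  rfl

lemma T.square_cases' : ∀ (p q : Fin 3) (h : p ≤ q),
    (∀ a c c', T.square p q h (a, c) = T.square p q h (a, c')) ∨
    (∀ a a' c, T.square p q h (a, c) = T.square p q h (a', c)) ∨ (p = 1 ∧ q = 2) := by
  decide

/-- There is a pointwise zero diagram. -/
lemma exists_zero_diagram (hX : IsExact X) (c : (ExDiag X k) _⦋0⦌) :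
    ∃ y : (ExDiag X k) _⦋0⦌, ∀ v, IsZeroVertex ((Fun.toHom y.1).app _ (N.vertex v)) := by
  obtain ⟨z, hz⟩ := hX.additive.exists_zero
  have hz' : ∀ i : Fin 3, IsZeroVertex
      ((SSet.const z : N.{u} (Fin 3) ⟶ X.carrier).app _ (N.vertex i)) := fun i =>
    (congrArg IsZeroVertex (map_const_zero z)).mpr hz
  -- The constant diagram `z` is pulled back from the constant chain `z`, `z`, `z` along any
  -- `boxHom`, so it is allowed. A family over the one-point poset is a single diagram.
  obtain ⟨f, hf, e⟩ := exists_eval_eq (W := Unit) (p := IsExDiagram X 2 k) (A := ⊤)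
    (natOn_const z _) c fun w _ =>
      ⟨_, isExDiagram_box (fun _ => true) hX (SSet.const z) (hz' 0) (hz' 2), rfl⟩
  refine ⟨(f.toHom hf).app _ (N.vertex ()), fun v => ?_⟩
  have h := congrFun (congrFun (ofHom_at (f.toHom hf) ()) ⦋0⦌) (OrderHom.const _ v)
  rw [ofHom_toHom] at h
  have h' := h.trans ((e ⦋0⦌ ((slice _ ()).comp (OrderHom.const _ v)) trivial).trans
    (map_const_zero z))
  exact (congrArg IsZeroVertex h').mpr hz

/-- A diagram is allowed if it is an allowed diagram of allowed diagrams. -/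
theorem isExDiagram_succ_iff (hX : IsExact X)
    (hγ : eval (ofHom γ) = (ofHom τ).comp (T.cons 2 k)) :
    IsExDiagram X 2 (k + 1) τ ↔ IsExDiagram (Ex 2 k X) 2 1 γ := by
  constructor
  · intro hτ
    refine ⟨fun x l hl => ?_, fun x s a j j' h h' v => ?_, fun x t i i' a h h' v => ?_,
      fun x r p q h => ?_⟩
    · obtain rfl : l = 0 := Subsingleton.elim _ _
      have hz : ∀ v, IsZeroVertex ((Diag.at γ x).app _ (N.vertex v)) := by
        intro v
        rw [app_vertex_at hγ]
        exact hτ.zero _ 0 hl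
      exact ⟨isInitialVertex_of_eval hX.hasInnerFillers fun v => (hz v).1,
        isTerminalVertex_of_eval fun v => (hz v).2⟩
    · change (γ ≫ ExDiag.ev X v).app _ (N.edge _) ∈ X.cof
      rw [comp_ev_eq hγ, N.map_comp_app_edge]
      have := hτ.horizontal (T.cons 2 k (x, v)) 0 h h'
      rwa [← N.app_edge_congr τ (T.consRight_comp_insert x v s)
        (T.mk_le (h := h) (h' := h.trans h') le_rfl h')] at this
    · change (γ ≫ ExDiag.ev X v).app _ (N.edge _) ∈ X.fib
      rw [comp_ev_eq hγ, N.map_comp_app_edge]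
      have := hτ.vertical (T.cons 2 k (x, v)) 0 h h'
      rwa [← N.app_edge_congr τ (T.consRight_comp_insert x v t)
        (T.mk_le (h := h.trans h') (h' := h') h le_rfl)] at this
    -- From pointwise colimits to colimits of diagrams no restriction on the square is needed.
    · refine isCocartesian_of_ev hX.hasInnerFillers _ fun v => ?_
      exact (congrArg IsCocartesian (square_comp_ev hγ x r h v)).mpr (hτ.cocartesian _ 0 h)
  · intro hγ'
    have hat : ∀ x, IsExDiagram X 2 k (N.map (T.consLeft x) ≫ τ) := fun x => by
      rw [← at_eq hγ]
      exact Diag.prop_at γ x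
    have hcons : ∀ w, w = T.cons 2 k (T.head 2 k w, T.tail 2 k w) := fun w =>
      (T.cons_head_tail w).symm
    have hzero : ∀ (x : Fin 1 → T 2), (x 0).1.1 = (x 0).1.2 → ∀ v,
        IsZeroVertex (τ.app _ (N.vertex (T.cons 2 k (x, v)))) := by
      intro x hx v
      -- A zero object of the category of allowed diagrams is pointwise zero because a pointwise
      -- zero diagram exists.
      obtain ⟨y, hy⟩ := exists_zero_diagram hX (γ.app _ (N.vertex x))
      rw [← app_vertex_at hγ]
      exact isZeroVertex_eval hX.hasInnerFillers hy (hγ'.zero x 0 hx) v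
    have hrow : ∀ (x : Fin 1 → T 2) (v : Fin k → T 2) {a j j' : Fin 3} (h : a ≤ j) (h' : j ≤ j'),
        τ.app _ (N.edge ((T.insert (T.cons 2 k (x, v)) 0).monotone
          (T.mk_le (h := h) (h' := h.trans h') le_rfl h'))) ∈ X.cof := by
      intro x v a j j' h h'
      rw [← N.app_edge_congr τ (T.consRight_comp_insert x v 0)
        (T.mk_le (h := h) (h' := h.trans h') le_rfl h')]
      have := hγ'.horizontal x 0 h h' v
      change (γ ≫ ExDiag.ev X v).app _ (N.edge _) ∈ X.cof at this
      rwa [comp_ev_eq hγ, N.map_comp_app_edge] at this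
    have hcol : ∀ (x : Fin 1 → T 2) (v : Fin k → T 2) {i i' a : Fin 3} (h : i ≤ i') (h' : i' ≤ a),
        τ.app _ (N.edge ((T.insert (T.cons 2 k (x, v)) 0).monotone
          (T.mk_le (h := h.trans h') (h' := h') h le_rfl))) ∈ X.fib := by
      intro x v i i' a h h'
      rw [← N.app_edge_congr τ (T.consRight_comp_insert x v 0)
        (T.mk_le (h := h.trans h') (h' := h') h le_rfl)]
      have := hγ'.vertical x 0 h h' v
      change (γ ≫ ExDiag.ev X v).app _ (N.edge _) ∈ X.fib at this
      rwa [comp_ev_eq hγ, N.map_comp_app_edge] at this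
    refine ⟨fun w l hl => ?_, fun w s a j j' h h' => ?_, fun w t i i' a h h' => ?_,
      fun w r p q h => ?_⟩
    · rw [hcons w] at hl ⊢
      revert hl
      refine Fin.cases (fun hl => ?_) (fun l hl => ?_) l
      · exact hzero _ hl _
      · have := (hat (T.head 2 k w)).zero (T.tail 2 k w) l hl
        rwa [N.map_comp_app_vertex] at this
    · rw [hcons w]
      revert s
      refine Fin.cases (hrow _ _ h h') fun s => ?_
      rw [← N.app_edge_congr τ (T.consLeft_comp_insert (T.head 2 k w) (T.tail 2 k w) s)
        (T.mk_le (h := h) (h' := h.trans h') le_rfl h')]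
      have := (hat (T.head 2 k w)).horizontal (T.tail 2 k w) s h h'
      rwa [N.map_comp_app_edge] at this
    · rw [hcons w]
      revert t
      refine Fin.cases (hcol _ _ h h') fun t => ?_
      rw [← N.app_edge_congr τ (T.consLeft_comp_insert (T.head 2 k w) (T.tail 2 k w) t)
        (T.mk_le (h := h.trans h') (h' := h') h le_rfl)]
      have := (hat (T.head 2 k w)).vertical (T.tail 2 k w) t h h'
      rwa [N.map_comp_app_edge] at this
    · rw [hcons w]
      generalize T.head 2 k w = x
      generalize T.tail 2 k w = v
      revert r
      refine Fin.cases ?_ fun r => ?_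
      -- Degenerate squares are always cocartesian. The remaining case `p = 1`, `q = 2` has the zero
      -- corner `11`, a cofibration on top and a fibration on the right, as `isCocartesian_ev`
      -- requires.
      · rcases T.square_cases' p q h with H | H | ⟨rfl, rfl⟩
        · exact isCocartesian_of_rows hX.hasInnerFillers _
            (fun a c c' => congrArg (T.insert (T.cons 2 k (x, v)) 0) (H a c c')) τ
        · exact isCocartesian_of_columns hX.hasInnerFillers _
            (fun a a' c => congrArg (T.insert (T.cons 2 k (x, v)) 0) (H a a' c)) τ
        · have hsq := square_comp_ev hγ x 0 h
          rw [← hsq]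
          refine isCocartesian_ev hX (N.map ((T.insert x 0).comp (T.square 1 2 h)) ≫ γ) (hγ'.cocartesian x 0 h) (fun v => ?_) (fun v => ?_)
            (fun v => ?_) v
          · rw [hsq, Square.lowerLeft, N.map_comp_app_vertex]
            change IsZeroVertex (τ.app _ (N.vertex (T.insert (T.cons 2 k (x, v)) 0 (T.main (1, 0)))))
            rw [← T.consRight_comp_insert x v 0]
            exact hzero _ rfl v
          · rw [hsq, Square.top, N.map_comp_app_edge]
            exact hrow x v (a := 0) (j := 1) (j' := 2) (by decide) (by decide)
          · rw [hsq, Square.right, N.map_comp_app_edge]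
            exact hcol x v (i := 0) (i' := 1) (a := 2) (by decide) (by decide)
      · rw [← T.consLeft_comp_insert]
        exact (hat x).cocartesian v r h

end

end ExInf

end

noncomputable section

set_option linter.unusedSectionVars false

namespace ExInf

open PMap

/-! ### Currying -/

section

variable {A C Y Z : SSet.{u}}

/-- A map whose values on vertices satisfy `p` factors through the full simplicial subset. -/
def liftFull (f : Y ⟶ Z) (p : Z _⦋0⦌ → Prop) (h : ∀ y : Y _⦋0⦌, p (f.app _ y)) :
    Y ⟶ (fullSub Z p : SSet.{u}) :=
  SSet.Subcomplex.lift f (by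
    rintro d _ ⟨y, rfl⟩ φ
    have := h (Y.map φ.op y)
    rwa [NatTrans.naturality_apply] at this)

lemma val_map_app (f : Y ⟶ Fun A C) {d e : SimplexCategoryᵒᵖ} (φ : d ⟶ e) (y : Y.obj d)
    (a : A.obj e) : Fun.val a ((Fun A C).map φ (f.app d y)) = Fun.val a (f.app e (Y.map φ y)) :=
  congrArg (Fun.val a) (NatTrans.naturality_apply f φ y).symm

lemma Fun.hom_ext {f g : Y ⟶ Fun A C}
    (h : ∀ (d : SimplexCategory) (y : Y.obj (op d)) (a : A.obj (op d)),
      Fun.val a (f.app _ y) = Fun.val a (g.app _ y)) : f = g := by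
  ext ⟨d⟩ y
  apply Fun.ext
  intro e φ a
  exact (val_map_app f φ.op y a).trans ((h e _ a).trans (val_map_app g φ.op y a).symm)

lemma Fun.val_uncurry (f : Y ⟶ Fun A C) {d : SimplexCategoryᵒᵖ} (a : A.obj d) (y : Y.obj d) :
    (MonoidalClosed.uncurry f).app d (a, y) = Fun.val a (f.app d y) := by
  rw [← Fun.val_curry, MonoidalClosed.curry_uncurry]

end

section

variable {C Y : SSet.{u}} {P Q : Type} [PartialOrder P] [PartialOrder Q]
  {p : (N.{u} Q ⟶ C) → Prop} {p' : (N.{u} P ⟶ Diag Q p) → Prop}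

lemma Diag.hom_ext {f g : Y ⟶ Diag Q p}
    (h : ∀ (d : SimplexCategory) (y : Y.obj (op d)) (a : (N.{u} Q).obj (op d)),
      Fun.val a (f.app _ y).1 = Fun.val a (g.app _ y).1) : f = g := by
  have : f ≫ (fullSub _ _).ι = g ≫ (fullSub _ _).ι := Fun.hom_ext h
  exact (cancel_mono _).1 this

lemma eval_toHom (F : (Fun (N.{u} P) (Diag Q p)) _⦋0⦌) {d : SimplexCategory}
    (s : Fin (d.len + 1) →o P × Q) :
    eval (ofHom (Fun.toHom F)) d s = Fun.val (N.simplex (OrderHom.snd.comp s))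
      (Fun.val (N.simplex (OrderHom.fst.comp s))
        ((Fun (N.{u} P) (Diag Q p)).map (SimplexCategory.const d ⦋0⦌ 0).op F)).1 := rfl

/-- Evaluating twice separates maps into diagrams of diagrams; uncurrying the outer variable reduces
this to `Diag.hom_ext`. -/
lemma Diag.hom_ext₂ {f g : Y ⟶ Diag P p'}
    (h : ∀ (d : SimplexCategory) (y : Y.obj (op d)) (a : (N.{u} P).obj (op d))
      (b : (N.{u} Q).obj (op d)),
      Fun.val b (Fun.val a (f.app _ y).1).1 = Fun.val b (Fun.val a (g.app _ y).1).1) : f = g := by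
  have : MonoidalClosed.uncurry (f ≫ (fullSub _ _).ι) =
      MonoidalClosed.uncurry (g ≫ (fullSub _ _).ι) := by
    refine Diag.hom_ext fun d y b => ?_
    obtain ⟨a, y⟩ := y
    refine Eq.trans ?_ ((h d y a b).trans ?_)
    · exact congrArg (fun z : (Diag Q p).obj (op d) => Fun.val b z.1)
        (Fun.val_uncurry (f ≫ (fullSub _ _).ι) a y)
    · exact congrArg (fun z : (Diag Q p).obj (op d) => Fun.val b z.1)
        (Fun.val_uncurry (g ≫ (fullSub _ _).ι) a y).symm
  exact (cancel_mono _).1 (MonoidalClosed.uncurry_injective this)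

end

section

variable {n k : ℕ}

/-- The simplex of `T_n ^ (k + 1)` with given first and remaining coordinates. -/
def N.cons {d : SimplexCategoryᵒᵖ} (x : (N.{u} (Fin 1 → T n)).obj d)
    (y : (N.{u} (Fin k → T n)).obj d) : (N.{u} (Fin (k + 1) → T n)).obj d :=
  N.simplex ((T.cons n k).comp ((N.seq x).prod (N.seq y)))

end

section

variable (k : ℕ) (X : Triple.{u})

/-- The map `(y, x, F) ↦ F(x, y)`. -/
def evalCons : N.{u} (Fin k → T 2) ⊗ (N.{u} (Fin 1 → T 2) ⊗ ExDiag X (k + 1)) ⟶ X.carrier where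
  app d := ↾fun t => Fun.val (N.cons t.2.1 t.1) t.2.2.1
  naturality d e φ := by
    ext t
    exact (Fun.map_val φ (N.cons t.2.1 t.1) t.2.2.1).symm

variable {X} in
lemma toHom_evalCons (t : (N.{u} (Fin 1 → T 2) ⊗ ExDiag X (k + 1)) _⦋0⦌) :
    Fun.toHom ((MonoidalClosed.curry (evalCons k X)).app _ t) =
      N.map (T.consLeft (N.seq t.1 0)) ≫ Fun.toHom t.2.1 := by
  apply ofHom_injective
  funext d s
  change (Fun.toHom _).app _ (N.simplex s) = _
  rw [Fun.toHom_app, val_map_app, Fun.val_curry]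
  rfl

/-- Currying of the first variable, as a map to the allowed diagrams. -/
def curryCons : N.{u} (Fin 1 → T 2) ⊗ ExDiag X (k + 1) ⟶ ExDiag X k :=
  liftFull (MonoidalClosed.curry (evalCons k X)) _ fun t => by
    rw [toHom_evalCons]
    refine IsExDiagram.consLeft ?_ _
    have := t.2.2 (𝟙 _)
    rwa [op_id, Functor.map_id_apply] at this

lemma val_curryCons {d : SimplexCategory} (x : (N.{u} (Fin 1 → T 2)).obj (op d))
    (α : (ExDiag X (k + 1)).obj (op d)) (y : (N.{u} (Fin k → T 2)).obj (op d)) :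
    Fun.val y ((curryCons k X).app _ (x, α)).1 = Fun.val (N.cons x y) α.1 :=
  Fun.val_curry (evalCons k X) y (x, α)

variable {X} in
lemma prop_toHom (α : (ExDiag X k) _⦋0⦌) : IsExDiagram X 2 k (Fun.toHom α.1) := by
  have := α.2 (𝟙 _)
  rwa [op_id, Functor.map_id_apply] at this

/-- The allowed diagrams of allowed diagrams. -/
abbrev ExDiag₂ : SSet.{u} := Diag (Fin 1 → T 2) (IsExDiagram (Ex 2 k X) 2 1)

variable {X} in
lemma eval_toHom_curryCons (α : (ExDiag X (k + 1)) _⦋0⦌) :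
    eval (ofHom (Fun.toHom ((MonoidalClosed.curry (curryCons k X)).app _ α))) =
      (ofHom (Fun.toHom α.1)).comp (T.cons 2 k) := by
  funext d s
  rw [eval_toHom, val_map_app, Fun.val_curry, val_curryCons]
  rfl

variable {X} in
/-- The map `R` that curries the first variable. -/
def curryEx (hX : IsExact X) : ExDiag X (k + 1) ⟶ ExDiag₂ k X :=
  liftFull (MonoidalClosed.curry (curryCons k X)) _ fun α =>
    (isExDiagram_succ_iff hX (eval_toHom_curryCons k α)).1 (prop_toHom _ α)

variable {X} in
lemma val_curryEx (hX : IsExact X) {d : SimplexCategory} (α : (ExDiag X (k + 1)).obj (op d))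
    (x : (N.{u} (Fin 1 → T 2)).obj (op d)) (y : (N.{u} (Fin k → T 2)).obj (op d)) :
    Fun.val y (Fun.val x ((curryEx k hX).app _ α).1).1 = Fun.val (N.cons x y) α.1 :=
  (congrArg (fun z : (ExDiag X k).obj (op d) => Fun.val y z.1)
    (Fun.val_curry (curryCons k X) x α)).trans (val_curryCons k X x α y)

/-- The map `(w, F) ↦ F(x)(y)`, where `x` is the first coordinate of `w` and `y` consists of the
remaining coordinates. -/
def evalHeadTail : N.{u} (Fin (k + 1) → T 2) ⊗ ExDiag₂ k X ⟶ X.carrier where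
  app d := ↾fun t => Fun.val ((N.map (T.tail 2 k)).app d t.1)
    (Fun.val ((N.map (T.head 2 k)).app d t.1) t.2.1).1
  naturality d e φ := by
    ext t
    refine Eq.trans ?_ (Fun.map_val φ ((N.map (T.tail 2 k)).app d t.1)
      (Fun.val ((N.map (T.head 2 k)).app d t.1) t.2.1).1).symm
    exact congrArg (fun z : (ExDiag X k).obj e => Fun.val _ z.1)
      (Fun.map_val φ ((N.map (T.head 2 k)).app d t.1) t.2.1).symm

variable {X} in
-- This is the compatibility that `isExDiagram_succ_iff` asks for, now read from the curried side;
-- it shows that uncurrying produces allowed diagrams.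
lemma eval_toHom_uncurry (β : (ExDiag₂ k X) _⦋0⦌) :
    eval (ofHom (Fun.toHom β.1)) =
      (ofHom (Fun.toHom ((MonoidalClosed.curry (evalHeadTail k X)).app _ β))).comp
        (T.cons 2 k) := by
  funext d s
  change _ = (Fun.toHom _).app _ (N.simplex ((T.cons 2 k).comp s))
  rw [Fun.toHom_app, val_map_app, Fun.val_curry]
  have h : (N.map.{u} (T.head 2 k)).app _ (N.simplex ((T.cons 2 k).comp s)) =
      N.simplex (OrderHom.fst.comp s) := by
    rw [N.map_app_simplex]
    congr 1
    ext i : 2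
    exact T.head_cons (s i)
  refine (eval_toHom (p := IsExDiagram X 2 k) β.1 s).trans ?_
  rw [← h]
  rfl

variable {X} in
/-- The inverse of `R`. -/
def uncurryEx (hX : IsExact X) : ExDiag₂ k X ⟶ ExDiag X (k + 1) :=
  liftFull (MonoidalClosed.curry (evalHeadTail k X)) _ fun β => by
    refine (isExDiagram_succ_iff hX (eval_toHom_uncurry k β)).2 ?_
    have := β.2 (𝟙 _)
    rwa [op_id, Functor.map_id_apply] at this

variable {X} in
lemma val_uncurryEx (hX : IsExact X) {d : SimplexCategory} (β : (ExDiag₂ k X).obj (op d))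
    (w : (N.{u} (Fin (k + 1) → T 2)).obj (op d)) :
    Fun.val w ((uncurryEx k hX).app _ β).1 = Fun.val ((N.map (T.tail 2 k)).app _ w)
      (Fun.val ((N.map (T.head 2 k)).app _ w) β.1).1 :=
  Fun.val_curry (evalHeadTail k X) w β

lemma N.cons_head_tail {d : SimplexCategory} (w : (N.{u} (Fin (k + 1) → T 2)).obj (op d)) :
    N.cons ((N.map (T.head 2 k)).app _ w) ((N.map (T.tail 2 k)).app _ w) = w := by
  obtain ⟨s, rfl⟩ : ∃ s, N.simplex s = w := ⟨N.seq w, rfl⟩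
  refine congrArg N.simplex ?_
  ext i : 2
  exact T.cons_head_tail (s i)

lemma N.head_cons {d : SimplexCategory} (x : (N.{u} (Fin 1 → T 2)).obj (op d))
    (y : (N.{u} (Fin k → T 2)).obj (op d)) : (N.map (T.head 2 k)).app _ (N.cons x y) = x := by
  have h : (T.head 2 k).comp ((T.cons 2 k).comp ((N.seq x).prod (N.seq y))) = N.seq x := by
    ext i : 2
    exact T.head_cons (N.seq x i, N.seq y i)
  exact congrArg (fun s : Fin (d.len + 1) →o (Fin 1 → T 2) => N.simplex.{u} s) h

lemma N.tail_cons {d : SimplexCategory} (x : (N.{u} (Fin 1 → T 2)).obj (op d))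
    (y : (N.{u} (Fin k → T 2)).obj (op d)) : (N.map (T.tail 2 k)).app _ (N.cons x y) = y := rfl

variable {X}

lemma curryEx_uncurryEx (hX : IsExact X) : curryEx k hX ≫ uncurryEx k hX = 𝟙 _ := by
  refine Diag.hom_ext fun d α w => ?_
  refine (val_uncurryEx k hX _ w).trans ((val_curryEx k hX α _ _).trans ?_)
  rw [N.cons_head_tail]
  rfl

lemma uncurryEx_curryEx (hX : IsExact X) : uncurryEx k hX ≫ curryEx k hX = 𝟙 _ := by
  refine Diag.hom_ext₂ fun d β x y => ?_
  refine (val_curryEx k hX _ x y).trans ((val_uncurryEx k hX β _).trans ?_)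
  rw [N.head_cons, N.tail_cons]
  rfl

lemma natEquivalent_refl {Y Z : SSet.{u}} (f : Y ⟶ Z) : NatEquivalent f f :=
  ⟨fst _ _ ≫ f, by simp, by simp⟩

/-- For a strict inverse the natural equivalences can be taken constant along the walking
isomorphism. -/
lemma isCategoricalEquivalence_of_inverse {Y Z : SSet.{u}} {f : Y ⟶ Z} {g : Z ⟶ Y}
    (h : f ≫ g = 𝟙 _) (h' : g ≫ f = 𝟙 _) : IsCategoricalEquivalence f :=
  ⟨g, h ▸ natEquivalent_refl _, h' ▸ natEquivalent_refl _⟩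

lemma isCurrying_curryEx (hX : IsExact X) : IsCurrying 2 (k + 1) X (curryEx (k + 1) hX) := by
  ext ⟨d⟩ ⟨w, α⟩
  exact (val_curryEx (k + 1) hX α ((N.map (T.head 2 (k + 1))).app _ w)
    ((N.map (T.tail 2 (k + 1))).app _ w)).trans
    (congrArg (fun y => Fun.val y α.1) (N.cons_head_tail (k + 1) w))

/-- With no remaining coordinates both sides are the same simplicial set, and taking the first
coordinate is the identity of `T_2 ^ 1`. -/
lemma isCurrying_id : IsCurrying 2 0 X (𝟙 _) := by
  ext ⟨d⟩ ⟨w, α⟩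
  have h : (T.head 2 0).comp (N.seq w) = N.seq w := by
    ext i : 2
    funext j
    exact congrArg (N.seq w i) (Subsingleton.elim 0 j)
  exact congrArg (fun s : Fin (d.len + 1) →o (Fin 1 → T 2) => Fun.val (N.simplex s) α.1) h

end

end ExInf

end

theorem mainTheorem3 (X : ExInf.Triple.{u}) (hX : ExInf.IsExact X) (n : ℕ) :
    ∃ R : (ExInf.S 2 (n + 1) X).carrier ⟶ (ExInf.S 2 1 (ExInf.S 2 n X)).carrier,
      ExInf.IsCurrying 2 n X R ∧ ExInf.IsCategoricalEquivalence R := by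
  cases n with
  | zero =>
    exact ⟨𝟙 _, ExInf.isCurrying_id,
      ExInf.isCategoricalEquivalence_of_inverse (Category.comp_id _) (Category.comp_id _)⟩
  | succ k =>
    exact ⟨ExInf.curryEx (k + 1) hX, ExInf.isCurrying_curryEx k hX,
      ExInf.isCategoricalEquivalence_of_inverse (ExInf.curryEx_uncurryEx (k + 1) hX)
        (ExInf.uncurryEx_curryEx (k + 1) hX)⟩
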